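/- **Conventions.** Let $G$ be an unweighted graph and let $P=(p_1,\dots,p_n)$, $Q=(q_1,\dots,q_m)$ be paths in $G$ (consecutive vertices are adjacent, no vertex is repeated). A *monotone walk* is a finite sequence of index pairs from $(1,1)$ to $(n,m)$ in which, from one pair to the next, each of the two indices stays or increases by one. The *discrete Fréchet distance* is $D_F(P,Q)=\min_F\max_{(i,j)\in F}\operatorname{dist}_G(p_i,q_j)$, where $F$ ranges over the monotone walks and $\operatorname{dist}_G$ is the shortest-path distance. An algorithm *approximates $D_F$ within a factor $c\ge 1$* if it outputs a rational number $v$ with $D_F(P,Q)\le v\le c\,D_F(P,Q)$. Algorithms are deterministic word RAM programs with words of $O(\log L)$ bits, where $L$ is the input length in words; graphs are given by edge lists. *Orthogonal Vector Hypothesis.* For $\gamma>0$, let $\mathrm{OVH}_\gamma$ be the statement: for every $\delta>0$ there is a constant $\omega>0$ such that no algorithm decides, for all $n\ge1$, $m=\lceil n^\gamma\rceil$, $d=\lceil\omega\log n\rceil$ and all $u^{(1)},\dots,u^{(n)},w^{(1)},\dots,w^{(m)}\in\{0,1\}^d$, in $O((nm)^{1-\delta})$ time whether some $u^{(i)}$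 is orthogonal to some $w^{(j)}$. The hypothesis OVH states that $\mathrm{OVH}_\gamma$ holds for some constant $\gamma\in(0,1)$. **Theorem.** There is an absolute constant $K$ such that the following holds. For $\gamma>0$, $\delta\in(0,1)$ and $1\le c<1.25$, let $\mathcal H(\gamma,\delta,c)$ be the statement: no algorithm approximates, within the factor $c$ and in $O((nm)^{1-\delta})$ time, the discrete Fréchet distance $D_F(P,Q)$ for all paths $P,Q$ with $|P|=n\ge1$ and $|Q|=m=\lceil n^\gamma\rceil$ vertices in an unweighted planar graph; and this is so even if the algorithm only has to handle connected planar graphs with at most $K(n+m)$ vertices. 1. Unless OVH fails, $\mathcal H(\gamma,\delta,c)$ holds for every rational $\gamma>0$, every $\delta\in(0,1)$ and every $1\le c<1.25$. 2. For every real $\gamma>0$: unless $\mathrm{OVH}_\gamma$ fails, $\mathcal H(\gamma,\delta,c)$ holds for every $\delta\in(0,1)$ and every $1\le c<1.25$. -/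

import Mathlib

/-! ### Discrete Fréchet distance of paths in an unweighted graph -/

/-- `p` visits the vertices `p 0, …, p (n - 1)` of a path in `G`: consecutive vertices are adjacent
and no vertex is visited twice. -/
def IsGraphPath {V : Type*} (G : SimpleGraph V) {n : ℕ} (p : Fin n → V) : Prop :=
  Function.Injective p ∧ ∀ i j : Fin n, (j : ℕ) = i + 1 → G.Adj (p i) (p j)

/-- One step of a monotone walk: each of the two indices stays or advances by one. -/
def MonotoneStep {n m : ℕ} (s t : Fin n × Fin m) : Prop :=
  ((t.1 : ℕ) = s.1 ∨ (t.1 : ℕ) = s.1 + 1) ∧ ((t.2 : ℕ) = s.2 ∨ (t.2 : ℕ) = s.2 + 1)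

/-- Monotone walks from the first pair of indices to the last one (indices start at `0`). -/
def IsMonotoneWalk {n m : ℕ} (F : List (Fin n × Fin m)) : Prop :=
  F.IsChain MonotoneStep ∧
    (∃ s ∈ F.head?, (s.1 : ℕ) = 0 ∧ (s.2 : ℕ) = 0) ∧
    (∃ t ∈ F.getLast?, (t.1 : ℕ) + 1 = n ∧ (t.2 : ℕ) + 1 = m)

/-- The discrete Fréchet distance with respect to the shortest-path distance of `G`
(which is `⊤` between vertices in different components). -/
noncomputable def discreteFrechet {V : Type*} (G : SimpleGraph V) {n m : ℕ}
    (p : Fin n → V) (q : Fin m → V) : ℕ∞ :=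
  ⨅ (F : List (Fin n × Fin m)) (_ : IsMonotoneWalk F), ⨆ s ∈ F, G.edist (p s.1) (q s.2)

/-! ### Planar graphs -/

/-- `A` is an arc in the plane with end points `x` and `y`. -/
def IsPlaneArc (A : Set (ℝ × ℝ)) (x y : ℝ × ℝ) : Prop :=
  ∃ f : ℝ → ℝ × ℝ, ContinuousOn f (Set.Icc 0 1) ∧ Set.InjOn f (Set.Icc 0 1) ∧
    f 0 = x ∧ f 1 = y ∧ f '' Set.Icc 0 1 = A

/-- `G` has a drawing in the plane: vertices are distinct points, edges are arcs between their end
vertices that contain no other vertex, and distinct edges meet at most in common end vertices. -/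
def IsPlanar {V : Type*} (G : SimpleGraph V) : Prop :=
  ∃ (pos : V → ℝ × ℝ) (arc : Sym2 V → Set (ℝ × ℝ)),
    Function.Injective pos ∧
    (∀ u v, G.Adj u v → IsPlaneArc (arc s(u, v)) (pos u) (pos v)) ∧
    (∀ e ∈ G.edgeSet, ∀ w, pos w ∈ arc e → w ∈ e) ∧
    (∀ e ∈ G.edgeSet, ∀ f ∈ G.edgeSet, e ≠ f →
      ∀ x ∈ arc e ∩ arc f, ∃ w, w ∈ e ∧ w ∈ f ∧ pos w = x)

/-! ### The word RAM

Programs act on word-sized registers and on a word-addressed memory.  They are built from the usual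
unit-cost instructions of a word RAM by sequencing, branching and loops. -/

namespace WordRAM

/-- Word operations. -/
inductive Op
  | add | sub | mul | div | mod | land | lor | xor | shl | shr | lt | eq

/-- Subtraction is truncated at `0`, division by `0` gives `0`, comparisons give `1` or `0`. -/
def Op.eval : Op → ℕ → ℕ → ℕ
  | .add, a, b => a + b
  | .sub, a, b => a - b
  | .mul, a, b => a * b
  | .div, a, b => a / b
  | .mod, a, b => a % b
  | .land, a, b => a &&& b
  | .lor, a, b => a ||| b
  | .xor, a, b => a ^^^ b
  | .shl, a, b => a <<< b
  | .shr, a, b => a >>> b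
  | .lt, a, b => if a < b then 1 else 0
  | .eq, a, b => if a = b then 1 else 0

/-- Programs.  Natural numbers `r`, `a`, `b` below are names of registers. -/
inductive Prog
  /-- do nothing -/
  | skip
  /-- `r := v` -/
  | const (r v : ℕ)
  /-- `r := o a b` -/
  | op (o : Op) (r a b : ℕ)
  /-- `r := memory[a]` -/
  | load (r a : ℕ)
  /-- `memory[a] := r` -/
  | store (a r : ℕ)
  /-- first `P`, then `Q` -/
  | seq (P Q : Prog)
  /-- if `r ≠ 0` then `P` else `Q` -/
  | ite (r : ℕ) (P Q : Prog)
  /-- while `r ≠ 0` do `P` -/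
  | loop (r : ℕ) (P : Prog)

/-- Contents of the registers and of the memory. -/
structure State where
  reg : ℕ → ℕ
  mem : ℕ → ℕ

/-- Write `v` into register `r`. -/
def State.setReg (s : State) (r v : ℕ) : State := ⟨Function.update s.reg r v, s.mem⟩

/-- Write `v` into the memory cell with address `x`. -/
def State.setMem (s : State) (x v : ℕ) : State := ⟨s.reg, Function.update s.mem x v⟩

/-- `Exec B P s t s'`: started in state `s`, the program `P` halts after exactly `t` steps in state
`s'`, and every number it writes on the way is smaller than `B`.  (So `B` is the bound imposed by
the word size; a computation that overflows a word is not a valid one.) -/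
inductive Exec (B : ℕ) : Prog → State → ℕ → State → Prop
  | skip (s : State) : Exec B .skip s 1 s
  | const (s : State) (r v : ℕ) : v < B → Exec B (.const r v) s 1 (s.setReg r v)
  | op (s : State) (o : Op) (r a b : ℕ) : o.eval (s.reg a) (s.reg b) < B →
      Exec B (.op o r a b) s 1 (s.setReg r (o.eval (s.reg a) (s.reg b)))
  | load (s : State) (r a : ℕ) : s.mem (s.reg a) < B →
      Exec B (.load r a) s 1 (s.setReg r (s.mem (s.reg a)))
  | store (s : State) (a r : ℕ) : s.reg r < B →
      Exec B (.store a r) s 1 (s.setMem (s.reg a) (s.reg r))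
  | seq {P Q : Prog} {s s₁ s₂ : State} {t₁ t₂ : ℕ} :
      Exec B P s t₁ s₁ → Exec B Q s₁ t₂ s₂ → Exec B (.seq P Q) s (t₁ + t₂) s₂
  | ite_true {P Q : Prog} {s s' : State} {r t : ℕ} :
      s.reg r ≠ 0 → Exec B P s t s' → Exec B (.ite r P Q) s (t + 1) s'
  | ite_false {P Q : Prog} {s s' : State} {r t : ℕ} :
      s.reg r = 0 → Exec B Q s t s' → Exec B (.ite r P Q) s (t + 1) s'
  | loop_done {P : Prog} {s : State} {r : ℕ} : s.reg r = 0 → Exec B (.loop r P) s 1 s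
  | loop_step {P : Prog} {s s₁ s₂ : State} {r t₁ t₂ : ℕ} :
      s.reg r ≠ 0 → Exec B P s t₁ s₁ → Exec B (.loop r P) s₁ t₂ s₂ →
      Exec B (.loop r P) s (t₁ + t₂ + 1) s₂

/-- The input stands at the addresses `0, 1, 2, …`; everything else is `0`. -/
def initState (x : List ℕ) : State := ⟨fun _ => 0, fun i => x.getD i 0⟩

/-- On the input `x` the program `P` halts within `T` steps in a state that satisfies `post`, with
words of `k * log₂ (x.length + 2)` bits: all numbers stay below `(x.length + 2) ^ k`. -/
def RunsWithin (P : Prog) (k : ℕ) (x : List ℕ) (T : ℝ) (post : State → Prop) : Prop :=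
  ∃ (t : ℕ) (s : State), Exec ((x.length + 2) ^ k) P (initState x) t s ∧ (t : ℝ) ≤ T ∧ post s

end WordRAM

/-! ### Orthogonal vectors -/

/-- Some `U i` is orthogonal to some `W j`. -/
def HasOrthogonalPair {n m d : ℕ} (U : Fin n → Fin d → Bool) (W : Fin m → Fin d → Bool) : Prop :=
  ∃ i j, ∀ k, (U i k && W j k) = false

/-- Encoding of an instance: the sizes `n, m, d`, followed by the bits of all vectors. -/
def encodeOV {n m d : ℕ} (U : Fin n → Fin d → Bool) (W : Fin m → Fin d → Bool) : List ℕ :=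
  [n, m, d] ++ (List.ofFn fun i => List.ofFn fun k => (U i k).toNat).flatten
    ++ (List.ofFn fun j => List.ofFn fun k => (W j k).toNat).flatten

open Classical in
/-- The orthogonal vectors problem with `n ≥ 1` and `m = ⌈n ^ γ⌉` vectors of dimension
`d = ⌈ω log n⌉` is solved by a word RAM program in time `O((n m) ^ (1 - δ))`;
the answer is left in register `0`. -/
def OVSolvable (ω γ δ : ℝ) : Prop :=
  ∃ (A : WordRAM.Prog) (k : ℕ) (C : ℝ), ∀ (n m d : ℕ), 1 ≤ n → m = ⌈(n : ℝ) ^ γ⌉₊ →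
    d = ⌈ω * Real.log n⌉₊ → ∀ (U : Fin n → Fin d → Bool) (W : Fin m → Fin d → Bool),
      WordRAM.RunsWithin A k (encodeOV U W) (C * ((n : ℝ) * m) ^ (1 - δ))
        fun s => s.reg 0 = if HasOrthogonalPair U W then 1 else 0

/-- The orthogonal vector hypothesis for sets of sizes `n` and `n ^ γ`. -/
def OVHAt (γ : ℝ) : Prop := ∀ δ : ℝ, 0 < δ → ∃ ω : ℝ, 0 < ω ∧ ¬ OVSolvable ω γ δ

/-- The orthogonal vector hypothesis. -/
def OVH : Prop := ∃ γ : ℝ, 0 < γ ∧ γ < 1 ∧ OVHAt γ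

/-! ### Approximating the Fréchet distance of paths in planar graphs -/

/-- An input: a connected planar graph on `N` vertices, given by a list in which every edge occurs
exactly once, and two nonempty paths, with `n` and `m` vertices. -/
structure PlanarPathPair where
  (N n m : ℕ)
  G : SimpleGraph (Fin N)
  planar : IsPlanar G
  connected : G.Connected
  edges : List (Fin N × Fin N)
  mem_edges : ∀ u v, G.Adj u v ↔ (u, v) ∈ edges ∨ (v, u) ∈ edges
  nodup_edges : (edges.map fun e => s(e.1, e.2)).Nodup
  P : Fin n → Fin N
  Q : Fin m → Fin N
  one_le_n : 1 ≤ n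
  one_le_m : 1 ≤ m
  isPath_P : IsGraphPath G P
  isPath_Q : IsGraphPath G Q

/-- Encoding of an input: the four sizes, the edge list, and the vertex sequences of the paths. -/
def PlanarPathPair.encode (I : PlanarPathPair) : List ℕ :=
  [I.N, I.edges.length, I.n, I.m] ++ (I.edges.map fun e => [(e.1 : ℕ), (e.2 : ℕ)]).flatten
    ++ (List.ofFn fun i => (I.P i : ℕ)) ++ (List.ofFn fun j => (I.Q j : ℕ))

/-- The Fréchet distance of the two paths. -/
noncomputable def PlanarPathPair.frechet (I : PlanarPathPair) : ℕ∞ := discreteFrechet I.G I.P I.Q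

/-- Some word RAM program computes, for all pairs of paths with `n` and `m = ⌈n ^ γ⌉` vertices in a
connected planar graph with at most `K * (n + m)` vertices, a `c`-approximation `v` of their Fréchet
distance `f`, i.e. `f ≤ v ≤ c * f`, in time `O((n m) ^ (1 - δ))`.  The rational number `v` is left
as a numerator in register `0` and a positive denominator in register `1`. -/
def FrechetApproximable (K : ℕ) (γ δ c : ℝ) : Prop :=
  ∃ (A : WordRAM.Prog) (k : ℕ) (C : ℝ), ∀ I : PlanarPathPair,
    I.m = ⌈(I.n : ℝ) ^ γ⌉₊ → I.N ≤ K * (I.n + I.m) →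
      WordRAM.RunsWithin A k I.encode (C * ((I.n : ℝ) * I.m) ^ (1 - δ))
        fun s => ∃ f : ℕ, I.frechet = f ∧ 0 < s.reg 1 ∧
          (f : ℝ) ≤ (s.reg 0 : ℝ) / s.reg 1 ∧ (s.reg 0 : ℝ) / s.reg 1 ≤ c * f

/-! An instance of orthogonal vectors is turned into two paths whose Fréchet distance is at most `4`
if some pair is orthogonal and at least `5` otherwise. Since `c < 5/4`, the approximate value is
below `5` exactly in the first case.

The graph has two adjacent hubs. Every vertex of the first path and every inner vertex of the second
hangs on a hub by a spoke of length 1, 2 or 3; the second path starts at hub `0` and ends at hub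
`1`. The two paths are joined only through the hubs, so closeness is read off from sums of distances
to a common hub (`Gadget.lab_le`). These lower bounds come from 1-Lipschitz potentials
(`Spokes.le_of_near`); an explicit drawing proves planarity (`Spokes.planar`).

Each vector is a gadget of `4 * d + 6` vertices. In the first path a gadget begins at distance 1
from hub `0`, ends at distance 1 from hub `1`, and has distance 2 or 3 from hub `0` at a coordinate,
according to the bit; in the second path the distance there is 1 or 2. Two bits thus clash, with sum
5, exactly if both are 1. Markers on hub `1` between the coordinates keep the traversals in step.
The ends of the gadgets of the second path have distance 3 from both hubs, so the interior of a
gadget of the first path is close only to the interior of a gadget of the second.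

If a pair is orthogonal, the first path walks to its vector while the second waits at hub `0`, the
second walks to its vector, both gadgets are traversed synchronously, the second runs to hub `1`,
and the first follows (`Gadget.reach_end`). If no pair is orthogonal, the vertex `3` of the second
path forces the first path to stand at the start of a gadget, and the tail of the second path would
require it to have reached the end of a gadget or the padding. On the way through, a common
coordinate costs the first path a full marker period that it can never regain
(`Gadget.Behind.step`), so it gets stuck (`Gadget.Reachable.step`).

The lengths of the paths are tied by `m' = ⌈n' ^ γ⌉` and need not fit the given numbers of vectors.
The vectors are therefore cut into blocks that fit, and the approximation is called for every pair
of blocks. Each call runs a relocated copy of the program in a fresh memory window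
(`Runs.callProg`). If `n'` and `m'` are at least a constant times `n ^ ε`, each call saves a power
of `n`, which outweighs the logarithmic gadget lengths (`calls_time_le`, `total_time_le`); hence
`ovSolvable_of_selection`. For equal exponents the lengths are essentially `n` and `m`
(`hasSelection_same`); for a rational exponent `a / b` they are `t ^ b` and `t ^ a`, so that no
rounding of real powers has to be computed (`hasSelection_rat`). -/

namespace WordRAM

/-! ### Expressions and structured programs on the word RAM -/

/-- Registers in which compiled expressions keep their intermediate values. -/
def Scratch (r : ℕ) : Prop := 30 ≤ r ∧ r < 50

instance (r : ℕ) : Decidable (Scratch r) := inferInstanceAs (Decidable (_ ∧ _))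

/-- Arithmetic expressions in registers and memory cells. -/
inductive Expr
  | lit (v : ℕ)
  | var (r : ℕ)
  | op (o : Op) (e f : Expr)
  | load (e : Expr)

namespace Expr

def eval (s : State) : Expr → ℕ
  | lit v => v
  | var r => s.reg r
  | op o e f => o.eval (e.eval s) (f.eval s)
  | load e => s.mem (e.eval s)

/-- Code that computes the expression into register `d`, using registers `≥ d`. -/
def code : Expr → ℕ → Prog
  | lit v, d => .const d v
  | var r, d => .op .lor d r r
  | op o e f, d => .seq (e.code d) (.seq (f.code (d + 1)) (.op o d d (d + 1)))
  | load e, d => .seq (e.code d) (.load d d)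

def cost : Expr → ℕ
  | lit _ => 1
  | var _ => 1
  | op _ e f => e.cost + (f.cost + 1)
  | load e => e.cost + 1

/-- Number of leaves. -/
def deg : Expr → ℕ
  | lit _ => 1
  | var _ => 1
  | op _ e f => e.deg + f.deg
  | load e => e.deg

/-- Number of scratch registers used by `Expr.code`. -/
def width : Expr → ℕ
  | lit _ => 1
  | var _ => 1
  | op _ e f => max e.width (f.width + 1)
  | load e => e.width

/-- Operations whose results are not much longer than the arguments. -/
def _root_.WordRAM.Op.plain : Op → Bool
  | .shl | .lor | .xor => false
  | _ => true

/-- Literals are at most `16`, no scratch register occurs, and the operations are plain. -/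
def plain : Expr → Bool
  | lit v => v ≤ 16
  | var r => r < 30 || 50 ≤ r
  | op o e f => o.plain && e.plain && f.plain
  | load e => e.plain

/-- The degree bound keeps all intermediate values below `W ^ 100`, and the width bound lets the
code start at register `30` or `31` without leaving the scratch range. -/
def wf (e : Expr) : Bool := e.plain && e.deg ≤ 100 && e.width ≤ 17

lemma one_le_deg : ∀ e : Expr, 1 ≤ e.deg
  | lit _ => le_rfl
  | var _ => le_rfl
  | op _ e _ => (one_le_deg e).trans (Nat.le_add_right _ _)
  | load e => one_le_deg e

end Expr

/-- Agreement of two states outside the scratch registers. -/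
def Sim (s σ : State) : Prop := s.mem = σ.mem ∧ ∀ r, ¬ Scratch r → s.reg r = σ.reg r

/-- Contents of memory and of non-scratch registers are at most `W`. -/
def Bounded (W : ℕ) (σ : State) : Prop :=
  16 ≤ W ∧ (∀ r, ¬ Scratch r → σ.reg r ≤ W) ∧ ∀ x, σ.mem x ≤ W

/-- The sum of two numbers that are at least 2 is at most their product, so the degree bound for
products also covers sums. The remaining plain operations do not exceed an argument or 1. -/
lemma Op.eval_le_mul {W a b p q : ℕ} (o : Op) (ho : o.plain = true)
    (hW : 2 ≤ W) (hp : 1 ≤ p) (hq : 1 ≤ q) (ha : a ≤ W ^ p) (hb : b ≤ W ^ q) :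
    o.eval a b ≤ W ^ (p + q) := by
  have h1 : W ≤ W ^ p := Nat.le_self_pow (by omega) W
  have h2 : W ≤ W ^ q := Nat.le_self_pow (by omega) W
  have hs : W ^ p + W ^ q ≤ W ^ (p + q) := by
    rw [pow_add]; nlinarith
  have h0 : a + b ≤ W ^ (p + q) := by omega
  cases o with
  | add => exact h0
  | sub => exact (Nat.sub_le a b).trans (by omega)
  | mul => rw [pow_add]; exact Nat.mul_le_mul ha hb
  | div => exact (Nat.div_le_self a b).trans (by omega)
  | mod => exact (Nat.mod_le a b).trans (by omega)
  | land => exact Nat.and_le_left.trans (by omega)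
  | lor => simp [plain] at ho
  | xor => simp [plain] at ho
  | shl => simp [plain] at ho
  | shr => exact (Nat.shiftRight_le a b).trans (by omega)
  | lt => simp only [Op.eval]; split_ifs <;> omega
  | eq => simp only [Op.eval]; split_ifs <;> omega

lemma Expr.eval_le {W : ℕ} {σ : State} (hσ : Bounded W σ) :
    ∀ e : Expr, e.plain = true → e.eval σ ≤ W ^ e.deg
  | lit v, h => by
    have := hσ.1
    simp only [plain, decide_eq_true_eq] at h
    simp only [eval, deg, pow_one]; omega
  | var r, h => by
    simp only [plain, Bool.or_eq_true, decide_eq_true_eq] at h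
    simpa [eval, deg] using hσ.2.1 r (by unfold Scratch; omega)
  | op o e f, h => by
    simp only [plain, Bool.and_eq_true] at h
    have := hσ.1
    exact Op.eval_le_mul o h.1.1 (by omega) e.one_le_deg f.one_le_deg (eval_le hσ e h.1.2)
      (eval_le hσ f h.2)
  | load e, h => by
    have h1 := hσ.1
    exact (hσ.2.2 _).trans (Nat.le_self_pow (by have := e.one_le_deg; simp only [deg]; omega) W)

/-- The second operand is evaluated one register higher; the final clause on registers below `d` is
what preserves the first operand meanwhile. -/
lemma Exec.code {W B : ℕ} {σ : State} (hσ : Bounded W σ) :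
    ∀ (e : Expr) (d : ℕ) (s : State), e.plain = true → 30 ≤ d → d + e.width ≤ 50 → W ^ e.deg < B →
      Sim s σ → ∃ s', Exec B (e.code d) s e.cost s' ∧ Sim s' σ ∧ s'.reg d = e.eval σ ∧
        ∀ r < d, s'.reg r = s.reg r
  | .lit v, d, s, h, hd, hw, hB, hs => by
    refine ⟨_, .const s d v ((Expr.eval_le hσ (.lit v) h).trans_lt hB), ⟨hs.1, fun r hr => ?_⟩, ?_,
      fun r hr => ?_⟩
    · simp only [Expr.width] at hw
      have : r ≠ d := by rintro rfl; exact hr ⟨hd, by omega⟩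
      simp [State.setReg, this, hs.2 r hr]
    · simp [State.setReg, Expr.eval]
    · simp [State.setReg, hr.ne]
  | .var q, d, s, h, hd, hw, hB, hs => by
    have hq : s.reg q = σ.reg q := by
      simp only [Expr.plain, Bool.or_eq_true, decide_eq_true_eq] at h
      exact hs.2 q (by unfold Scratch; omega)
    refine ⟨_, .op s .lor d q q ?_, ⟨hs.1, fun r hr => ?_⟩, ?_,
      fun r hr => ?_⟩
    · simp only [Op.eval, Nat.or_self, hq]
      exact (Expr.eval_le hσ (.var q) h).trans_lt hB
    · simp only [Expr.width] at hw
      have : r ≠ d := by rintro rfl; exact hr ⟨hd, by omega⟩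
      simp [State.setReg, this, hs.2 r hr]
    · simp [State.setReg, Expr.eval, Op.eval, hq]
    · simp [State.setReg, hr.ne]
  | .op o e f, d, s, h, hd, hw, hB, hs => by
    have hle := Expr.eval_le hσ (.op o e f) h
    simp only [Expr.plain, Bool.and_eq_true] at h
    simp only [Expr.width] at hw
    simp only [Expr.deg] at hB
    have hW := hσ.1
    obtain ⟨s₁, h1, h2, h3, h4⟩ := Exec.code hσ e d s h.1.2 hd (by omega)
      ((Nat.pow_le_pow_right (by omega) (by omega)).trans_lt hB) hs
    obtain ⟨s₂, k1, k2, k3, k4⟩ := Exec.code hσ f (d + 1) s₁ h.2 (by omega) (by omega)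
      ((Nat.pow_le_pow_right (by omega) (by omega)).trans_lt hB) h2
    have e1 : s₂.reg d = e.eval σ := by rw [k4 d (by omega), h3]
    refine ⟨_, .seq h1 (.seq k1 (.op s₂ o d d (d + 1) ?_)), ⟨k2.1, fun r hr => ?_⟩, ?_,
      fun r hr => ?_⟩
    · rw [e1, k3]; exact hle.trans_lt hB
    · have : r ≠ d := by rintro rfl; exact hr ⟨hd, by omega⟩
      simp [State.setReg, this, k2.2 r hr]
    · simp [State.setReg, e1, k3, Expr.eval]
    · simp [State.setReg, hr.ne, k4 r (by omega), h4 r hr]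
  | .load e, d, s, h, hd, hw, hB, hs => by
    simp only [Expr.plain] at h
    simp only [Expr.width] at hw
    simp only [Expr.deg] at hB
    have hW := hσ.1
    obtain ⟨s₁, h1, h2, h3, h4⟩ := Exec.code hσ e d s h hd hw hB hs
    have hm : s₁.mem (s₁.reg d) = σ.mem (e.eval σ) := by rw [h2.1, h3]
    refine ⟨_, .seq h1 (.load s₁ d d ?_), ⟨h2.1, fun r hr => ?_⟩, ?_, fun r hr => ?_⟩
    · rw [hm]
      exact ((hσ.2.2 _).trans (Nat.le_self_pow (by have := e.one_le_deg; omega) W)).trans_lt hB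
    · have : r ≠ d := by
        rintro rfl; exact hr ⟨hd, by have : 1 ≤ e.width := by
                                        clear * -; induction e <;> simp_all [Expr.width]
                                     omega⟩
      simp [State.setReg, this, h2.2 r hr]
    · simp [State.setReg, hm, Expr.eval]
    · simp [State.setReg, hr.ne, h4 r hr]

/-! ### A program logic with time and word bounds -/

/-- Started in any state that agrees with `σ` outside the scratch registers, with words that can
hold `W ^ 100`, the program `P` halts after at most `T` steps in a state that agrees outside the
scratch registers with one that is bounded by `W` and satisfies `post`. -/
def Runs (W : ℕ) (P : Prog) (T : ℕ) (σ : State) (post : State → Prop) : Prop :=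
  Bounded W σ → ∀ B, W ^ 100 < B → ∀ s, Sim s σ →
    ∃ t s' σ', Exec B P s t s' ∧ t ≤ T ∧ Sim s' σ' ∧ Bounded W σ' ∧ post σ'

namespace Runs

variable {W T T₁ T₂ : ℕ} {P Q : Prog} {σ : State} {post post' : State → Prop}

lemma mono (h : Runs W P T₁ σ post) (hT : T₁ ≤ T₂) (hp : ∀ σ', Bounded W σ' → post σ' → post' σ') :
    Runs W P T₂ σ post' := fun hb B hB s hs => by
  obtain ⟨t, s', σ', h1, h2, h3, h4, h5⟩ := h hb B hB s hs
  exact ⟨t, s', σ', h1, h2.trans hT, h3, h4, hp _ h4 h5⟩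

lemma with_bounded (h : Bounded W σ → Runs W P T σ post) : Runs W P T σ post :=
  fun hb => h hb hb

/-- The triple for `Q` is itself the postcondition of `P`, so proofs follow the execution forwards.
-/
lemma seq (h : Runs W P T₁ σ fun σ₁ => Runs W Q T₂ σ₁ post) :
    Runs W (.seq P Q) (T₁ + T₂) σ post := fun hb B hB s hs => by
  obtain ⟨t, s₁, σ₁, h1, h2, h3, h4, h5⟩ := h hb B hB s hs
  obtain ⟨t', s₂, σ₂, k1, k2, k3, k4, k5⟩ := h5 h4 B hB s₁ h3
  exact ⟨_, s₂, σ₂, .seq h1 k1, by omega, k3, k4, k5⟩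

end Runs

lemma Sim.setReg {s σ : State} (h : Sim s σ) (x v : ℕ) : Sim (s.setReg x v) (σ.setReg x v) :=
  ⟨h.1, fun r hr => by
    by_cases hx : r = x
    · subst hx; simp [State.setReg]
    · simp [State.setReg, hx, h.2 r hr]⟩

lemma Sim.setMem {s σ : State} (h : Sim s σ) (x v : ℕ) : Sim (s.setMem x v) (σ.setMem x v) :=
  ⟨by simp [State.setMem, h.1], fun r hr => h.2 r hr⟩

lemma Sim.refl (s : State) : Sim s s := ⟨rfl, fun _ _ => rfl⟩

lemma Bounded.setReg {W x v : ℕ} {σ : State} (h : Bounded W σ) (hv : v ≤ W) :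
    Bounded W (σ.setReg x v) :=
  ⟨h.1, fun r hr => by
    by_cases hx : r = x
    · subst hx; simpa [State.setReg] using hv
    · simpa [State.setReg, hx] using h.2.1 r hr, h.2.2⟩

lemma Bounded.setMem {W x v : ℕ} {σ : State} (h : Bounded W σ) (hv : v ≤ W) :
    Bounded W (σ.setMem x v) :=
  ⟨h.1, h.2.1, fun r => by
    by_cases hx : r = x
    · subst hx; simpa [State.setMem] using hv
    · simpa [State.setMem, hx] using h.2.2 r⟩

/-- `x := e` -/
def assign (x : ℕ) (e : Expr) : Prog := .seq (e.code 30) (.op .lor x 30 30)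

/-- `memory[a] := e` -/
def storeAt (a e : Expr) : Prog := .seq (a.code 30) (.seq (e.code 31) (.store 30 31))

/-- if `e ≠ 0` then `P` else `Q` -/
def branch (e : Expr) (P Q : Prog) : Prog := .seq (e.code 30) (.ite 30 P Q)

/-- for `i = 0, …, e - 1` do `P` -/
def forLoop (i : ℕ) (e : Expr) (P : Prog) : Prog :=
  .seq (assign i (.lit 0)) (.seq ((Expr.op .lt (.var i) e).code 30)
    (.loop 30 (.seq P (.seq (assign i (.op .add (.var i) (.lit 1)))
      ((Expr.op .lt (.var i) e).code 30)))))

namespace Runs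

variable {W T T₁ T₂ : ℕ} {P Q : Prog} {σ : State} {post post' : State → Prop}

lemma pow_deg_lt {W B : ℕ} {e : Expr} (hW : 16 ≤ W) (he : e.wf = true) (hB : W ^ 100 < B) :
    W ^ e.deg < B := by
  simp only [Expr.wf, Bool.and_eq_true, decide_eq_true_eq] at he
  exact (Nat.pow_le_pow_right (by omega) he.1.2).trans_lt hB

lemma const (x v : ℕ) (hv : v ≤ W) (h : post (σ.setReg x v)) : Runs W (.const x v) 1 σ post :=
  fun hb B hB s hs => by
    have hW := hb.1
    have : W ≤ W ^ 100 := Nat.le_self_pow (by norm_num) W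
    exact ⟨_, _, _, .const s x v (by omega), le_rfl, hs.setReg x v, hb.setReg hv, h⟩

lemma assign {x : ℕ} {e : Expr} (he : e.wf = true) (hv : Bounded W σ → e.eval σ ≤ W)
    (h : post (σ.setReg x (e.eval σ))) : Runs W (assign x e) (e.cost + 1) σ post :=
  fun hb B hB s hs => by
    have hdB := pow_deg_lt hb.1 he hB
    simp only [Expr.wf, Bool.and_eq_true, decide_eq_true_eq] at he
    obtain ⟨s', h1, h2, h3, h4⟩ := Exec.code hb e 30 s he.1.1 le_rfl (by omega) hdB hs
    have hW := hb.1
    have : W ≤ W ^ 100 := Nat.le_self_pow (by norm_num) W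
    have hv := hv hb
    have h5 : Op.lor.eval (s'.reg 30) (s'.reg 30) = e.eval σ := by simp [Op.eval, h3]
    refine ⟨_, _, _, .seq h1 (.op s' .lor x 30 30 (by rw [h5]; omega)), le_rfl, ?_, hb.setReg hv, h⟩
    rw [h5]
    exact h2.setReg _ _

lemma storeAt {a e : Expr} (ha : a.wf = true) (he : e.wf = true)
    (hv : Bounded W σ → e.eval σ ≤ W)
    (h : post (σ.setMem (a.eval σ) (e.eval σ))) :
    Runs W (storeAt a e) (a.cost + (e.cost + 1)) σ post :=
  fun hb B hB s hs => by
    have hdB := pow_deg_lt hb.1 ha hB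
    have hdB' := pow_deg_lt hb.1 he hB
    simp only [Expr.wf, Bool.and_eq_true, decide_eq_true_eq] at he ha
    obtain ⟨s₁, h1, h2, h3, h4⟩ := Exec.code hb a 30 s ha.1.1 le_rfl (by omega) hdB hs
    obtain ⟨s₂, k1, k2, k3, k4⟩ := Exec.code hb e 31 s₁ he.1.1 (by omega) (by omega) hdB' h2
    have hW := hb.1
    have : W ≤ W ^ 100 := Nat.le_self_pow (by norm_num) W
    have hv := hv hb
    refine ⟨_, _, _, .seq h1 (.seq k1 (.store s₂ 30 31 (by rw [k3]; omega))), le_rfl, ?_,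
      hb.setMem hv, h⟩
    rw [k4 30 (by omega), h3, k3]
    exact k2.setMem _ _

lemma branch {e : Expr} (he : e.wf = true) (h1 : e.eval σ ≠ 0 → Runs W P T σ post)
    (h2 : e.eval σ = 0 → Runs W Q T σ post) :
    Runs W (branch e P Q) (e.cost + (T + 1)) σ post := fun hb B hB s hs => by
  have hdB := pow_deg_lt hb.1 he hB
  simp only [Expr.wf, Bool.and_eq_true, decide_eq_true_eq] at he
  obtain ⟨s₁, k1, k2, k3, k4⟩ := Exec.code hb e 30 s he.1.1 le_rfl (by omega) hdB hs
  by_cases h : e.eval σ = 0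
  · obtain ⟨t, s', σ', m1, m2, m3, m4, m5⟩ := h2 h hb B hB s₁ k2
    exact ⟨_, s', σ', .seq k1 (.ite_false (by rw [k3, h]) m1), by omega, m3, m4, m5⟩
  · obtain ⟨t, s', σ', m1, m2, m3, m4, m5⟩ := h1 h hb B hB s₁ k2
    exact ⟨_, s', σ', .seq k1 (.ite_true (by rw [k3]; exact h) m1), by omega, m3, m4, m5⟩

lemma skip (h : post σ) : Runs W .skip 1 σ post := fun hb _ _ s hs =>
  ⟨1, s, σ, .skip s, le_rfl, hs, hb, h⟩

/-- The rule for `for` loops with an invariant that is indexed by the loop counter. -/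
lemma forLoop {i N c : ℕ} {e : Expr} (I : ℕ → State → Prop) (hi : i < 30)
    (he : (Expr.op .lt (.var i) e).wf = true)
    (hcost : e.cost ≤ c)
    (h0 : I 0 (σ.setReg i 0))
    (hI : ∀ k ≤ N, ∀ σ, I k σ → σ.reg i = k ∧ e.eval σ = N)
    (hN : N ≤ W)
    (hP : ∀ k < N, ∀ σ, I k σ →
      Runs W P T σ fun σ' => σ'.reg i = k ∧ I (k + 1) (σ'.setReg i (k + 1)))
    (hpost : ∀ σ, I N σ → post σ) :
    Runs W (forLoop i e P) ((T + (c + 10)) * N + (c + 10)) σ post := by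
  -- The bound `e` is evaluated anew before each round; the invariant guarantees that its value is
  -- still `N`.
  have hW1 : ∀ k σ, Bounded W σ → I k σ → k ≤ N → ∀ B, W ^ 100 < B → ∀ s, Sim s σ →
      ∃ s', Exec B ((Expr.op .lt (.var i) e).code 30) s (e.cost + 2) s' ∧ Sim s' σ ∧
        s'.reg 30 = if k < N then 1 else 0 := by
    intro k σ hb hk hkN B hB s hs
    have hdB := pow_deg_lt hb.1 he hB
    have he' := he
    simp only [Expr.wf, Bool.and_eq_true, decide_eq_true_eq] at he'
    obtain ⟨s₁, k1, k2, k3, k4⟩ := Exec.code hb _ 30 s he'.1.1 le_rfl (by omega) hdB hs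
    refine ⟨s₁, by convert k1 using 1; simp [Expr.cost]; omega, k2, ?_⟩
    rw [k3]
    simp [Expr.eval, Op.eval, (hI k hkN σ hk).1, (hI k hkN σ hk).2]
  -- Induction on the number `j` of rounds that remain.
  have main : ∀ j k, k + j = N → ∀ σ, Bounded W σ → I k σ → ∀ B, W ^ 100 < B → ∀ s, Sim s σ →
      s.reg 30 = (if k < N then 1 else 0) → ∃ t s' σ',
      Exec B (.loop 30 (.seq P (.seq (WordRAM.assign i (.op .add (.var i) (.lit 1)))
        ((Expr.op .lt (.var i) e).code 30)))) s t s' ∧ t ≤ (T + (c + 10)) * j + 1 ∧ Sim s' σ' ∧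
        Bounded W σ' ∧ I N σ' := by
    intro j
    induction j with
    | zero =>
      intro k hk σ hb hIk B hB s hs h30
      obtain rfl : k = N := by omega
      exact ⟨1, s, σ, .loop_done (by simp [h30]), by omega, hs, hb, hIk⟩
    | succ j ih =>
      intro k hk σ hb hIk B hB s hs h30
      obtain ⟨t, s₁, σ₁, h1, h2, h3, h4, h5, h6⟩ := hP k (by omega) σ hIk hb B hB s hs
      have hA : Runs W (WordRAM.assign i (.op .add (.var i) (.lit 1))) 4 σ₁
          (fun σ' => σ' = σ₁.setReg i (k + 1)) := by
        refine Runs.assign ?_ (fun _ => ?_) ?_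
        · simp [Expr.wf, Expr.plain, Expr.deg, Expr.width, Op.plain]; omega
        · simp only [Expr.eval, Op.eval, h5]; omega
        · simp [Expr.eval, Op.eval, h5]
      obtain ⟨t₂, s₂, σ₂, k1, k2, k3, k4, rfl⟩ := hA h4 B hB s₁ h3
      obtain ⟨s₃, m1, m2, m3⟩ := hW1 (k + 1) _ k4 h6 (by omega) B hB s₂ k3
      obtain ⟨t₄, s₄, σ₄, n1, n2, n3, n4, n5⟩ := ih (k + 1) (by omega) _ k4 h6 B hB s₃ m2 m3
      refine ⟨_, s₄, σ₄, .loop_step ?_ (.seq h1 (.seq k1 m1)) n1, ?_, n3, n4, n5⟩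
      · rw [h30, if_pos (by omega)]; norm_num
      · rw [Nat.mul_succ]; omega
  have hA : Runs W (WordRAM.assign i (.lit 0)) 2 σ (fun σ' => σ' = σ.setReg i 0) := by
    refine Runs.assign ?_ (fun _ => ?_) ?_
    · simp [Expr.wf, Expr.plain, Expr.deg, Expr.width]
    · simp only [Expr.eval]; omega
    · simp [Expr.eval]
  intro hb B hB s hs
  obtain ⟨t, s₁, σ₁, h1, h2, h3, h4, rfl⟩ := hA hb B hB s hs
  obtain ⟨s₂, k1, k2, k3⟩ := hW1 0 _ h4 h0 (by omega) B hB s₁ h3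
  obtain ⟨t₃, s₃, σ₃, n1, n2, n3, n4, n5⟩ := main N 0 (by omega) _ h4 h0 B hB s₂ k2 k3
  exact ⟨_, s₃, σ₃, .seq h1 (.seq k1 n1), by omega, n3, n4, hpost _ n5⟩

end Runs

/-! ### Running a program on other registers and another part of the memory -/

/-- The program `P` with register `r` moved to `r + 50` and with memory cell `x` moved to `b + x`,
where `b` stands in register `29`. -/
def Prog.relocate : Prog → Prog
  | .skip => .skip
  | .const r v => .const (r + 50) v
  | .op o r a b => .op o (r + 50) (a + 50) (b + 50)
  | .load r a => .seq (.op .add 49 29 (a + 50)) (.load (r + 50) 49)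
  | .store a r => .seq (.op .add 49 29 (a + 50)) (.store 49 (r + 50))
  | .seq P Q => .seq P.relocate Q.relocate
  | .ite r P Q => .ite (r + 50) P.relocate Q.relocate
  | .loop r P => .loop (r + 50) P.relocate

/-- `σ` is a state that simulates `s`, with registers and memory moved. -/
structure Relocated (B b : ℕ) (s σ : State) : Prop where
  reg : ∀ r, σ.reg (r + 50) = s.reg r
  mem : ∀ x < B, σ.mem (b + x) = s.mem x
  lt : ∀ r, s.reg r < B

/-- `σ'` differs from `σ` only in registers from `50` on and in the memory window `[b, b + B)`. -/
structure SameOutside (B b : ℕ) (σ σ' : State) : Prop where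
  reg : ∀ r < 30, σ'.reg r = σ.reg r
  mem : ∀ x, x < b ∨ b + B ≤ x → σ'.mem x = σ.mem x

lemma SameOutside.trans {B b : ℕ} {σ₁ σ₂ σ₃ : State} (h : SameOutside B b σ₁ σ₂)
    (h' : SameOutside B b σ₂ σ₃) : SameOutside B b σ₁ σ₃ :=
  ⟨fun r hr => (h'.reg r hr).trans (h.reg r hr), fun x hx => (h'.mem x hx).trans (h.mem x hx)⟩

lemma Exec.relocate {B' B W b : ℕ} {P : Prog} {s s' : State} {t : ℕ} (h : Exec B' P s t s')
    (hW : b + B' ≤ W) (hB : W < B) {σ τ : State} (hσ : Bounded W σ) (hb : σ.reg 29 = b)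
    (hR : Relocated B' b s σ) (hτ : Sim τ σ) :
    ∃ u τ' σ', Exec B P.relocate τ u τ' ∧ u ≤ 2 * t ∧ Sim τ' σ' ∧ Bounded W σ' ∧
      Relocated B' b s' σ' ∧ SameOutside B' b σ σ' := by
  have hns : ∀ r, ¬ Scratch (r + 50) := fun r => by unfold Scratch; omega
  have hset : ∀ {σ : State} {s : State} {r v : ℕ}, v < B' → Relocated B' b s σ →
      Relocated B' b (s.setReg r v) (σ.setReg (r + 50) v) ∧
      SameOutside B' b σ (σ.setReg (r + 50) v) := by
    intro σ s r v hv hR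
    refine ⟨⟨fun q => ?_, hR.mem, fun q => ?_⟩, ⟨fun q hq => ?_, fun x _ => rfl⟩⟩
    · by_cases hq : q = r
      · subst hq; simp [State.setReg]
      · simp [State.setReg, hq, hR.reg]
    · by_cases hq : q = r
      · subst hq; simpa [State.setReg] using hv
      · simp [State.setReg, hq, hR.lt]
    · simp [State.setReg, show q ≠ r + 50 by omega]
  induction h generalizing σ τ with
  | skip s => exact ⟨1, τ, σ, .skip τ, by omega, hτ, hσ, hR, ⟨fun _ _ => rfl, fun _ _ => rfl⟩⟩
  | const s r v hv =>
    obtain ⟨h1, h2⟩ := hset (r := r) hv hR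
    exact ⟨1, _, _, .const τ (r + 50) v (by omega), by omega, hτ.setReg _ _,
      hσ.setReg (by omega), h1, h2⟩
  | op s o r x y hv =>
    obtain ⟨h1, h2⟩ := hset (r := r) hv hR
    have e : o.eval (τ.reg (x + 50)) (τ.reg (y + 50)) = o.eval (s.reg x) (s.reg y) := by
      rw [hτ.2 _ (hns x), hτ.2 _ (hns y), hR.reg, hR.reg]
    refine ⟨1, _, _, .op τ o (r + 50) (x + 50) (y + 50) (by rw [e]; omega), by omega, ?_,
      hσ.setReg (by omega), h1, h2⟩
    rw [e]; exact hτ.setReg _ _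
  | load s r x hv =>
    obtain ⟨h1, h2⟩ := hset (r := r) hv hR
    have h3 := hR.lt x
    have e : Op.add.eval (τ.reg 29) (τ.reg (x + 50)) = b + s.reg x := by
      rw [hτ.2 _ (hns x), hτ.2 29 (by unfold Scratch; omega), hR.reg, hb]; rfl
    have e2 : τ.mem (b + s.reg x) = s.mem (s.reg x) := by rw [hτ.1, hR.mem _ h3]
    -- The shifted address is computed in register `49`, which is scratch and hence invisible to
    -- `Sim`. This extra instruction accounts for the factor 2 in the time.
    have hτ' : Sim (τ.setReg 49 (b + s.reg x)) σ := ⟨hτ.1, fun q hq => by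
      have : q ≠ 49 := by rintro rfl; exact hq (by decide)
      simp [State.setReg, this, hτ.2 q hq]⟩
    have E1 := Exec.op (B := B) τ .add 49 29 (x + 50) (by rw [e]; omega)
    rw [e] at E1
    have E2 := Exec.load (B := B) (τ.setReg 49 (b + s.reg x)) (r + 50) 49
      (by simp [State.setReg, e2]; omega)
    refine ⟨_, _, _, .seq E1 E2, by omega, ?_, hσ.setReg (by omega), h1, h2⟩
    have e3 : (τ.setReg 49 (b + s.reg x)).mem ((τ.setReg 49 (b + s.reg x)).reg 49) =
        s.mem (s.reg x) := by simp [State.setReg, e2]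
    rw [e3]
    exact hτ'.setReg _ _
  | store s x r hv =>
    have h3 := hR.lt x
    have e : Op.add.eval (τ.reg 29) (τ.reg (x + 50)) = b + s.reg x := by
      rw [hτ.2 _ (hns x), hτ.2 29 (by unfold Scratch; omega), hR.reg, hb]; rfl
    have e2 : τ.reg (r + 50) = s.reg r := by rw [hτ.2 _ (hns r), hR.reg]
    have hτ' : Sim (τ.setReg 49 (b + s.reg x)) σ := ⟨hτ.1, fun q hq => by
      have : q ≠ 49 := by rintro rfl; exact hq (by decide)
      simp [State.setReg, this, hτ.2 q hq]⟩
    have E1 := Exec.op (B := B) τ .add 49 29 (x + 50) (by rw [e]; omega)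
    rw [e] at E1
    have e4 : (τ.setReg 49 (b + s.reg x)).reg (r + 50) = s.reg r := by
      simp [State.setReg, e2]
    have e5 : (τ.setReg 49 (b + s.reg x)).reg 49 = b + s.reg x := by simp [State.setReg]
    have E2 := Exec.store (B := B) (τ.setReg 49 (b + s.reg x)) 49 (r + 50) (by rw [e4]; omega)
    rw [e4, e5] at E2
    refine ⟨_, _, _, .seq E1 E2, by omega, hτ'.setMem _ _, hσ.setMem (by omega),
      ⟨hR.reg, fun z hz => ?_, hR.lt⟩, ⟨fun _ _ => rfl, fun z hz => ?_⟩⟩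
    · by_cases hzx : z = s.reg x
      · subst hzx; simp [State.setMem]
      · simp [State.setMem, hzx, hR.mem z hz]
    · simp [State.setMem, show z ≠ b + s.reg x by omega]
  | seq _ _ ih1 ih2 =>
    obtain ⟨u, τ₁, σ₁, a1, a2, a3, a4, a5, a6⟩ := ih1 hσ hb hR hτ
    obtain ⟨u', τ₂, σ₂, b1, b2, b3, b4, b5, b6⟩ := ih2 a4 ((a6.reg 29 (by omega)).trans hb) a5 a3
    exact ⟨_, _, _, .seq a1 b1, by omega, b3, b4, b5, a6.trans b6⟩
  | ite_true hr _ ih =>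
    obtain ⟨u, τ₁, σ₁, a1, a2, a3, a4, a5, a6⟩ := ih hσ hb hR hτ
    exact ⟨_, _, _, .ite_true (by rwa [hτ.2 _ (hns _), hR.reg]) a1, by omega, a3, a4, a5, a6⟩
  | ite_false hr _ ih =>
    obtain ⟨u, τ₁, σ₁, a1, a2, a3, a4, a5, a6⟩ := ih hσ hb hR hτ
    exact ⟨_, _, _, .ite_false (by rwa [hτ.2 _ (hns _), hR.reg]) a1, by omega, a3, a4, a5, a6⟩
  | loop_done hr =>
    exact ⟨_, _, _, .loop_done (by rwa [hτ.2 _ (hns _), hR.reg]), by omega, hτ, hσ, hR,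
      ⟨fun _ _ => rfl, fun _ _ => rfl⟩⟩
  | loop_step hr _ _ ih1 ih2 =>
    obtain ⟨u, τ₁, σ₁, a1, a2, a3, a4, a5, a6⟩ := ih1 hσ hb hR hτ
    obtain ⟨u', τ₂, σ₂, b1, b2, b3, b4, b5, b6⟩ := ih2 a4 ((a6.reg 29 (by omega)).trans hb) a5 a3
    exact ⟨_, _, _, .loop_step (by rwa [hτ.2 _ (hns _), hR.reg]) a1 b1, by omega, b3, b4, b5,
      a6.trans b6⟩

/-- All registers that the program writes are below `P.maxReg`. -/
def Prog.maxReg : Prog → ℕ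
  | .skip => 0
  | .const r _ => r + 1
  | .op _ r _ _ => r + 1
  | .load r _ => r + 1
  | .store _ _ => 0
  | .seq P Q => max P.maxReg Q.maxReg
  | .ite _ P Q => max P.maxReg Q.maxReg
  | .loop _ P => P.maxReg

/-- Needed to restart a program: clearing finitely many registers restores the initial register
contents. -/
lemma Exec.reg_of_maxReg_le {B : ℕ} {P : Prog} {s s' : State} {t : ℕ} (h : Exec B P s t s') :
    ∀ r, P.maxReg ≤ r → s'.reg r = s.reg r := by
  induction h with
  | skip => intros; rfl
  | const s r v hv =>
    intro q hq; simp only [Prog.maxReg] at hq; simp [State.setReg, show q ≠ r by omega]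
  | op s o r x y hv =>
    intro q hq; simp only [Prog.maxReg] at hq; simp [State.setReg, show q ≠ r by omega]
  | load s r x hv =>
    intro q hq; simp only [Prog.maxReg] at hq; simp [State.setReg, show q ≠ r by omega]
  | store => intros; rfl
  | seq _ _ ih1 ih2 =>
    intro q hq; simp only [Prog.maxReg] at hq
    rw [ih2 q (by omega), ih1 q (by omega)]
  | ite_true _ _ ih => intro q hq; simp only [Prog.maxReg] at hq; exact ih q (by omega)
  | ite_false _ _ ih => intro q hq; simp only [Prog.maxReg] at hq; exact ih q (by omega)
  | loop_done => intros; rfl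
  | loop_step _ _ _ ih1 ih2 =>
    intro q hq
    rw [ih2 q hq, ih1 q (by simpa only [Prog.maxReg] using hq)]

/-- Set the registers `50, …, 50 + k - 1` to zero. -/
def clearRegs : ℕ → Prog
  | 0 => .skip
  | k + 1 => .seq (clearRegs k) (.const (k + 50) 0)

lemma Runs.clearRegs {W : ℕ} (k : ℕ) {σ : State} :
    Runs W (clearRegs k) (k + 1) σ fun σ' => σ'.mem = σ.mem ∧ (∀ r < 30, σ'.reg r = σ.reg r) ∧
      (∀ r < k, σ'.reg (r + 50) = 0) ∧ ∀ r, k ≤ r → σ'.reg (r + 50) = σ.reg (r + 50) := by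
  induction k with
  | zero => exact Runs.skip ⟨rfl, fun _ _ => rfl, by omega, fun _ _ => rfl⟩
  | succ k ih =>
    refine Runs.seq (ih.mono le_rfl fun σ' hb h => Runs.const _ _ (by omega) ?_)
    obtain ⟨h1, h2, h3, h4⟩ := h
    refine ⟨h1, fun r hr => ?_, fun r hr => ?_, fun r hr => ?_⟩
    · simp [State.setReg, show r ≠ k + 50 by omega, h2 r hr]
    · by_cases hk : r = k
      · simp [State.setReg, hk]
      · simp [State.setReg, hk, h3 r (by omega)]
    · simp [State.setReg, show r ≠ k by omega, h4 r (by omega)]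

/-- Running a relocated program. -/
lemma Runs.relocate {B' W b t : ℕ} {P : Prog} {s s' : State} (h : Exec B' P s t s')
    (hW : b + B' ≤ W) {σ : State} (hb : σ.reg 29 = b) (hR : Relocated B' b s σ) :
    Runs W P.relocate (2 * t) σ fun σ' => Relocated B' b s' σ' ∧ SameOutside B' b σ σ' :=
  fun hσ B hB τ hτ => by
    have h16 := hσ.1
    have : W ≤ W ^ 100 := Nat.le_self_pow (by norm_num) W
    obtain ⟨u, τ', σ', a1, a2, a3, a4, a5, a6⟩ := h.relocate hW (by omega : W < B) hσ hb hR hτ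
    exact ⟨u, τ', σ', a1, a2, a3, a4, a5, a6⟩

end WordRAM

/-! ### Straight-line drawings -/

/-- A straight-line drawing in which distinct edges meet only in common end points is plane. -/
lemma isPlanar_of_segments {V : Type*} (G : SimpleGraph V) (pos : V → ℝ × ℝ)
    (hpos : Function.Injective pos) (hdeg : ∀ v, ∃ w, G.Adj v w)
    (h : ∀ u v u' v', G.Adj u v → G.Adj u' v' → s(u, v) ≠ s(u', v') →
      ∀ x ∈ segment ℝ (pos u) (pos v) ∩ segment ℝ (pos u') (pos v'),
        ∃ w, w ∈ s(u, v) ∧ w ∈ s(u', v') ∧ pos w = x) : IsPlanar G := by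
  have key : ∀ e ∈ G.edgeSet, ∀ f ∈ G.edgeSet, e ≠ f → ∀ x ∈
      (Sym2.lift ⟨fun u v => segment ℝ (pos u) (pos v), fun u v => segment_symm ℝ _ _⟩ e : Set _) ∩
      (Sym2.lift ⟨fun u v => segment ℝ (pos u) (pos v), fun u v => segment_symm ℝ _ _⟩ f : Set _),
      ∃ w, w ∈ e ∧ w ∈ f ∧ pos w = x := by
    intro e he f hf hef x hx
    induction e using Sym2.ind with
    | _ u v =>
    induction f using Sym2.ind with
    | _ u' v' => exact h u v u' v' he hf hef x hx
  refine ⟨pos, Sym2.lift ⟨fun u v => segment ℝ (pos u) (pos v), fun u v => segment_symm ℝ _ _⟩,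
    hpos, fun u v huv => ?_, fun e he w hw => ?_, key⟩
  · refine ⟨AffineMap.lineMap (pos u) (pos v), by fun_prop, fun a _ b _ hab => ?_, by simp, by simp,
      ?_⟩
    · exact AffineMap.lineMap_injective ℝ (hpos.ne huv.ne) hab
    · rw [Sym2.lift_mk]
      exact (segment_eq_image_lineMap ℝ (pos u) (pos v)).symm
  -- A vertex on the segment of `e` also lies on an edge `w z`. If that is another edge, the
  -- condition on meeting edges applies to the two.
  · obtain ⟨z, hz⟩ := hdeg w
    by_cases hf : e = s(w, z)
    · rw [hf]; exact Sym2.mem_mk_left w z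
    · obtain ⟨w', h1, _, h3⟩ := key e he s(w, z) hz hf (pos w)
        ⟨hw, by rw [Sym2.lift_mk]; exact left_mem_segment ℝ _ _⟩
      rwa [← hpos h3]

/-- The segments `e` and `f` between points with integral coordinates are separated by a line that
contains at most one end point of `f`, and that only if it is an end point of `e` or the line does
not contain `e`. -/
def Separated (X Y : ℕ → ℤ) (e f : ℕ × ℕ) : Prop :=
  ∃ α β γ : ℤ, α * X e.1 + β * Y e.1 + γ ≤ 0 ∧ α * X e.2 + β * Y e.2 + γ ≤ 0 ∧
    0 ≤ α * X f.1 + β * Y f.1 + γ ∧ 0 ≤ α * X f.2 + β * Y f.2 + γ ∧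
    (0 < α * X f.1 + β * Y f.1 + γ ∨ 0 < α * X f.2 + β * Y f.2 + γ) ∧
    ((α * X e.1 + β * Y e.1 + γ < 0 ∨ α * X e.2 + β * Y e.2 + γ < 0) ∨
      ((α * X f.1 + β * Y f.1 + γ = 0 → f.1 = e.1 ∨ f.1 = e.2) ∧
        (α * X f.2 + β * Y f.2 + γ = 0 → f.2 = e.1 ∨ f.2 = e.2)))

/-- The point with integral coordinates `X v` and `Y v`. -/
def latticePoint (X Y : ℕ → ℤ) (v : ℕ) : ℝ × ℝ := ((X v : ℝ), (Y v : ℝ))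

/-- On a segment an affine function is a convex combination of its end values. Two nonnegative terms
with sum at most 0 both vanish, and the positive end value forces its coefficient to be 0. -/
lemma eq_endpoint_of_mem_segment {p q x : ℝ × ℝ} {α β γ : ℝ} (hx : x ∈ segment ℝ p q)
    (hp : 0 ≤ α * p.1 + β * p.2 + γ) (hq : 0 ≤ α * q.1 + β * q.2 + γ)
    (hpq : 0 < α * p.1 + β * p.2 + γ ∨ 0 < α * q.1 + β * q.2 + γ)
    (h : α * x.1 + β * x.2 + γ ≤ 0) :
    (x = p ∧ α * p.1 + β * p.2 + γ = 0) ∨ (x = q ∧ α * q.1 + β * q.2 + γ = 0) := by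
  obtain ⟨a, b, ha, hb, hab, rfl⟩ := hx
  have e : α * (a • p + b • q).1 + β * (a • p + b • q).2 + γ =
      a * (α * p.1 + β * p.2 + γ) + b * (α * q.1 + β * q.2 + γ) := by
    simp only [Prod.fst_add, Prod.snd_add, Prod.smul_fst, Prod.smul_snd, smul_eq_mul]
    linear_combination (-γ) * hab
  rw [e] at h
  have h1 := mul_nonneg ha hp
  have h2 := mul_nonneg hb hq
  have h3 : a * (α * p.1 + β * p.2 + γ) = 0 := by linarith
  have h4 : b * (α * q.1 + β * q.2 + γ) = 0 := by linarith
  rcases hpq with hpq | hpq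
  · have : a = 0 := by
      rcases mul_eq_zero.1 h3 with h | h
      · exact h
      · exact absurd h hpq.ne'
    subst this
    have hb1 : b = 1 := by linarith
    subst hb1
    right; constructor
    · simp
    · simpa using h4
  · have : b = 0 := by
      rcases mul_eq_zero.1 h4 with h | h
      · exact h
      · exact absurd h hpq.ne'
    subst this
    have hb1 : a = 1 := by linarith
    subst hb1
    left; constructor
    · simp
    · simpa using h3

lemma mem_segment_le_zero {p q x : ℝ × ℝ} {α β γ : ℝ} (hx : x ∈ segment ℝ p q)
    (hp : α * p.1 + β * p.2 + γ ≤ 0) (hq : α * q.1 + β * q.2 + γ ≤ 0) :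
    α * x.1 + β * x.2 + γ ≤ 0 := by
  obtain ⟨a, b, ha, hb, hab, rfl⟩ := hx
  have e : α * (a • p + b • q).1 + β * (a • p + b • q).2 + γ =
      a * (α * p.1 + β * p.2 + γ) + b * (α * q.1 + β * q.2 + γ) := by
    simp only [Prod.fst_add, Prod.snd_add, Prod.smul_fst, Prod.smul_snd, smul_eq_mul]
    linear_combination (-γ) * hab
  rw [e]
  have h1 := mul_nonneg ha (neg_nonneg.2 hp)
  have h2 := mul_nonneg hb (neg_nonneg.2 hq)
  linarith

/-- A common point lies on the separating line, which meets the second segment only at an end point.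
The first segment also meets the line only at an end point unless it lies on the line; in that case
the last clause of `Separated` supplies the common vertex. -/
lemma Separated.exists_endpoint {X Y : ℕ → ℤ} {e f : ℕ × ℕ} (h : Separated X Y e f) {x : ℝ × ℝ}
    (hx : x ∈ segment ℝ (latticePoint X Y e.1) (latticePoint X Y e.2) ∩
      segment ℝ (latticePoint X Y f.1) (latticePoint X Y f.2)) :
    ∃ w w', (w = e.1 ∨ w = e.2) ∧ (w' = f.1 ∨ w' = f.2) ∧ latticePoint X Y w = x ∧
      latticePoint X Y w' = x := by
  obtain ⟨α, β, γ, h1, h2, h3, h4, h5, h6⟩ := h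
  have cast : ∀ v, (α : ℝ) * (latticePoint X Y v).1 + β * (latticePoint X Y v).2 + γ =
      ((α * X v + β * Y v + γ : ℤ) : ℝ) := fun v => by simp [latticePoint]
  have hle : (α : ℝ) * x.1 + β * x.2 + γ ≤ 0 := mem_segment_le_zero hx.1
    (by rw [cast]; exact_mod_cast h1) (by rw [cast]; exact_mod_cast h2)
  have hf := eq_endpoint_of_mem_segment hx.2 (by rw [cast]; exact_mod_cast h3)
    (by rw [cast]; exact_mod_cast h4) (by rw [cast, cast]; exact_mod_cast h5) hle
  simp only [cast, Int.cast_eq_zero] at hf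
  have hx0 : (α : ℝ) * x.1 + β * x.2 + γ = 0 := by
    rcases hf with ⟨rfl, h⟩ | ⟨rfl, h⟩ <;> rw [cast, h] <;> simp
  rcases h6 with h6 | h6
  -- With reversed signs the first segment plays the role of the second.
  · have he := eq_endpoint_of_mem_segment (α := -α) (β := -β) (γ := -γ) hx.1
      (by have := cast e.1; have h1' : ((α * X e.1 + β * Y e.1 + γ : ℤ) : ℝ) ≤ 0 := by
            exact_mod_cast h1
          linarith)
      (by have := cast e.2; have h1' : ((α * X e.2 + β * Y e.2 + γ : ℤ) : ℝ) ≤ 0 := by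
            exact_mod_cast h2
          linarith)
      (by
        have c1 := cast e.1
        have c2 := cast e.2
        rcases h6 with h6 | h6
        · left
          have : ((α * X e.1 + β * Y e.1 + γ : ℤ) : ℝ) < 0 := by exact_mod_cast h6
          linarith
        · right
          have : ((α * X e.2 + β * Y e.2 + γ : ℤ) : ℝ) < 0 := by exact_mod_cast h6
          linarith)
      (by linarith)
    have he' : x = latticePoint X Y e.1 ∨ x = latticePoint X Y e.2 := by tauto
    have hf' : x = latticePoint X Y f.1 ∨ x = latticePoint X Y f.2 := by tauto
    rcases he' with he' | he' <;> rcases hf' with hf' | hf'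
    · exact ⟨e.1, f.1, .inl rfl, .inl rfl, he'.symm, hf'.symm⟩
    · exact ⟨e.1, f.2, .inl rfl, .inr rfl, he'.symm, hf'.symm⟩
    · exact ⟨e.2, f.1, .inr rfl, .inl rfl, he'.symm, hf'.symm⟩
    · exact ⟨e.2, f.2, .inr rfl, .inr rfl, he'.symm, hf'.symm⟩
  · rcases hf with ⟨rfl, h⟩ | ⟨rfl, h⟩
    · exact ⟨f.1, f.1, h6.1 h, .inl rfl, rfl, rfl⟩
    · exact ⟨f.2, f.2, h6.2 h, .inr rfl, rfl, rfl⟩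

/-! ### Two paths attached to two hubs -/

/-- Rows `0, …, T - 1` of three vertices each, which are attached to two adjacent hubs `0` and `1`.
The row `t` consists of `3 * t + 2`, which is adjacent to the hub `side t`, of `3 * t + 3`, which is
adjacent to `3 * t + 2`, and of `3 * t + 4`, which is joined to one of these three vertices such
that it has distance `ell t` from the hub.  The last vertices of the rows before `n`, and also those
of the rows from `n` on, form a path. -/
structure Spokes where
  (T n : ℕ)
  (ell side : ℕ → ℕ)
  one_le_ell : ∀ t, 1 ≤ ell t
  ell_le : ∀ t, ell t ≤ 3
  side_le : ∀ t, side t ≤ 1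

namespace Spokes

variable (S : Spokes)

/-- The vertex to which the path vertex of the row `t` is attached. -/
def target (t : ℕ) : ℕ :=
  if S.ell t = 1 then S.side t else if S.ell t = 2 then 3 * t + 2 else 3 * t + 3

/-- The larger vertex number comes first in every edge. `3 * t + 1` is the path vertex of the
previous row; this edge is missing in the rows `0` and `n`, where paths begin. -/
def row (t : ℕ) : List (ℕ × ℕ) :=
  [(3 * t + 2, S.side t), (3 * t + 3, 3 * t + 2), (3 * t + 4, S.target t)] ++
    if t = 0 ∨ t = S.n then [] else [(3 * t + 4, 3 * t + 1)]

def edgeList : List (ℕ × ℕ) := (1, 0) :: (List.range S.T).flatMap S.row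

lemma mem_row {t : ℕ} {e : ℕ × ℕ} : e ∈ S.row t ↔ e = (3 * t + 2, S.side t) ∨
    e = (3 * t + 3, 3 * t + 2) ∨ e = (3 * t + 4, S.target t) ∨
    (t ≠ 0 ∧ t ≠ S.n ∧ e = (3 * t + 4, 3 * t + 1)) := by
  unfold row
  split_ifs with h
  · simp; tauto
  · simp; tauto

lemma mem_edgeList {e : ℕ × ℕ} : e ∈ S.edgeList ↔ e = (1, 0) ∨ ∃ t < S.T, e ∈ S.row t := by
  simp [edgeList]

lemma target_lt (t : ℕ) : S.target t < 3 * t + 4 ∧ (t ≠ 0 → S.target t ≠ 3 * t + 1) := by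
  have := S.side_le t
  unfold target
  split_ifs <;> omega

lemma lt_of_mem {e : ℕ × ℕ} (he : e ∈ S.edgeList) : e.2 < e.1 ∧ e.1 < 3 * S.T + 2 := by
  rcases S.mem_edgeList.1 he with rfl | ⟨t, ht, h⟩
  · simp
  · have := S.side_le t
    have := S.target_lt t
    rcases S.mem_row.1 h with rfl | rfl | rfl | ⟨h1, h2, rfl⟩ <;> dsimp only <;> omega

lemma nodup_edgeList : S.edgeList.Nodup := by
  unfold edgeList
  rw [List.nodup_cons]
  constructor
  · simp only [List.mem_flatMap, not_exists, not_and]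
    intro t _ h
    rcases S.mem_row.1 h with h | h | h | ⟨_, _, h⟩ <;> simp only [Prod.mk.injEq] at h <;> omega
  · rw [List.nodup_flatMap]
    constructor
    · intro t _
      have := S.target_lt t
      unfold row
      split_ifs with h
      · simp
      · simp only [List.cons_append, List.nil_append, List.nodup_cons, List.mem_cons, Prod.mk.injEq,
          List.not_mem_nil, or_false, not_false_eq_true, List.nodup_nil, and_true]
        omega
    · refine List.pairwise_lt_range.imp fun {t s} hts => ?_
      simp only [Function.onFun]
      intro e h1 h2
      rcases S.mem_row.1 h1 with rfl | rfl | rfl | ⟨_, _, rfl⟩ <;>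
      rcases S.mem_row.1 h2 with h | h | h | ⟨_, _, h⟩ <;>
      simp only [Prod.mk.injEq] at h <;> omega

/-- `1` for the hub `0` and `-1` for the hub `1`. -/
def sign (t : ℕ) : ℤ := if S.side t = 0 then 1 else -1

/-- First coordinates of a plane drawing. -/
def xPos (v : ℕ) : ℤ :=
  if v < 2 then 0 else
    if (v - 2) % 3 = 0 then 2 * ((v - 2) / 3 : ℕ) + 3 else
      if (v - 2) % 3 = 1 then 4 * ((v - 2) / 3 : ℕ) + 6 else 6 * ((v - 2) / 3 : ℕ) + 6

/-- Second coordinates of a plane drawing. -/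
def yPos (v : ℕ) : ℤ :=
  if v = 0 then 3 else if v = 1 then -3 else
    if (v - 2) % 3 = 0 then 2 * S.sign ((v - 2) / 3) else
      if (v - 2) % 3 = 1 then S.sign ((v - 2) / 3) else 0

lemma div_mod (t : ℕ) : (3 * t + 2 - 2) / 3 = t ∧ (3 * t + 2 - 2) % 3 = 0 ∧
    (3 * t + 3 - 2) / 3 = t ∧ (3 * t + 3 - 2) % 3 = 1 ∧
    (3 * t + 4 - 2) / 3 = t ∧ (3 * t + 4 - 2) % 3 = 2 := by omega

lemma xPos_y (t : ℕ) : xPos (3 * t + 2) = 2 * t + 3 := by simp [xPos]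
lemma xPos_x (t : ℕ) : xPos (3 * t + 3) = 4 * t + 6 := by
  obtain ⟨_, _, h1, h2, _⟩ := div_mod t
  rw [xPos, h1, h2, if_neg (by omega)]; norm_num
lemma xPos_p (t : ℕ) : xPos (3 * t + 4) = 6 * t + 6 := by
  obtain ⟨_, _, _, _, h1, h2⟩ := div_mod t
  rw [xPos, h1, h2, if_neg (by omega)]; norm_num
lemma yPos_y (t : ℕ) : S.yPos (3 * t + 2) = 2 * S.sign t := by simp [yPos]
lemma yPos_x (t : ℕ) : S.yPos (3 * t + 3) = S.sign t := by
  obtain ⟨_, _, h1, h2, _⟩ := div_mod t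
  rw [yPos, h1, h2, if_neg (by omega), if_neg (by omega)]; norm_num
lemma yPos_p (t : ℕ) : S.yPos (3 * t + 4) = 0 := by
  obtain ⟨_, _, _, _, h1, h2⟩ := div_mod t
  rw [yPos, h1, h2, if_neg (by omega), if_neg (by omega)]; norm_num
lemma xPos_hub {v : ℕ} (h : v ≤ 1) : xPos v = 0 := by simp [xPos, show v < 2 by omega]
lemma xPos_side (t : ℕ) : xPos (S.side t) = 0 := xPos_hub (S.side_le t)
lemma yPos_side (t : ℕ) : S.yPos (S.side t) = 3 * S.sign t := by
  have := S.side_le t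
  unfold yPos sign
  rcases (show S.side t = 0 ∨ S.side t = 1 by omega) with h | h <;> simp [h]

lemma sign_cases (t : ℕ) : S.sign t = 1 ∨ S.sign t = -1 := by unfold sign; split_ifs <;> simp


/-! ### Separating lines for the edges of the drawing -/

lemma target_cases (t : ℕ) : S.target t = S.side t ∨ S.target t = 3 * t + 2 ∨
    S.target t = 3 * t + 3 := by
  unfold target; split_ifs <;> simp

lemma sign_eq_or_neg (t s : ℕ) : S.sign t = S.sign s ∨ S.sign t = - S.sign s := by
  rcases S.sign_cases t with h | h <;> rcases S.sign_cases s with h' | h' <;> simp [h, h']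

lemma row_cases {t : ℕ} {e : ℕ × ℕ} (he : e ∈ S.row t) :
    (e = (3 * t + 2, S.side t) ∨ e = (3 * t + 3, 3 * t + 2)) ∨
    (e = (3 * t + 4, S.side t) ∨ e = (3 * t + 4, 3 * t + 2) ∨ e = (3 * t + 4, 3 * t + 3)) ∨
    ∃ r, t = r + 1 ∧ e = (3 * (r + 1) + 4, 3 * r + 4) := by
  rcases S.mem_row.1 he with h | h | h | ⟨h, _, h'⟩
  · tauto
  · tauto
  · rcases S.target_cases t with h1 | h1 | h1 <;> rw [h1] at h <;> tauto
  · obtain ⟨r, rfl⟩ := Nat.exists_eq_succ_of_ne_zero h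
    exact .inr (.inr ⟨r, rfl, h'⟩)

lemma separated_hubs {t : ℕ} {f : ℕ × ℕ} (hf : f ∈ S.row t) :
    Separated xPos S.yPos (1, 0) f := by
  have hs := S.side_le t
  refine ⟨1, 0, 0, ?_⟩
  rcases S.row_cases hf with (rfl | rfl) | (rfl | rfl | rfl) | ⟨r, rfl, rfl⟩ <;>
  simp only [xPos_y, xPos_x, xPos_p, xPos_side, xPos_hub zero_le_one, xPos_hub le_rfl] <;>
  omega

/-- The hubs are `(0, ±3)`. The first two vertices of row `t` lie on a ray from its hub that points
to `(6 * t + 9, 0)`, and the path vertex is `(6 * t + 6, 0)`. Rows on one hub are thus nested fans,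
rows on different hubs lie on different sides of the horizontal axis, and the path edges lie on that
axis. -/
lemma separated_rows {s t : ℕ} (hts : t < s) {e f : ℕ × ℕ} (he : e ∈ S.row t) (hf : f ∈ S.row s) :
    Separated xPos S.yPos e f ∨ Separated xPos S.yPos f e := by
  have hf' := S.row_cases hf
  have he' := S.row_cases he
  rw [← or_assoc] at hf'
  rcases hf' with hf' | ⟨r, rfl, rfl⟩
  · rw [← or_assoc] at he'
    rcases he' with he' | ⟨r, rfl, rfl⟩
    · rcases S.sign_eq_or_neg t s with hc | hc
      · left
        -- The line through the common hub that meets the axis at `6 * t + 10.5`, between `6 * t +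
        -- 9` and the next path vertex at `6 * t + 12`.
        refine ⟨2, (4 * t + 7) * S.sign s, - 3 * (4 * t + 7), ?_⟩
        rcases he' with (rfl | rfl) | (rfl | rfl | rfl) <;>
        rcases hf' with (rfl | rfl) | (rfl | rfl | rfl) <;>
        simp only [xPos_y, xPos_x, xPos_p, xPos_side, S.yPos_y, S.yPos_x, S.yPos_p, S.yPos_side,
          hc] <;>
        rcases S.sign_cases s with h | h <;> rw [h] <;> omega
      · left
        -- Different hubs: the horizontal axis separates.
        refine ⟨0, S.sign s, 0, ?_⟩
        rcases he' with (rfl | rfl) | (rfl | rfl | rfl) <;>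
        rcases hf' with (rfl | rfl) | (rfl | rfl | rfl) <;>
        simp only [S.yPos_y, S.yPos_x, S.yPos_p, S.yPos_side, hc] <;>
        rcases S.sign_cases s with h | h <;> rw [h] <;> omega
    · left
      refine ⟨2, (4 * (r + 1) + 7) * S.sign s, - 3 * (4 * (r + 1) + 7), ?_⟩
      rcases hf' with (rfl | rfl) | (rfl | rfl | rfl) <;>
      simp only [xPos_y, xPos_x, xPos_p, xPos_side, S.yPos_y, S.yPos_x, S.yPos_p, S.yPos_side] <;>
      rcases S.sign_cases s with h | h <;> rw [h] <;> push_cast <;> omega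
  · rcases he' with (rfl | rfl) | he' | ⟨r', rfl, rfl⟩
    · right
      refine ⟨0, S.sign t, 0, ?_⟩
      simp only [S.yPos_y, S.yPos_p, S.yPos_side]
      rcases S.sign_cases t with h | h <;> rw [h] <;> omega
    · right
      refine ⟨0, S.sign t, 0, ?_⟩
      simp only [S.yPos_y, S.yPos_x, S.yPos_p]
      rcases S.sign_cases t with h | h <;> rw [h] <;> omega
    · left
      -- A line of slope `±1` through the path vertex of row `t`, which is the only possible common
      -- point with the later path edge.
      refine ⟨1, - S.sign t, - 6 * (t + 1), ?_⟩
      rcases he' with rfl | rfl | rfl <;>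
      simp only [xPos_y, xPos_x, xPos_p, xPos_side, S.yPos_y, S.yPos_x, S.yPos_p, S.yPos_side] <;>
      rcases S.sign_cases t with h | h <;> rw [h] <;> push_cast <;> omega
    · left
      refine ⟨1, 0, - 6 * (r' + 1 + 1), ?_⟩
      simp only [xPos_p, S.yPos_p]
      push_cast; omega

lemma separated_outer_mid (t : ℕ) :
    Separated xPos S.yPos (3 * t + 2, S.side t) (3 * t + 3, 3 * t + 2) := by
  refine ⟨0, - S.sign t, 2, ?_⟩
  simp only [S.yPos_y, S.yPos_x, S.yPos_side]
  rcases S.sign_cases t with h | h <;> rw [h] <;> omega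

lemma separated_outer_inner (t : ℕ) :
    Separated xPos S.yPos (3 * t + 2, S.side t) (3 * t + 4, S.target t) ∨
    Separated xPos S.yPos (3 * t + 4, S.target t) (3 * t + 2, S.side t) := by
  rcases S.target_cases t with h | h | h <;> rw [h]
  · right
    -- The line through the hub that meets the axis at `6 * t + 7.5`, between the path vertex and
    -- the end of the ray at `6 * t + 9`.
    refine ⟨2, (4 * t + 5) * S.sign t, -3 * (4 * t + 5), ?_⟩
    simp only [xPos_y, xPos_p, xPos_side, S.yPos_y, S.yPos_p, S.yPos_side]
    rcases S.sign_cases t with h | h <;> rw [h] <;> omega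
  · left
    refine ⟨0, - S.sign t, 2, ?_⟩
    simp only [S.yPos_y, S.yPos_p, S.yPos_side]
    rcases S.sign_cases t with h | h <;> rw [h] <;> omega
  · left
    refine ⟨0, - S.sign t, 2, ?_⟩
    simp only [S.yPos_y, S.yPos_x, S.yPos_p, S.yPos_side]
    rcases S.sign_cases t with h | h <;> rw [h] <;> omega

lemma separated_inner_mid (t : ℕ) :
    Separated xPos S.yPos (3 * t + 4, S.target t) (3 * t + 3, 3 * t + 2) := by
  rcases S.target_cases t with h | h | h <;> rw [h]
  · refine ⟨2, (4 * t + 5) * S.sign t, -3 * (4 * t + 5), ?_⟩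
    simp only [xPos_y, xPos_x, xPos_p, xPos_side, S.yPos_y, S.yPos_x, S.yPos_p, S.yPos_side]
    rcases S.sign_cases t with h | h <;> rw [h] <;> omega
  -- The line through the shared vertex `3 * t + 2` and the point `(6 * t + 7.5, 0)`.
  · refine ⟨4, (8 * t + 9) * S.sign t, - 4 * (2 * t + 3) - 2 * (8 * t + 9), ?_⟩
    simp only [xPos_y, xPos_x, xPos_p, S.yPos_y, S.yPos_x, S.yPos_p]
    rcases S.sign_cases t with h | h <;> rw [h] <;> omega
  · refine ⟨0, S.sign t, - 1, ?_⟩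
    simp only [S.yPos_y, S.yPos_x, S.yPos_p]
    rcases S.sign_cases t with h | h <;> rw [h] <;> omega

lemma separated_path (r : ℕ) {e : ℕ × ℕ} (he : e = (3 * (r + 1) + 2, S.side (r + 1)) ∨
    e = (3 * (r + 1) + 3, 3 * (r + 1) + 2) ∨ e = (3 * (r + 1) + 4, S.target (r + 1))) :
    Separated xPos S.yPos (3 * (r + 1) + 4, 3 * r + 4) e := by
  rcases he with rfl | rfl | rfl
  · refine ⟨0, S.sign (r + 1), 0, ?_⟩
    simp only [S.yPos_y, S.yPos_p, S.yPos_side]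
    rcases S.sign_cases (r + 1) with h | h <;> rw [h] <;> omega
  · refine ⟨0, S.sign (r + 1), 0, ?_⟩
    simp only [S.yPos_y, S.yPos_x, S.yPos_p]
    rcases S.sign_cases (r + 1) with h | h <;> rw [h] <;> omega
  -- The line through the shared path vertex and the point `(0, ±1)`, which lies below all possible
  -- targets.
  · refine ⟨1, 6 * (r + 2) * S.sign (r + 1), - 6 * (r + 2), ?_⟩
    rcases S.target_cases (r + 1) with h | h | h <;> rw [h] <;>
    simp only [xPos_y, xPos_x, xPos_p, xPos_side, S.yPos_y, S.yPos_x, S.yPos_p, S.yPos_side] <;>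
    rcases S.sign_cases (r + 1) with h | h <;> rw [h] <;> push_cast <;> omega

lemma pairwise_edgeList : S.edgeList.Pairwise fun e f =>
    Separated xPos S.yPos e f ∨ Separated xPos S.yPos f e := by
  unfold edgeList
  rw [List.pairwise_cons]
  constructor
  · intro f hf
    obtain ⟨t, _, hf⟩ := List.mem_flatMap.1 hf
    exact .inl (S.separated_hubs hf)
  · rw [List.pairwise_flatMap]
    constructor
    · intro t _
      have h1 := S.separated_outer_mid t
      have h2 := S.separated_outer_inner t
      have h3 := S.separated_inner_mid t
      unfold row
      split_ifs with h
      · simp only [List.append_nil, List.pairwise_cons, List.mem_cons, List.not_mem_nil, or_false,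
          List.Pairwise.nil, and_true, forall_eq_or_imp, forall_eq]
        tauto
      · obtain ⟨r, rfl⟩ := Nat.exists_eq_succ_of_ne_zero (show t ≠ 0 by tauto)
        have h4 : ∀ e, _ → _ := fun e he => S.separated_path r (e := e) he
        have e1 : 3 * (r + 1) + 1 = 3 * r + 4 := by ring
        simp only [Nat.succ_eq_add_one, List.cons_append, List.nil_append, List.pairwise_cons,
          List.mem_cons, List.not_mem_nil, or_false, List.Pairwise.nil, and_true, forall_eq_or_imp,
          forall_eq, e1] at *
        tauto
    · exact List.pairwise_lt_range.imp fun hts e he f hf => S.separated_rows hts he hf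

/-! ### The graph -/

/-- The graph with the edges `S.edgeList`. -/
def graph : SimpleGraph (Fin (3 * S.T + 2)) where
  Adj u v := ((u : ℕ), (v : ℕ)) ∈ S.edgeList ∨ ((v : ℕ), (u : ℕ)) ∈ S.edgeList
  symm := ⟨fun _ _ h => h.symm⟩
  loopless := ⟨fun u h => by
    rcases h with h | h <;> exact lt_irrefl _ (S.lt_of_mem h).1⟩

def edges : List (Fin (3 * S.T + 2) × Fin (3 * S.T + 2)) :=
  S.edgeList.pmap (fun e h => (⟨e.1, h.2⟩, ⟨e.2, h.1.trans h.2⟩)) fun _ h => S.lt_of_mem h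

lemma mem_edges {u v : Fin (3 * S.T + 2)} : (u, v) ∈ S.edges ↔ ((u : ℕ), (v : ℕ)) ∈ S.edgeList := by
  unfold edges
  rw [List.mem_pmap]
  constructor
  · rintro ⟨⟨a, b⟩, h, h'⟩
    simp only [Prod.mk.injEq] at h'
    rw [← h'.1, ← h'.2]; exact h
  · intro h
    exact ⟨_, h, rfl⟩

lemma map_edges {α : Type*} (f : ℕ → ℕ → α) :
    S.edges.map (fun e => f e.1 e.2) = S.edgeList.map fun e => f e.1 e.2 := by
  unfold edges
  rw [List.map_pmap, ← List.pmap_eq_map (fun _ h => S.lt_of_mem h)]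

/-- By `lt_of_mem` the larger end comes first, so no edge reappears with its ends exchanged. -/
lemma nodup_edges : (S.edges.map fun e => s(e.1, e.2)).Nodup := by
  refine (List.nodup_map_iff_inj_on ?_).2 ?_
  · unfold edges
    refine S.nodup_edgeList.pmap ?_
    rintro ⟨a, b⟩ _ ⟨a', b'⟩ _ h
    simp only [Prod.mk.injEq, Fin.mk.injEq] at h
    rw [h.1, h.2]
  · rintro ⟨a, b⟩ h ⟨a', b'⟩ h' hs
    have h1 := (S.lt_of_mem (S.mem_edges.1 h)).1
    have h2 := (S.lt_of_mem (S.mem_edges.1 h')).1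
    simp only [Sym2.eq_iff] at hs
    rcases hs with ⟨rfl, rfl⟩ | ⟨rfl, rfl⟩
    · rfl
    · simp only at h1 h2; omega

lemma vertex_cases {v : ℕ} (h : v < 3 * S.T + 2) : v = 0 ∨ v = 1 ∨
    ∃ t < S.T, v = 3 * t + 2 ∨ v = 3 * t + 3 ∨ v = 3 * t + 4 := by
  by_cases h0 : v < 2
  · omega
  · exact .inr (.inr ⟨(v - 2) / 3, by omega, by omega⟩)

lemma latticePoint_injective :
    Function.Injective fun v : Fin (3 * S.T + 2) => latticePoint xPos S.yPos v := by
  rintro ⟨u, hu⟩ ⟨v, hv⟩ h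
  simp only [latticePoint, Prod.mk.injEq, Int.cast_inj] at h
  obtain ⟨h1, h2⟩ := h
  simp only [Fin.mk.injEq]
  have y0 : S.yPos 0 = 3 := rfl
  have y1 : S.yPos 1 = -3 := rfl
  rcases S.vertex_cases hu with rfl | rfl | ⟨t, _, rfl | rfl | rfl⟩ <;>
  rcases S.vertex_cases hv with rfl | rfl | ⟨s, _, rfl | rfl | rfl⟩ <;>
  simp only [xPos_y, xPos_x, xPos_p, S.yPos_y, S.yPos_x, S.yPos_p, y0, y1] at h1 h2 <;>
  (try have ht := S.sign_cases t) <;> (try have hs := S.sign_cases s) <;> omega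

lemma adj_of_mem {u v : Fin (3 * S.T + 2)} (h : ((u : ℕ), (v : ℕ)) ∈ S.edgeList) :
    S.graph.Adj u v := .inl h

lemma connected : S.graph.Connected := by
  have hub : ∀ h : ℕ, ∀ hh : h ≤ 1, S.graph.Reachable ⟨h, by omega⟩ ⟨0, by omega⟩ := by
    intro h hh
    rcases (show h = 0 ∨ h = 1 by omega) with rfl | rfl
    · exact .refl _
    · exact (S.adj_of_mem (S.mem_edgeList.2 (.inl rfl))).reachable
  have hy : ∀ t, ∀ ht : t < S.T, S.graph.Reachable ⟨3 * t + 2, by omega⟩ ⟨0, by omega⟩ := by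
    intro t ht
    refine SimpleGraph.Reachable.trans (SimpleGraph.Adj.reachable (S.adj_of_mem
      (S.mem_edgeList.2 (.inr ⟨t, ht, S.mem_row.2 (.inl rfl)⟩)))) (hub _ (S.side_le t))
  have hx : ∀ t, ∀ ht : t < S.T, S.graph.Reachable ⟨3 * t + 3, by omega⟩ ⟨0, by omega⟩ := by
    intro t ht
    refine SimpleGraph.Reachable.trans (SimpleGraph.Adj.reachable (S.adj_of_mem
      (S.mem_edgeList.2 (.inr ⟨t, ht, S.mem_row.2 (.inr (.inl rfl))⟩)))) (hy t ht)
  have hp : ∀ t, ∀ ht : t < S.T, S.graph.Reachable ⟨3 * t + 4, by omega⟩ ⟨0, by omega⟩ := by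
    intro t ht
    have hlt := (S.target_lt t).1
    have h1 : S.graph.Adj ⟨3 * t + 4, by omega⟩ ⟨S.target t, by omega⟩ :=
      S.adj_of_mem (S.mem_edgeList.2 (.inr ⟨t, ht, S.mem_row.2 (.inr (.inr (.inl rfl)))⟩))
    refine h1.reachable.trans ?_
    rcases S.target_cases t with h | h | h
    · convert hub _ (S.side_le t)
    · convert hy t ht
    · convert hx t ht
  have all : ∀ v, S.graph.Reachable v ⟨0, by omega⟩ := by
    rintro ⟨v, hv⟩
    rcases S.vertex_cases hv with rfl | rfl | ⟨t, ht, rfl | rfl | rfl⟩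
    exacts [.refl _, hub 1 le_rfl, hy t ht, hx t ht, hp t ht]
  exact (SimpleGraph.connected_iff_exists_forall_reachable _).2
    ⟨⟨0, by omega⟩, fun v => (all v).symm⟩

/-- Separation gives end vertices of both edges at a common point, and these coincide because
positions are injective. Connectedness rules out isolated vertices. -/
lemma planar : IsPlanar S.graph := by
  refine isPlanar_of_segments _ (fun v => latticePoint xPos S.yPos v) S.latticePoint_injective ?_ ?_
  · intro v
    have : Nontrivial (Fin (3 * S.T + 2)) := Fin.nontrivial_iff_two_le.2 (by omega)
    obtain ⟨w, hw⟩ := exists_ne v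
    obtain ⟨p⟩ := S.connected.preconnected v w
    cases p with
    | nil => exact absurd rfl hw
    | cons h _ => exact ⟨_, h⟩
  · have sym : ∀ e f : ℕ × ℕ, e ∈ S.edgeList → f ∈ S.edgeList → e ≠ f →
        Separated xPos S.yPos e f ∨ Separated xPos S.yPos f e := fun e f he hf hef => by
      have : Std.Symm fun e f => Separated xPos S.yPos e f ∨ Separated xPos S.yPos f e :=
        ⟨fun _ _ h => h.symm⟩
      exact S.pairwise_edgeList.forall he hf hef
    have key : ∀ u v u' v' : Fin (3 * S.T + 2), ((u : ℕ), (v : ℕ)) ∈ S.edgeList →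
        ((u' : ℕ), (v' : ℕ)) ∈ S.edgeList → s(u, v) ≠ s(u', v') → ∀ x ∈
        segment ℝ (latticePoint xPos S.yPos u) (latticePoint xPos S.yPos v) ∩
        segment ℝ (latticePoint xPos S.yPos u') (latticePoint xPos S.yPos v'),
        ∃ w, w ∈ s(u, v) ∧ w ∈ s(u', v') ∧ latticePoint xPos S.yPos w = x := by
      intro u v u' v' he hf hne x hx
      have fin : ∀ w w' : ℕ, (w = u ∨ w = v) → (w' = u' ∨ w' = v') →
          latticePoint xPos S.yPos w = x → latticePoint xPos S.yPos w' = x →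
          ∃ w, w ∈ s(u, v) ∧ w ∈ s(u', v') ∧ latticePoint xPos S.yPos w = x := by
        intro w w' h1 h2 h3 h4
        have : ∃ z : Fin (3 * S.T + 2), (z : ℕ) = w ∧ z ∈ s(u, v) := by
          rcases h1 with rfl | rfl
          · exact ⟨u, rfl, Sym2.mem_mk_left _ _⟩
          · exact ⟨v, rfl, Sym2.mem_mk_right _ _⟩
        obtain ⟨z, rfl, hz⟩ := this
        have : ∃ z : Fin (3 * S.T + 2), (z : ℕ) = w' ∧ z ∈ s(u', v') := by
          rcases h2 with rfl | rfl
          · exact ⟨u', rfl, Sym2.mem_mk_left _ _⟩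
          · exact ⟨v', rfl, Sym2.mem_mk_right _ _⟩
        obtain ⟨z', rfl, hz'⟩ := this
        obtain rfl : z = z' := S.latticePoint_injective (h3.trans h4.symm)
        exact ⟨z, hz, hz', h3⟩
      rcases sym _ _ he hf (fun h => hne (by
          simp only [Prod.mk.injEq, Fin.val_inj] at h
          rw [h.1, h.2])) with h | h
      · obtain ⟨w, w', h1, h2, h3, h4⟩ := h.exists_endpoint hx
        exact fin w w' h1 h2 h3 h4
      · obtain ⟨w, w', h1, h2, h3, h4⟩ := h.exists_endpoint hx.symm
        exact fin w' w h2 h1 h4 h3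
    intro u v u' v' h h' hne x hx
    rcases h with h | h <;> rcases h' with h' | h'
    · exact key u v u' v' h h' hne x hx
    · rw [Sym2.eq_swap (a := u')] at hne ⊢
      rw [segment_symm ℝ (latticePoint xPos S.yPos u')] at hx
      exact key u v v' u' h h' hne x hx
    · rw [Sym2.eq_swap (a := u)] at hne ⊢
      rw [segment_symm ℝ (latticePoint xPos S.yPos u)] at hx
      exact key v u u' v' h h' hne x hx
    · rw [Sym2.eq_swap (a := u), Sym2.eq_swap (a := u')] at hne ⊢
      rw [segment_symm ℝ (latticePoint xPos S.yPos u),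
        segment_symm ℝ (latticePoint xPos S.yPos u')] at hx
      exact key v u v' u' h h' hne x hx

end Spokes

/-! ### Bounds for the discrete Fréchet distance -/

/-- Reachability by close steps yields a monotone walk. The relation only tests the pair that is
entered, so closeness of the first pair is a separate hypothesis. -/
lemma discreteFrechet_le {V : Type*} {G : SimpleGraph V} {n m : ℕ} {p : Fin n → V} {q : Fin m → V}
    {c : ℕ∞} {s t : Fin n × Fin m} (hs : (s.1 : ℕ) = 0 ∧ (s.2 : ℕ) = 0)
    (ht : (t.1 : ℕ) + 1 = n ∧ (t.2 : ℕ) + 1 = m) (hc : G.edist (p s.1) (q s.2) ≤ c)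
    (h : Relation.ReflTransGen
      (fun s t => MonotoneStep s t ∧ G.edist (p t.1) (q t.2) ≤ c) s t) :
    discreteFrechet G p q ≤ c := by
  obtain ⟨l, hl, hlast⟩ := List.exists_isChain_cons_of_relationReflTransGen h
  have hall : ∀ (l : List (Fin n × Fin m)) (a : Fin n × Fin m), G.edist (p a.1) (q a.2) ≤ c →
      (a :: l).IsChain (fun s t => MonotoneStep s t ∧ G.edist (p t.1) (q t.2) ≤ c) →
      ∀ x ∈ a :: l, G.edist (p x.1) (q x.2) ≤ c := by
    intro l
    induction l with
    | nil => intro a ha _ x hx; simp only [List.mem_singleton] at hx; rwa [hx]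
    | cons b l ih =>
      intro a ha hl x hx
      rw [List.isChain_cons_cons] at hl
      rcases List.mem_cons.1 hx with rfl | hx
      · exact ha
      · exact ih b hl.1.2 hl.2 x hx
  have hw : IsMonotoneWalk (s :: l) := by
    refine ⟨hl.imp fun _ _ h => h.1, ⟨s, by simp, hs⟩, ⟨t, ?_, ht⟩⟩
    rw [List.getLast?_eq_getLast_of_ne_nil (List.cons_ne_nil s l), hlast]
    simp
  exact (iInf₂_le _ hw).trans (iSup₂_le fun x hx => hall l s hc hl x hx)

/-- The lower bound by an invariant: distances are in `ℕ∞`, so a value below `c + 1` yields a walk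
all of whose pairs have distance at most `c`. The invariant propagates along it and contradicts
`hend`. -/
lemma le_discreteFrechet {V : Type*} {G : SimpleGraph V} {n m : ℕ} {p : Fin n → V} {q : Fin m → V}
    {c : ℕ} (I : ℕ → ℕ → Prop) (h0 : I 0 0) (hend : ∀ i j, i + 1 = n → j + 1 = m → ¬ I i j)
    (hstep : ∀ s t : Fin n × Fin m, MonotoneStep s t → I s.1 s.2 →
      G.edist (p t.1) (q t.2) ≤ c → I t.1 t.2) :
    (c : ℕ∞) + 1 ≤ discreteFrechet G p q := by
  refine le_iInf₂ fun F hF => ?_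
  by_contra hlt
  have hall : ∀ s ∈ F, G.edist (p s.1) (q s.2) ≤ c := fun s hs => by
    have h1 : G.edist (p s.1) (q s.2) ≤ ⨆ s ∈ F, G.edist (p s.1) (q s.2) :=
      le_iSup₂ (f := fun s (_ : s ∈ F) => G.edist (p s.1) (q s.2)) s hs
    exact Order.le_of_lt_add_one (h1.trans_lt (not_le.1 hlt))
  obtain ⟨hch, ⟨s, hs, hs0⟩, ⟨t, ht, ht0⟩⟩ := hF
  have main : ∀ (l : List (Fin n × Fin m)) (a : Fin n × Fin m), I a.1 a.2 →
      (∀ x ∈ a :: l, G.edist (p x.1) (q x.2) ≤ c) → (a :: l).IsChain MonotoneStep →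
      ∀ x ∈ a :: l, I x.1 x.2 := by
    intro l
    induction l with
    | nil => intro a ha _ _ x hx; simp only [List.mem_singleton] at hx; rwa [hx]
    | cons b l ih =>
      intro a ha hl hc x hx
      rw [List.isChain_cons_cons] at hc
      rcases List.mem_cons.1 hx with rfl | hx
      · exact ha
      · exact ih b (hstep a b hc.1 ha (hl b (by simp))) (fun x hx => hl x (List.mem_cons_of_mem _ hx))
          hc.2 x hx
  cases F with
  | nil => simp at hs
  | cons a l =>
    simp only [List.head?_cons, Option.mem_def, Option.some.injEq] at hs
    subst hs
    refine hend _ _ ht0.1 ht0.2 (main l a ?_ hall hch t (List.mem_of_getLast? ht))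
    rw [hs0.1, hs0.2]; exact h0

namespace Spokes

variable (S : Spokes)

/-- The vertex with number `v`. -/
def vert (v : ℕ) : Fin (3 * S.T + 2) := Fin.ofNat _ v

lemma vert_val {v : ℕ} (h : v < 3 * S.T + 2) : ((S.vert v : Fin _) : ℕ) = v := Nat.mod_eq_of_lt h

lemma adj_vert {u v : ℕ} (h : (u, v) ∈ S.edgeList) : S.graph.Adj (S.vert u) (S.vert v) := by
  have := S.lt_of_mem h
  left
  rwa [S.vert_val this.2, S.vert_val (this.1.trans this.2)]

/-- The vertices with the numbers `u` and `v` have distance at most `k`. -/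
def Near (k u v : ℕ) : Prop := S.graph.edist (S.vert u) (S.vert v) ≤ k

variable {S}

namespace Near

lemma trans {j k u v w : ℕ} (h : S.Near j u v) (h' : S.Near k v w) : S.Near (j + k) u w := by
  refine (SimpleGraph.edist_triangle (v := S.vert v)).trans ?_
  push_cast
  exact add_le_add h h'

lemma symm {k u v : ℕ} (h : S.Near k u v) : S.Near k v u := by
  unfold Near; rw [SimpleGraph.edist_comm]; exact h

lemma mono {j k u v : ℕ} (h : S.Near j u v) (hjk : j ≤ k) : S.Near k u v :=
  le_trans h (by exact_mod_cast hjk)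

lemma rfl {k u : ℕ} : S.Near k u u := by
  unfold Near; simp

lemma of_mem {u v : ℕ} (h : (u, v) ∈ S.edgeList) : S.Near 1 u v := by
  unfold Near
  rw [SimpleGraph.edist_eq_one_iff_adj.2 (S.adj_vert h)]; simp

end Near

lemma near_hubs {h h' : ℕ} (hh : h ≤ 1) (hh' : h' ≤ 1) : S.Near 1 h h' := by
  have : S.Near 1 1 0 := .of_mem (S.mem_edgeList.2 (.inl rfl))
  rcases (show h = 0 ∨ h = 1 by omega) with rfl | rfl <;>
  rcases (show h' = 0 ∨ h' = 1 by omega) with rfl | rfl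
  exacts [.rfl, this.symm, this, .rfl]

lemma near_side {t : ℕ} (ht : t < S.T) : S.Near (S.ell t) (3 * t + 4) (S.side t) := by
  have h1 : S.Near 1 (3 * t + 2) (S.side t) :=
    .of_mem (S.mem_edgeList.2 (.inr ⟨t, ht, S.mem_row.2 (.inl rfl)⟩))
  have h2 : S.Near 1 (3 * t + 3) (3 * t + 2) :=
    .of_mem (S.mem_edgeList.2 (.inr ⟨t, ht, S.mem_row.2 (.inr (.inl rfl))⟩))
  have h3 : S.Near 1 (3 * t + 4) (S.target t) :=
    .of_mem (S.mem_edgeList.2 (.inr ⟨t, ht, S.mem_row.2 (.inr (.inr (.inl rfl)))⟩))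
  have := S.one_le_ell t
  have := S.ell_le t
  unfold target at h3
  split_ifs at h3 with h h'
  · exact h3.mono (by omega)
  · exact (h3.trans h1).mono (by omega)
  · exact (h3.trans (h2.trans h1)).mono (by omega)

/-- Distance to a hub. -/
lemma near_hub {t h k : ℕ} (ht : t < S.T) (hh : h ≤ 1)
    (hk : S.ell t + (if S.side t = h then 0 else 1) ≤ k) : S.Near k (3 * t + 4) h := by
  have h1 := near_side ht
  split_ifs at hk with hs
  · rw [hs] at h1; exact h1.mono hk
  · exact (h1.trans (near_hubs (S.side_le t) hh)).mono hk

lemma near_succ {t : ℕ} (ht : t + 1 < S.T) (hn : t + 1 ≠ S.n) :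
    S.Near 1 (3 * (t + 1) + 4) (3 * t + 4) :=
  .of_mem (S.mem_edgeList.2 (.inr ⟨t + 1, ht, S.mem_row.2
    (.inr (.inr (.inr ⟨by omega, hn, by ring_nf⟩)))⟩))

/-! ### Lower bounds for distances -/

/-- Given numbers `a t` for the path vertices, extend them to a lower bound for the distance of a
vertex to the hub `h`. -/
def label (S : Spokes) (h : ℕ) (a : ℕ → ℕ) (v : ℕ) : ℤ :=
  if v = h then 0 else if v < 2 then 1 else
    if (v - 2) % 3 = 2 then a ((v - 2) / 3)
    else ((v - 2) % 3 + 1 : ℕ) + if S.side ((v - 2) / 3) = h then 0 else 1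

/-- The numbers `a t` may be distances from the hub `h`. -/
structure IsLabel (S : Spokes) (h : ℕ) (a : ℕ → ℕ) : Prop where
  attach : ∀ t < S.T, a t ≤ S.ell t + (if S.side t = h then 0 else 1) ∧
    S.ell t + (if S.side t = h then 0 else 1) ≤ a t + 2
  step : ∀ t, t + 1 < S.T → t + 1 ≠ S.n → a t ≤ a (t + 1) + 1 ∧ a (t + 1) ≤ a t + 1

lemma label_p {h t : ℕ} (hh : h ≤ 1) (a : ℕ → ℕ) : S.label h a (3 * t + 4) = a t := by
  obtain ⟨_, _, _, _, h1, h2⟩ := div_mod t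
  rw [label, h1, h2, if_neg (by omega), if_neg (by omega), if_pos rfl]

lemma label_x {h t : ℕ} (hh : h ≤ 1) (a : ℕ → ℕ) :
    S.label h a (3 * t + 3) = 2 + if S.side t = h then 0 else 1 := by
  obtain ⟨_, _, h1, h2, _⟩ := div_mod t
  rw [label, h1, h2, if_neg (by omega), if_neg (by omega), if_neg (by omega)]; rfl

lemma label_y {h t : ℕ} (hh : h ≤ 1) (a : ℕ → ℕ) :
    S.label h a (3 * t + 2) = 1 + if S.side t = h then 0 else 1 := by
  obtain ⟨h1, h2, _⟩ := div_mod t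
  rw [label, h1, h2, if_neg (by omega), if_neg (by omega), if_neg (by omega)]; rfl

lemma label_hub {h h' : ℕ} (hh : h' ≤ 1) (a : ℕ → ℕ) :
    S.label h a h' = if h' = h then 0 else 1 := by
  unfold label
  rw [if_pos (by omega : h' < 2)]

lemma label_lipschitz {h : ℕ} (hh : h ≤ 1) {a : ℕ → ℕ} (ha : S.IsLabel h a) {e : ℕ × ℕ}
    (he : e ∈ S.edgeList) :
    S.label h a e.1 ≤ S.label h a e.2 + 1 ∧ S.label h a e.2 ≤ S.label h a e.1 + 1 := by
  rcases S.mem_edgeList.1 he with rfl | ⟨t, ht, he⟩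
  · rw [label_hub le_rfl, label_hub zero_le_one]
    split_ifs <;> omega
  · rcases S.mem_row.1 he with rfl | rfl | rfl | ⟨h1, h2, rfl⟩
    · dsimp only
      rw [label_y hh, label_hub (S.side_le t)]; omega
    · dsimp only
      rw [label_y hh, label_x hh]; omega
    -- The target is one step nearer to its hub than the path vertex, so the two bounds of `attach`
    -- are exactly the Lipschitz condition on this edge.
    · have := ha.attach t ht
      have := S.one_le_ell t
      have := S.ell_le t
      dsimp only
      unfold target
      split_ifs with h1 h2
      · rw [label_p hh, label_hub (S.side_le t)]
        split_ifs at * <;> omega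
      · rw [label_p hh, label_y hh]
        split_ifs at * <;> omega
      · rw [label_p hh, label_x hh]
        split_ifs at * <;> omega
    · obtain ⟨r, rfl⟩ := Nat.exists_eq_succ_of_ne_zero h1
      have := ha.step r ht h2
      dsimp only
      rw [show 3 * r.succ + 1 = 3 * r + 4 by omega, label_p hh, label_p hh]
      simp only [Nat.succ_eq_add_one]; omega

lemma walk_le {N : ℕ} {G : SimpleGraph (Fin N)} (f : Fin N → ℤ)
    (hf : ∀ u v, G.Adj u v → f v ≤ f u + 1) {u v : Fin N} (p : G.Walk u v) :
    f v ≤ f u + p.length := by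
  induction p with
  | nil => simp
  | cons h p ih =>
    have := hf _ _ h
    rw [SimpleGraph.Walk.length_cons]; push_cast; omega

/-- A path vertex of a row before `n` and one of a row from `n` on are joined only through the
hubs. -/
lemma le_of_near {a b : ℕ → ℕ} (ha : S.IsLabel 0 a) (hb : S.IsLabel 1 b) {i j k : ℕ}
    (hab : a i ≤ b i + 1 ∧ b i ≤ a i + 1) (hi : i < S.n) (hn : S.n ≤ j) (hj : j < S.T)
    (h : S.Near k (3 * i + 4) (3 * j + 4)) : a i + a j ≤ k ∨ b i + b j ≤ k := by
  -- A potential that vanishes at the path vertex of row `i`. On the side of the first path it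
  -- subtracts hub labels, on the other side it adds them to the labels of row `i`.
  set fP : ℕ → ℤ := fun v => max (a i - S.label 0 a v) (b i - S.label 1 b v) with hfP
  set fQ : ℕ → ℤ := fun v => min (a i + S.label 0 a v) (b i + S.label 1 b v) with hfQ
  -- The two halves can be glued at the hubs because `a i` and `b i` differ by at most one.
  have hub : ∀ v ≤ 1, fP v = fQ v := by
    intro v hv
    simp only [hfP, hfQ]
    rw [label_hub hv, label_hub hv]
    rcases (show v = 0 ∨ v = 1 by omega) with rfl | rfl <;> norm_num <;> omega
  set f : ℕ → ℤ := fun v => if v < 3 * S.n + 2 then fP v else fQ v with hf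
  have hlip : ∀ e ∈ S.edgeList, f e.1 ≤ f e.2 + 1 ∧ f e.2 ≤ f e.1 + 1 := by
    intro e he
    have l1 := label_lipschitz zero_le_one ha he
    have l2 := label_lipschitz le_rfl hb he
    have hP : fP e.1 ≤ fP e.2 + 1 ∧ fP e.2 ≤ fP e.1 + 1 := by simp only [hfP]; omega
    have hQ : fQ e.1 ≤ fQ e.2 + 1 ∧ fQ e.2 ≤ fQ e.1 + 1 := by simp only [hfQ]; omega
    have cases : (f e.1 = fP e.1 ∧ f e.2 = fP e.2) ∨ (f e.1 = fQ e.1 ∧ f e.2 = fQ e.2) := by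
      have fQ' : ∀ v, v ≤ 1 ∨ 3 * S.n + 2 ≤ v → f v = fQ v := by
        intro v hv
        simp only [hf]
        split_ifs with h
        · exact hub v (by omega)
        · rfl
      rcases S.mem_edgeList.1 he with rfl | ⟨t, ht, he⟩
      · left; constructor <;> exact if_pos (by dsimp only; omega)
      · have hs := S.side_le t
        have hc := S.target_cases t
        by_cases htn : t < S.n
        · left
          constructor <;> refine if_pos ?_ <;>
          rcases S.mem_row.1 he with rfl | rfl | rfl | ⟨h1, h2, rfl⟩ <;> dsimp only <;> omega
        · right
          constructor <;> apply fQ' <;>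
          rcases S.mem_row.1 he with rfl | rfl | rfl | ⟨h1, h2, rfl⟩ <;> dsimp only <;> omega
    rcases cases with ⟨h1, h2⟩ | ⟨h1, h2⟩ <;> rw [h1, h2] <;> assumption
  have hne : S.graph.edist (S.vert (3 * i + 4)) (S.vert (3 * j + 4)) ≠ ⊤ :=
    ne_top_of_le_ne_top (ENat.natCast_ne_top k) h
  obtain ⟨p, hp⟩ := SimpleGraph.exists_walk_of_edist_ne_top hne
  have hlen : p.length ≤ k := by
    have : (p.length : ℕ∞) ≤ k := hp ▸ h
    exact_mod_cast this
  have := walk_le (fun v => f v) (fun u v huv => by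
    rcases huv with huv | huv
    · exact (hlip _ huv).2
    · exact (hlip _ huv).1) p
  rw [S.vert_val (by omega), S.vert_val (by omega)] at this
  have e1 : f (3 * i + 4) = 0 := by
    simp only [hf, hfP]
    rw [if_pos (by omega), label_p zero_le_one, label_p le_rfl]; simp
  have e2 : f (3 * j + 4) = min (a i + a j : ℤ) (b i + b j) := by
    simp only [hf, hfQ]
    rw [if_neg (by omega), label_p zero_le_one, label_p le_rfl]
  rw [e1, e2] at this
  omega

end Spokes

/-! ### Encoding vectors by paths -/

/-- An instance for the reduction: `u` vectors `U i` and `w` vectors `W j` of dimension `d`, which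
are encoded by paths with `n` and `m` vertices. -/
structure Gadget where
  (d u w n m : ℕ)
  (U W : ℕ → ℕ → Bool)
  hn : u * (4 * d + 6) ≤ n
  hm : w * (4 * d + 6) + 8 ≤ m
  one_le_n : 1 ≤ n

namespace Gadget

/-- Distance from the hub of the vertex at position `r` of the first kind of vector gadget. -/
def ellP (d : ℕ) (x : ℕ → Bool) (r : ℕ) : ℕ :=
  if r = 0 ∨ r = 4 * d + 5 then 1 else if r = 1 ∨ r = 4 * d + 4 then 2 else
    if r % 4 = 1 then 2 + (x (r / 4 - 1)).toNat else 3

/-- The positions that are 3 modulo 4 are markers on hub `1` between the coordinates, which stand at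
`4 * k + 5`. The last two positions lead over to hub `1`. -/
def sideP (d r : ℕ) : ℕ := if r % 4 = 3 ∨ r = 4 * d + 4 ∨ r = 4 * d + 5 then 1 else 0

/-- Distance from the hub of the vertex at position `r` of the second kind of vector gadget. -/
def ellQ (d : ℕ) (x : ℕ → Bool) (r : ℕ) : ℕ :=
  if r = 0 ∨ r = 4 * d + 5 then 3 else if r = 1 ∨ r = 4 * d + 4 then 2 else
    if r % 4 = 1 then 1 + (x (r / 4 - 1)).toNat else 1

/-- The first and the last position hang on the hub opposite to that of their neighbour inside the
gadget. As that neighbour has distance 2 from its hub, the end positions have distance 3 from both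
hubs. -/
def sideQ (d r : ℕ) : ℕ := if r % 4 = 3 ∨ r = 4 * d + 4 ∨ r = 0 then 1 else 0

variable (g : Gadget)

/-- Length of a vector gadget. -/
def L : ℕ := 4 * g.d + 6

lemma L_pos : 0 < g.L := by unfold L; omega

/-- Position in its vector gadget of the vertex `i` of the first path. -/
def posP (i : ℕ) : ℕ := if i / g.L < g.u then i % g.L else 4 * g.d + 5

/-- Data of the vertex `j` of the second path, for `0 < j < m - 1`. -/
def ellRowQ (j : ℕ) : ℕ :=
  if j < 4 then max j 1 else if (j - 4) / g.L < g.w then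
    ellQ g.d (g.W ((j - 4) / g.L)) ((j - 4) % g.L)
  else if j = 4 + g.w * g.L then 3 else if j = 5 + g.w * g.L then 2 else 1

def sideRowQ (j : ℕ) : ℕ :=
  if j < 4 then 0 else if (j - 4) / g.L < g.w then sideQ g.d ((j - 4) % g.L) else 1

lemma ellP_bounds (d : ℕ) (x : ℕ → Bool) (r : ℕ) : 1 ≤ ellP d x r ∧ ellP d x r ≤ 3 := by
  have := Bool.toNat_le (x (r / 4 - 1))
  unfold ellP; split_ifs <;> omega

lemma ellQ_bounds (d : ℕ) (x : ℕ → Bool) (r : ℕ) : 1 ≤ ellQ d x r ∧ ellQ d x r ≤ 3 := by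
  have := Bool.toNat_le (x (r / 4 - 1))
  unfold ellQ; split_ifs <;> omega

/-- `max j 1` in the definition is there to keep this true at `j = 0`, which is not the index of any
row. -/
lemma ellRowQ_bounds (j : ℕ) : 1 ≤ g.ellRowQ j ∧ g.ellRowQ j ≤ 3 := by
  have := ellQ_bounds g.d (g.W ((j - 4) / g.L)) ((j - 4) % g.L)
  unfold ellRowQ; split_ifs <;> omega

/-- The graph with both paths. -/
def spokes : Spokes where
  T := g.n + (g.m - 2)
  n := g.n
  ell t := if t < g.n then ellP g.d (g.U (t / g.L)) (g.posP t) else g.ellRowQ (t - g.n + 1)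
  side t := if t < g.n then sideP g.d (g.posP t) else g.sideRowQ (t - g.n + 1)
  one_le_ell t := by
    split_ifs
    exacts [(ellP_bounds _ _ _).1, (g.ellRowQ_bounds _).1]
  ell_le t := by
    split_ifs
    exacts [(ellP_bounds _ _ _).2, (g.ellRowQ_bounds _).2]
  side_le t := by
    unfold sideRowQ sideP sideQ
    split_ifs <;> simp

/-- Numbers of the vertices of the two paths. -/
def vertP (i : ℕ) : ℕ := 3 * i + 4
-- The ends of the second path are the hubs themselves, so the inner vertex `j` is the path vertex
-- of row `n + j - 1`.
def vertQ (j : ℕ) : ℕ := if j = 0 then 0 else if j + 1 = g.m then 1 else 3 * (g.n + j) + 1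

lemma decompose {i L : ℕ} (hL : 0 < L) : ∃ v r, i = v * L + r ∧ r < L :=
  ⟨i / L, i % L, by rw [mul_comm]; exact (Nat.div_add_mod i L).symm, Nat.mod_lt _ hL⟩

lemma div_eq {v r L : ℕ} (h : r < L) : (v * L + r) / L = v := by
  rw [mul_comm, Nat.mul_add_div (by omega), Nat.div_eq_of_lt h, add_zero]

lemma mod_eq {v r L : ℕ} (h : r < L) : (v * L + r) % L = r := by
  rw [mul_comm, Nat.mul_add_mod, Nat.mod_eq_of_lt h]

lemma lt_of_mul_add {v w r L : ℕ} (h : v < w) (hr : r < L) : v * L + r < w * L := by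
  have : (v + 1) * L ≤ w * L := Nat.mul_le_mul_right _ h
  rw [add_mul] at this; omega

lemma le_of_not_lt {v w r L : ℕ} (h : ¬ v < w) : w * L ≤ v * L + r := by
  have : w * L ≤ v * L := Nat.mul_le_mul_right _ (by omega)
  omega

/-- Values for the rows of the first path. -/
lemma ell_P {v r : ℕ} (hv : v < g.u) (hr : r < g.L) :
    v * g.L + r < g.n ∧ g.spokes.ell (v * g.L + r) = ellP g.d (g.U v) r ∧
      g.spokes.side (v * g.L + r) = sideP g.d r := by
  have h1 : v * g.L + r < g.n := (lt_of_mul_add hv hr).trans_le g.hn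
  refine ⟨h1, ?_, ?_⟩
  · simp only [spokes, if_pos h1, posP, div_eq hr, mod_eq hr, if_pos hv]
  · simp only [spokes, if_pos h1, posP, div_eq hr, mod_eq hr, if_pos hv]

/-- Padding repeats the last position of a gadget. Such vertices are on hub `1` and cannot serve as
a start of a gadget. -/
lemma ell_P_pad {i : ℕ} (hi : g.u * g.L ≤ i) (hin : i < g.n) :
    g.spokes.ell i = 1 ∧ g.spokes.side i = 1 := by
  have h : ¬ i / g.L < g.u := by
    rw [not_lt, Nat.le_div_iff_mul_le g.L_pos]; exact hi
  simp [spokes, if_pos hin, posP, h, ellP, sideP]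

/-- Values for the rows of the second path. -/
lemma ell_Q_gadget {v r : ℕ} (hv : v < g.w) (hr : r < g.L) :
    g.spokes.ell (g.n + 3 + (v * g.L + r)) = ellQ g.d (g.W v) r ∧
      g.spokes.side (g.n + 3 + (v * g.L + r)) = sideQ g.d r := by
  have h1 : ¬ (g.n + 3 + (v * g.L + r) < g.n) := by omega
  have h2 : g.n + 3 + (v * g.L + r) - g.n + 1 = v * g.L + r + 4 := by omega
  have h3 : ¬ (v * g.L + r + 4 < 4) := by omega
  constructor
  · simp only [spokes, if_neg h1, h2, ellRowQ, if_neg h3, Nat.add_sub_cancel, div_eq hr, mod_eq hr,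
      if_pos hv]
  · simp only [spokes, if_neg h1, h2, sideRowQ, if_neg h3, Nat.add_sub_cancel, div_eq hr,
      mod_eq hr, if_pos hv]

lemma ell_Q_head {j : ℕ} (hj : j < 3) :
    g.spokes.ell (g.n + j) = j + 1 ∧ g.spokes.side (g.n + j) = 0 := by
  have h3 : j + 1 < 4 := by omega
  simp [spokes, ellRowQ, sideRowQ, h3]

/-- The tail descends through distances 3, 2, 1 to hub `1` and stays at distance 1 until the path
ends in the hub. Together with the four vertices before the gadgets this explains the `8` in `hm`.
-/
lemma ell_Q_tail {s : ℕ} :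
    g.spokes.ell (g.n + 3 + (g.w * g.L + s)) = (if s = 0 then 3 else if s = 1 then 2 else 1) ∧
      g.spokes.side (g.n + 3 + (g.w * g.L + s)) = 1 := by
  have h1 : ¬ (g.n + 3 + (g.w * g.L + s) < g.n) := by omega
  have h2 : g.n + 3 + (g.w * g.L + s) - g.n + 1 = g.w * g.L + s + 4 := by omega
  have h3 : ¬ (g.w * g.L + s + 4 < 4) := by omega
  have h4 : ¬ (g.w * g.L + s) / g.L < g.w := by
    rw [not_lt, Nat.le_div_iff_mul_le g.L_pos]; omega
  have e1 : g.w * g.L + s + 4 = 4 + g.w * g.L ↔ s = 0 := by omega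
  have e2 : g.w * g.L + s + 4 = 5 + g.w * g.L ↔ s = 1 := by omega
  constructor
  · simp only [spokes, if_neg h1, h2, ellRowQ, if_neg h3, Nat.add_sub_cancel, if_neg h4, e1, e2]
  · simp only [spokes, if_neg h1, h2, sideRowQ, if_neg h3, Nat.add_sub_cancel, if_neg h4]

/-- Where a vertex of the first path lies. -/
lemma cases_P {i : ℕ} : (∃ v r, v < g.u ∧ r < g.L ∧ i = v * g.L + r) ∨ g.u * g.L ≤ i := by
  obtain ⟨v, r, h1, h2⟩ := decompose (i := i) g.L_pos
  by_cases hv : v < g.u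
  · exact .inl ⟨v, r, hv, h2, h1⟩
  · exact .inr (h1 ▸ le_of_not_lt hv)

/-- Where an inner vertex of the second path lies. -/
lemma cases_Q {j : ℕ} : j < 4 ∨
    (∃ v r, v < g.w ∧ r < g.L ∧ j = 4 + (v * g.L + r)) ∨ ∃ s, j = 4 + (g.w * g.L + s) := by
  by_cases h : j < 4
  · exact .inl h
  obtain ⟨v, r, h1, h2⟩ := decompose (i := j - 4) g.L_pos
  by_cases hv : v < g.w
  · exact .inr (.inl ⟨v, r, hv, h2, by omega⟩)
  · have := h1 ▸ le_of_not_lt (r := r) (L := g.L) hv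
    exact .inr (.inr ⟨j - 4 - g.w * g.L, by omega⟩)

/-! ### Upper bounds for distances -/

/-- This lets the first path move freely while the second stands on a hub. -/
lemma near_hub_P {i h : ℕ} (hi : i < g.n) (hh : h ≤ 1) : g.spokes.Near 4 (vertP i) h := by
  have := g.spokes.ell_le i
  refine Spokes.near_hub (by simp only [spokes]; omega) hh ?_
  split_ifs <;> omega

lemma vertQ_eq {j : ℕ} (h0 : j ≠ 0) (hm : j + 1 ≠ g.m) : g.vertQ j = 3 * (g.n + (j - 1)) + 4 := by
  unfold vertQ
  rw [if_neg h0, if_neg hm]; omega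

lemma near_hub_Q {j h k : ℕ} (h0 : j ≠ 0) (hm : j + 1 < g.m) (hh : h ≤ 1)
    (hk : g.spokes.ell (g.n + (j - 1)) + (if g.spokes.side (g.n + (j - 1)) = h then 0 else 1) ≤ k) :
    g.spokes.Near k (g.vertQ j) h := by
  rw [g.vertQ_eq h0 (by omega)]
  exact Spokes.near_hub (by simp only [spokes]; omega) hh hk

lemma near_succ_Q {j : ℕ} (h0 : j ≠ 0) (hm : j + 2 < g.m) :
    g.spokes.Near 1 (g.vertQ (j + 1)) (g.vertQ j) := by
  rw [g.vertQ_eq h0 (by omega), g.vertQ_eq (by omega) (by omega)]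
  rw [show g.n + (j + 1 - 1) = g.n + (j - 1) + 1 by omega]
  refine Spokes.near_succ (by simp only [spokes]; omega) (by simp only [spokes]; omega)

lemma near_hub_Q_gadget {v r h k : ℕ} (hv : v < g.w) (hr : r < g.L) (hh : h ≤ 1)
    (hk : ellQ g.d (g.W v) r + (if sideQ g.d r = h then 0 else 1) ≤ k) :
    g.spokes.Near k (g.vertQ (4 + (v * g.L + r))) h := by
  have h1 := lt_of_mul_add hv hr
  have h2 := g.hm
  have h3 : g.w * g.L = g.w * (4 * g.d + 6) := rfl
  refine g.near_hub_Q (by omega) (by omega) hh ?_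
  have e : g.n + (4 + (v * g.L + r) - 1) = g.n + 3 + (v * g.L + r) := by omega
  rw [e, (g.ell_Q_gadget hv hr).1, (g.ell_Q_gadget hv hr).2]
  exact hk

/-- The start of a gadget of the first path, at distance 1 from hub `0`, is therefore close to all
of the second path before its tail. -/
lemma near_hub_zero_Q {j : ℕ} (hj : j < 4 + g.w * g.L) : g.spokes.Near 3 (g.vertQ j) 0 := by
  have hm := g.hm
  have hL : g.w * g.L = g.w * (4 * g.d + 6) := rfl
  by_cases h0 : j = 0
  · subst h0; exact Spokes.Near.rfl
  rcases g.cases_Q (j := j) with h | ⟨v, r, hv, hr, rfl⟩ | ⟨s, rfl⟩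
  · refine g.near_hub_Q h0 (by omega) (by omega) ?_
    rw [(g.ell_Q_head (by omega)).1, (g.ell_Q_head (by omega)).2, if_pos rfl]; omega
  · have hlt := lt_of_mul_add hv hr
    have hr' : r < 4 * g.d + 6 := hr
    by_cases hr0 : r = 0
    · subst hr0
      -- The first position of a gadget hangs on hub `1`; it reaches hub `0` through its successor.
      have h1 : g.spokes.Near 2 (g.vertQ (4 + (v * g.L + 1))) 0 := by
        refine g.near_hub_Q_gadget hv (by unfold L; omega) (by omega) ?_
        simp [ellQ, sideQ]
      have h2 := g.near_succ_Q (j := 4 + (v * g.L + 0)) (by omega) (by omega)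
      exact (h2.symm.trans h1).mono (by omega)
    · refine g.near_hub_Q_gadget hv hr (by omega) ?_
      have := Bool.toNat_le (g.W v (r / 4 - 1))
      unfold ellQ sideQ
      split_ifs <;> omega
  · omega

/-- The counterpart for the end of a gadget of the first path, at distance 1 from hub `1`. -/
lemma near_hub_one_Q {j : ℕ} (hj : 4 ≤ j) (hjm : j < g.m) : g.spokes.Near 3 (g.vertQ j) 1 := by
  have hm := g.hm
  have hL : g.w * g.L = g.w * (4 * g.d + 6) := rfl
  by_cases h0 : j + 1 = g.m
  · have : g.vertQ j = 1 := by unfold vertQ; rw [if_neg (by omega), if_pos h0]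
    rw [this]; exact Spokes.Near.rfl
  rcases g.cases_Q (j := j) with h | ⟨v, r, hv, hr, rfl⟩ | ⟨s, rfl⟩
  · omega
  · have hlt := lt_of_mul_add hv hr
    have hr' : r < 4 * g.d + 6 := hr
    by_cases hr0 : r = 4 * g.d + 5
    · subst hr0
      have h1 : g.spokes.Near 2 (g.vertQ (4 + (v * g.L + (4 * g.d + 4)))) 1 := by
        refine g.near_hub_Q_gadget hv (by unfold L; omega) (by omega) ?_
        simp [ellQ, sideQ]
      have h2 := g.near_succ_Q (j := 4 + (v * g.L + (4 * g.d + 4))) (by omega) (by omega)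
      rw [show 4 + (v * g.L + (4 * g.d + 4)) + 1 = 4 + (v * g.L + (4 * g.d + 5)) by omega] at h2
      exact (h2.trans h1).mono (by omega)
    · refine g.near_hub_Q_gadget hv hr (by omega) ?_
      have := Bool.toNat_le (g.W v (r / 4 - 1))
      unfold ellQ sideQ
      split_ifs <;> omega
  · refine g.near_hub_Q (by omega) (by omega) (by omega) ?_
    have e : g.n + (4 + (g.w * g.L + s) - 1) = g.n + 3 + (g.w * g.L + s) := by omega
    rw [e, g.ell_Q_tail.1, g.ell_Q_tail.2, if_pos rfl]
    split_ifs <;> omega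

lemma near_hub_P_gadget {v r h k : ℕ} (hv : v < g.u) (hr : r < g.L) (hh : h ≤ 1)
    (hk : ellP g.d (g.U v) r + (if sideP g.d r = h then 0 else 1) ≤ k) :
    g.spokes.Near k (vertP (v * g.L + r)) h := by
  obtain ⟨h1, h2, h3⟩ := g.ell_P hv hr
  refine Spokes.near_hub (by simp only [spokes]; omega) hh ?_
  rw [h2, h3]; exact hk

/-- Vector gadgets of orthogonal vectors are traversed synchronously. -/
lemma near_gadgets {v w r : ℕ} (hv : v < g.u) (hw : w < g.w) (hr : r < g.L)
    (h : ∀ k < g.d, (g.U v k && g.W w k) = false) :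
    g.spokes.Near 4 (vertP (v * g.L + r)) (g.vertQ (4 + (w * g.L + r))) := by
  have hr' : r < 4 * g.d + 6 := hr
  by_cases h5 : r = 4 * g.d + 5
  · have h1 : g.spokes.Near 1 (vertP (v * g.L + r)) 1 := by
      refine g.near_hub_P_gadget hv hr (by omega) ?_
      simp [ellP, sideP, h5]
    have hlt := lt_of_mul_add hw hr
    have hm := g.hm
    have hL : g.w * g.L = g.w * (4 * g.d + 6) := rfl
    exact h1.trans (g.near_hub_one_Q (by omega) (by omega)).symm
  -- At a coordinate the distances to hub `0` are 2 and 1 plus the bits, so orthogonality keeps the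
  -- sum at 4.
  have hb : r % 4 = 1 → r ≠ 1 →
      (g.U v (r / 4 - 1)).toNat + (g.W w (r / 4 - 1)).toNat ≤ 1 := by
    intro h1 h2
    have := h (r / 4 - 1) (by omega)
    cases hU : g.U v (r / 4 - 1) <;> cases hW : g.W w (r / 4 - 1) <;> simp [hU, hW] at this ⊢
  -- Away from the first and the last position both gadgets are on the same hub.
  by_cases hs : r % 4 = 3 ∨ r = 4 * g.d + 4
  · have h1 := g.near_hub_P_gadget hv hr (h := 1) (by omega) le_rfl
    have h2 := g.near_hub_Q_gadget hw hr (h := 1) (by omega) le_rfl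
    refine (h1.trans h2.symm).mono ?_
    unfold ellP ellQ sideP sideQ
    split_ifs <;> omega
  · have h1 := g.near_hub_P_gadget hv hr (h := 0) (by omega) le_rfl
    by_cases h0 : r = 0
    · have h2 := g.near_hub_zero_Q (j := 4 + (w * g.L + r)) (by
        have := lt_of_mul_add hw hr; omega)
      refine (h1.trans h2.symm).mono ?_
      simp [ellP, sideP, h0]
    · have h2 := g.near_hub_Q_gadget hw hr (h := 0) (by omega) le_rfl
      refine (h1.trans h2.symm).mono ?_
      unfold ellP ellQ sideP sideQ
      split_ifs <;> omega

end Gadget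

namespace Gadget

variable (g : Gadget)

/-! ### Lower bounds for distances -/

/-- Rows that separate the vector gadgets on the second path. -/
def IsSep (t : ℕ) : Prop := g.n + 3 ≤ t ∧ (t - (g.n + 3)) / g.L < g.w ∧
  ((t - (g.n + 3)) % g.L = 0 ∨ (t - (g.n + 3)) % g.L = 4 * g.d + 5)

open Classical in
/-- Distance of a path vertex from the hub `h`. -/
noncomputable def lab (h t : ℕ) : ℕ :=
  if g.IsSep t then 3 else g.spokes.ell t + (if g.spokes.side t = h then 0 else 1)

lemma lab_of_lt {h t : ℕ} (ht : t < g.n + 3) :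
    g.lab h t = g.spokes.ell t + (if g.spokes.side t = h then 0 else 1) := by
  unfold lab; rw [if_neg]; unfold IsSep; omega

lemma lab_P {h v r : ℕ} (hv : v < g.u) (hr : r < g.L) :
    g.lab h (v * g.L + r) = ellP g.d (g.U v) r + (if sideP g.d r = h then 0 else 1) := by
  obtain ⟨h1, h2, h3⟩ := g.ell_P hv hr
  rw [g.lab_of_lt (by omega), h2, h3]

lemma lab_P_pad {h i : ℕ} (hi : g.u * g.L ≤ i) (hin : i < g.n) :
    g.lab h i = 1 + (if 1 = h then 0 else 1) := by
  obtain ⟨h2, h3⟩ := g.ell_P_pad hi hin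
  rw [g.lab_of_lt (by omega), h2, h3]

lemma lab_Q_head {h j : ℕ} (hj : j < 3) :
    g.lab h (g.n + j) = j + 1 + (if 0 = h then 0 else 1) := by
  obtain ⟨h2, h3⟩ := g.ell_Q_head hj
  rw [g.lab_of_lt (by omega), h2, h3]

lemma lab_Q_gadget {h v r : ℕ} (hv : v < g.w) (hr : r < g.L) :
    g.lab h (g.n + 3 + (v * g.L + r)) = if r = 0 ∨ r = 4 * g.d + 5 then 3 else
      ellQ g.d (g.W v) r + (if sideQ g.d r = h then 0 else 1) := by
  obtain ⟨h2, h3⟩ := g.ell_Q_gadget hv hr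
  unfold lab IsSep
  simp only [Nat.add_sub_cancel_left, div_eq hr, mod_eq hr, h2, h3, hv, true_and, Nat.le_add_right]

lemma lab_Q_tail {h s : ℕ} : g.lab h (g.n + 3 + (g.w * g.L + s)) =
    (if s = 0 then 3 else if s = 1 then 2 else 1) + (if 1 = h then 0 else 1) := by
  obtain ⟨h2, h3⟩ := g.ell_Q_tail (s := s)
  unfold lab
  rw [if_neg, h2, h3]
  rintro ⟨_, h, _⟩
  rw [Nat.add_sub_cancel_left] at h
  exact absurd h (by rw [not_lt, Nat.le_div_iff_mul_le g.L_pos]; omega)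

lemma lab_zero_one (t : ℕ) : g.lab 0 t ≤ g.lab 1 t + 1 ∧ g.lab 1 t ≤ g.lab 0 t + 1 := by
  unfold lab; split_ifs <;> omega

lemma ell_of_isSep {t : ℕ} (h : g.IsSep t) : g.spokes.ell t = 3 := by
  obtain ⟨h1, h2, h3⟩ := h
  obtain ⟨v, r, e, hr⟩ := decompose (i := t - (g.n + 3)) g.L_pos
  rw [e, div_eq hr] at h2
  rw [e, mod_eq hr] at h3
  have : t = g.n + 3 + (v * g.L + r) := by omega
  rw [this, (g.ell_Q_gadget h2 hr).1, ellQ, if_pos h3]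

lemma ite_zero {s : ℕ} (hs : s ≤ 1) : (if s = 0 then 0 else 1) = s := by split_ifs <;> omega

lemma ite_one {s : ℕ} (hs : s ≤ 1) : (if s = 1 then 0 else 1) = 1 - s := by split_ifs <;> omega

lemma sideP_le (d r : ℕ) : sideP d r ≤ 1 := by unfold sideP; split_ifs <;> omega

lemma sideQ_le (d r : ℕ) : sideQ d r ≤ 1 := by unfold sideQ; split_ifs <;> omega

lemma sideP_spec (d r : ℕ) : (r % 4 = 3 ∨ r = 4 * d + 4 ∨ r = 4 * d + 5) ∧ sideP d r = 1 ∨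
    ¬ (r % 4 = 3 ∨ r = 4 * d + 4 ∨ r = 4 * d + 5) ∧ sideP d r = 0 := by
  unfold sideP; split_ifs with h
  exacts [.inl ⟨h, rfl⟩, .inr ⟨h, rfl⟩]

lemma sideQ_spec (d r : ℕ) : (r % 4 = 3 ∨ r = 4 * d + 4 ∨ r = 0) ∧ sideQ d r = 1 ∨
    ¬ (r % 4 = 3 ∨ r = 4 * d + 4 ∨ r = 0) ∧ sideQ d r = 0 := by
  unfold sideQ; split_ifs with h
  exacts [.inl ⟨h, rfl⟩, .inr ⟨h, rfl⟩]

/-- A form of the definition that `omega` can use, with the bit replaced by its range. -/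
lemma ellP_spec (d : ℕ) (x : ℕ → Bool) (r : ℕ) : (r = 0 ∨ r = 4 * d + 5) ∧ ellP d x r = 1 ∨
    (r = 1 ∨ r = 4 * d + 4) ∧ ellP d x r = 2 ∨
    (r % 4 = 1 ∧ r ≠ 1 ∧ r ≠ 4 * d + 5) ∧ 2 ≤ ellP d x r ∧ ellP d x r ≤ 3 ∨
    (r % 4 ≠ 1 ∧ r ≠ 0 ∧ r ≠ 4 * d + 4) ∧ ellP d x r = 3 := by
  have := Bool.toNat_le (x (r / 4 - 1))
  unfold ellP; split_ifs <;> omega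

lemma ellQ_spec (d : ℕ) (x : ℕ → Bool) (r : ℕ) : (r = 0 ∨ r = 4 * d + 5) ∧ ellQ d x r = 3 ∨
    (r = 1 ∨ r = 4 * d + 4) ∧ ellQ d x r = 2 ∨
    (r % 4 = 1 ∧ r ≠ 1 ∧ r ≠ 4 * d + 5) ∧ 1 ≤ ellQ d x r ∧ ellQ d x r ≤ 2 ∨
    (r % 4 ≠ 1 ∧ r ≠ 0 ∧ r ≠ 4 * d + 4) ∧ ellQ d x r = 1 := by
  have := Bool.toNat_le (x (r / 4 - 1))
  unfold ellQ; split_ifs <;> omega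

lemma ellP_step {d r h : ℕ} (x : ℕ → Bool) (hh : h ≤ 1) (hr : r + 1 < 4 * d + 6) :
    ellP d x r + (if sideP d r = h then 0 else 1) ≤
      ellP d x (r + 1) + (if sideP d (r + 1) = h then 0 else 1) + 1 ∧
    ellP d x (r + 1) + (if sideP d (r + 1) = h then 0 else 1) ≤
      ellP d x r + (if sideP d r = h then 0 else 1) + 1 := by
  have h1 := ellP_spec d x r
  have h2 := ellP_spec d x (r + 1)
  have h3 := sideP_spec d r
  have h4 := sideP_spec d (r + 1)
  rcases (show h = 0 ∨ h = 1 by omega) with rfl | rfl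
  · rw [ite_zero (sideP_le _ _), ite_zero (sideP_le _ _)]; omega
  · rw [ite_one (sideP_le _ _), ite_one (sideP_le _ _)]; omega

lemma ellQ_step {d r h : ℕ} (x : ℕ → Bool) (hh : h ≤ 1) (hr : r + 1 < 4 * d + 6) :
    (if r = 0 ∨ r = 4 * d + 5 then 3 else ellQ d x r + (if sideQ d r = h then 0 else 1)) ≤
      (if r + 1 = 0 ∨ r + 1 = 4 * d + 5 then 3 else
        ellQ d x (r + 1) + (if sideQ d (r + 1) = h then 0 else 1)) + 1 ∧
    (if r + 1 = 0 ∨ r + 1 = 4 * d + 5 then 3 else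
        ellQ d x (r + 1) + (if sideQ d (r + 1) = h then 0 else 1)) ≤
    (if r = 0 ∨ r = 4 * d + 5 then 3 else ellQ d x r + (if sideQ d r = h then 0 else 1)) + 1 := by
  have h1 := ellQ_spec d x r
  have h2 := ellQ_spec d x (r + 1)
  have h3 := sideQ_spec d r
  have h4 := sideQ_spec d (r + 1)
  obtain ⟨s, hs⟩ : ∃ s, s = r + 1 := ⟨_, rfl⟩
  rw [← hs] at h2 h4 ⊢
  rcases (show h = 0 ∨ h = 1 by omega) with rfl | rfl
  · rw [ite_zero (sideQ_le _ _), ite_zero (sideQ_le _ _)]; split_ifs <;> omega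
  · rw [ite_one (sideQ_le _ _), ite_one (sideQ_le _ _)]; split_ifs <;> omega

/-- Between gadgets the path passes from distance 1 of hub `1` to distance 1 of hub `0`; as the hubs
are adjacent, both labels change by one only. -/
lemma lab_step_P {h t : ℕ} (hh : h ≤ 1) (ht : t + 1 < g.n) :
    g.lab h t ≤ g.lab h (t + 1) + 1 ∧ g.lab h (t + 1) ≤ g.lab h t + 1 := by
  rcases g.cases_P (i := t) with ⟨v, r, hv, hr, rfl⟩ | hi
  · by_cases hr1 : r + 1 < g.L
    · rw [add_assoc, g.lab_P hv hr, g.lab_P hv hr1]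
      exact ellP_step _ hh hr1
    · have hr5 : r = 4 * g.d + 5 := by unfold L at *; omega
      have e : v * g.L + r + 1 = (v + 1) * g.L + 0 := by
        rw [add_mul]; unfold L at *; omega
      have h1 : g.lab h (v * g.L + r) = 1 + (if 1 = h then 0 else 1) := by
        rw [g.lab_P hv hr]; simp [ellP, sideP, hr5]
      rw [h1]
      by_cases hv1 : v + 1 < g.u
      · rw [e, g.lab_P hv1 g.L_pos]
        rcases (show h = 0 ∨ h = 1 by omega) with rfl | rfl <;> simp [ellP, sideP]
      · rw [e, g.lab_P_pad (le_of_not_lt hv1) (by omega)]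
        omega
  · rw [g.lab_P_pad hi (by omega), g.lab_P_pad (by omega) ht]; omega

lemma lab_step_Q {h t : ℕ} (hh : h ≤ 1) (ht : g.n ≤ t) :
    g.lab h t ≤ g.lab h (t + 1) + 1 ∧ g.lab h (t + 1) ≤ g.lab h t + 1 := by
  -- A vertex that follows the head or a gadget is either the first position of the next gadget or
  -- the first vertex of the tail.
  have hsep : ∀ v ≤ g.w, g.lab h (g.n + 3 + v * g.L) = 3 ∨
      g.lab h (g.n + 3 + v * g.L) = 3 + (if 1 = h then 0 else 1) := by
    intro v hv
    by_cases hv' : v < g.w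
    · left
      rw [show g.n + 3 + v * g.L = g.n + 3 + (v * g.L + 0) by rfl, g.lab_Q_gadget hv' g.L_pos]
      simp
    · right
      obtain rfl : v = g.w := by omega
      rw [show g.n + 3 + g.w * g.L = g.n + 3 + (g.w * g.L + 0) by rfl, g.lab_Q_tail]
      simp
  obtain ⟨j, rfl⟩ := Nat.exists_eq_add_of_le ht
  rcases g.cases_Q (j := j + 1) with h4 | ⟨v, r, hv, hr, he⟩ | ⟨s, he⟩
  · rw [g.lab_Q_head (by omega)]
    by_cases hj : j + 1 < 3
    · rw [show g.n + j + 1 = g.n + (j + 1) by omega, g.lab_Q_head hj]; omega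
    · obtain rfl : j = 2 := by omega
      have := hsep 0 (by omega)
      rw [zero_mul] at this
      rw [show g.n + 2 + 1 = g.n + 3 + 0 by rfl]
      split_ifs at * <;> omega
  · have e : g.n + j = g.n + 3 + (v * g.L + r) := by omega
    rw [e, g.lab_Q_gadget hv hr]
    by_cases hr1 : r + 1 < g.L
    · rw [show g.n + 3 + (v * g.L + r) + 1 = g.n + 3 + (v * g.L + (r + 1)) by omega,
        g.lab_Q_gadget hv hr1]
      exact ellQ_step _ hh hr1
    · have hr5 : r = 4 * g.d + 5 := by unfold L at *; omega
      have e : g.n + 3 + (v * g.L + r) + 1 = g.n + 3 + (v + 1) * g.L := by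
        rw [add_mul]; unfold L at *; omega
      rw [e, if_pos (.inr hr5)]
      have := hsep (v + 1) hv
      split_ifs at * <;> omega
  · have e : g.n + j = g.n + 3 + (g.w * g.L + s) := by omega
    rw [e, show g.n + 3 + (g.w * g.L + s) + 1 = g.n + 3 + (g.w * g.L + (s + 1)) by omega,
      g.lab_Q_tail, g.lab_Q_tail]
    rcases s with _ | _ | s <;> simp <;> omega

lemma isLabel {h : ℕ} (hh : h ≤ 1) : g.spokes.IsLabel h (g.lab h) where
  attach t _ := by
    unfold lab
    by_cases hs : g.IsSep t
    · rw [if_pos hs, g.ell_of_isSep hs]; split_ifs <;> omega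
    · rw [if_neg hs]; omega
  step t ht hn := by
    have hn' : t + 1 ≠ g.n := hn
    by_cases h : t + 1 < g.n
    · exact g.lab_step_P hh h
    · exact g.lab_step_Q hh (by omega)

/-- Vertices at distance at most `4` are at distance at most `4` via one of the hubs. -/
lemma lab_le {i j : ℕ} (hi : i < g.n) (h0 : 1 ≤ j) (hj : j + 1 < g.m)
    (h : g.spokes.Near 4 (vertP i) (g.vertQ j)) :
    g.lab 0 i + g.lab 0 (g.n + (j - 1)) ≤ 4 ∨ g.lab 1 i + g.lab 1 (g.n + (j - 1)) ≤ 4 := by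
  rw [g.vertQ_eq (by omega) (by omega)] at h
  exact Spokes.le_of_near (g.isLabel zero_le_one) (g.isLabel le_rfl) (g.lab_zero_one i) hi
    (by simp only [spokes]; omega) (by simp only [spokes]; omega) h

/-! ### The traversal of two paths -/

/-- Steps that are possible with a leash of length `4`. -/
def CloseStep (s t : ℕ × ℕ) : Prop :=
  (t.1 = s.1 ∨ t.1 = s.1 + 1) ∧ (t.2 = s.2 ∨ t.2 = s.2 + 1) ∧ t.1 < g.n ∧ t.2 < g.m ∧
    g.spokes.Near 4 (vertP t.1) (g.vertQ t.2)

lemma reach_left {j i i' : ℕ} (hj : j < g.m) (hii : i ≤ i') (hi : i' < g.n)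
    (h : ∀ k, i ≤ k → k ≤ i' → g.spokes.Near 4 (vertP k) (g.vertQ j)) :
    Relation.ReflTransGen g.CloseStep (i, j) (i', j) := by
  induction i', hii using Nat.le_induction with
  | base => exact .refl
  | succ k hk ih =>
    refine (ih (by omega) fun l h1 h2 => h l h1 (by omega)).tail ?_
    exact ⟨.inr rfl, .inl rfl, hi, hj, h _ (by omega) le_rfl⟩

lemma reach_right {i j j' : ℕ} (hi : i < g.n) (hjj : j ≤ j') (hj : j' < g.m)
    (h : ∀ k, j ≤ k → k ≤ j' → g.spokes.Near 4 (vertP i) (g.vertQ k)) :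
    Relation.ReflTransGen g.CloseStep (i, j) (i, j') := by
  induction j', hjj using Nat.le_induction with
  | base => exact .refl
  | succ k hk ih =>
    refine (ih (by omega) fun l h1 h2 => h l h1 (by omega)).tail ?_
    exact ⟨.inl rfl, .inr rfl, hi, hj, h _ (by omega) le_rfl⟩

lemma reach_diag {i j : ℕ} (r : ℕ) (hi : i + r < g.n) (hj : j + r < g.m)
    (h : ∀ k ≤ r, g.spokes.Near 4 (vertP (i + k)) (g.vertQ (j + k))) :
    Relation.ReflTransGen g.CloseStep (i, j) (i + r, j + r) := by
  induction r with
  | zero => exact .refl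
  | succ k ih =>
    refine (ih (by omega) (by omega) fun l h1 => h l (by omega)).tail ?_
    exact ⟨.inr rfl, .inr rfl, hi, hj, h _ le_rfl⟩

/-- Five phases: the first path goes to the start of gadget `v`, the second goes to gadget `w`, both
gadgets are traversed diagonally, the second path runs to its end, and the first path follows. -/
lemma reach_end {v w : ℕ} (hv : v < g.u) (hw : w < g.w)
    (h : ∀ k < g.d, (g.U v k && g.W w k) = false) :
    Relation.ReflTransGen g.CloseStep (0, 0) (g.n - 1, g.m - 1) := by
  have hm := g.hm
  have hL : g.w * g.L = g.w * (4 * g.d + 6) := rfl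
  have hLd : g.L = 4 * g.d + 6 := rfl
  have h1 : v * g.L + (4 * g.d + 5) < g.n := (g.ell_P hv (by omega)).1
  have h2 : w * g.L + (4 * g.d + 5) < g.w * g.L := lt_of_mul_add hw (by omega)
  have hs : ∀ j < 4 + g.w * g.L, g.spokes.Near 4 (vertP (v * g.L)) (g.vertQ j) := by
    intro j hj
    have := g.near_hub_P_gadget hv g.L_pos (h := 0) (k := 1) (by omega) (by simp [ellP, sideP])
    exact Spokes.Near.trans this (g.near_hub_zero_Q hj).symm
  have ht : ∀ j, 4 ≤ j → j < g.m →
      g.spokes.Near 4 (vertP (v * g.L + (4 * g.d + 5))) (g.vertQ j) := by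
    intro j hj hjm
    have := g.near_hub_P_gadget hv (r := 4 * g.d + 5) (by omega) (h := 1) (k := 1) (by omega)
      (by simp [ellP, sideP])
    exact Spokes.Near.trans this (g.near_hub_one_Q hj hjm).symm
  have e0 : g.vertQ 0 = 0 := rfl
  have e1 : g.vertQ (g.m - 1) = 1 := by
    unfold vertQ; rw [if_neg (by omega), if_pos (by omega)]
  refine (g.reach_left (j := 0) (i := 0) (i' := v * g.L) (by omega) (by omega) (by omega)
    fun k _ hk => by rw [e0]; exact g.near_hub_P (by omega) (by omega)).trans ?_
  refine (g.reach_right (i := v * g.L) (j := 0) (j' := 4 + w * g.L) (by omega) (by omega) (by omega)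
    fun k _ hk => hs k (by omega)).trans ?_
  refine (g.reach_diag (i := v * g.L) (j := 4 + w * g.L) (4 * g.d + 5) (by omega) (by omega)
    fun k hk => ?_).trans ?_
  · rw [add_assoc 4]
    exact g.near_gadgets hv hw (by omega) h
  refine (g.reach_right (j' := g.m - 1) (by omega) (by omega) (by omega)
    fun k hk hk' => ht k (by omega) (by omega)).trans ?_
  exact g.reach_left (by omega) (by omega) (by omega)
    fun k _ hk => by rw [e1]; exact g.near_hub_P (by omega) (by omega)

/-! ### Traversals that fail -/

/-- Relative position of two vector gadgets: the first path has not overtaken the second one, and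
it is behind if it has passed the common coordinate `k`. -/
def Behind (k r r' : ℕ) : Prop :=
  (r % 4 = 3 → r ≤ r' ∧ r' % 4 = 3) ∧ (r % 4 ≠ 3 → 4 * (r / 4) ≤ r') ∧
  (4 * k + 7 ≤ r → (r % 4 = 3 → r + 4 ≤ r') ∧ (r % 4 ≠ 3 → 4 * (r / 4) + 4 ≤ r')) ∧
  (4 * k + 4 ≤ r → r ≤ 4 * k + 6 → r' = 4 * k + 4 ∨ 4 * k + 8 ≤ r')

/-- The pairs of positions that can be reached if there are no orthogonal vectors. -/
def Reachable (i j : ℕ) : Prop :=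
  j ≤ 2 ∨ (3 ≤ j ∧ j < 4 + g.w * g.L ∧ ∃ v < g.u, i = v * g.L ∨
    ∃ r w r', i = v * g.L + r ∧ 1 ≤ r ∧ r ≤ 4 * g.d + 3 ∧ w < g.w ∧ j = 4 + (w * g.L + r') ∧
      1 ≤ r' ∧ r' ≤ 4 * g.d + 4 ∧ ∃ k < g.d, g.U v k = true ∧ g.W w k = true ∧ Behind k r r')

/-- The vertex `3` has distances 3 and 4 from the hubs `0` and `1`. A partner within 4 must have
distance at most 1 from hub `0`, which holds only at starts of gadgets. -/
lemma eq_of_near_three {i : ℕ} (hi : i < g.n) (h : g.spokes.Near 4 (vertP i) (g.vertQ 3)) :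
    ∃ v < g.u, i = v * g.L := by
  have hm := g.hm
  have hc := g.lab_le hi (by omega) (by omega) h
  simp only [Nat.add_one_sub_one] at hc
  rw [g.lab_Q_head (by omega), g.lab_Q_head (by omega)] at hc
  rcases g.cases_P (i := i) with ⟨v, r, hv, hr, rfl⟩ | hi'
  · refine ⟨v, hv, ?_⟩
    rw [g.lab_P hv hr, g.lab_P hv hr] at hc
    by_contra hne
    have hr' : r < 4 * g.d + 6 := hr
    norm_num at hc
    simp only [ite_zero (sideP_le _ _)] at hc
    have s1 := ellP_spec g.d (g.U v) r
    have s2 := sideP_spec g.d r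
    omega
  · rw [g.lab_P_pad hi' hi, g.lab_P_pad hi' hi] at hc
    norm_num at hc

/-- The tail begins at distance 3 from hub `1` and 4 from hub `0`, so a partner needs distance at
most 1 from hub `1`. Before its last position a gadget has no such vertex. -/
lemma not_near_tail {v r : ℕ} (hv : v < g.u) (hr : r ≤ 4 * g.d + 4) :
    ¬ g.spokes.Near 4 (vertP (v * g.L + r)) (g.vertQ (4 + g.w * g.L)) := by
  intro h
  have hm := g.hm
  have hL : g.w * g.L = g.w * (4 * g.d + 6) := rfl
  have hr' : r < g.L := by unfold L; omega
  have hc := g.lab_le (g.ell_P hv hr').1 (by omega) (by omega) h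
  rw [show g.n + (4 + g.w * g.L - 1) = g.n + 3 + (g.w * g.L + 0) by omega, g.lab_Q_tail,
    g.lab_Q_tail, g.lab_P hv hr', g.lab_P hv hr'] at hc
  norm_num at hc
  simp only [ite_one (sideP_le _ _)] at hc
  have s1 := ellP_spec g.d (g.U v) r
  have s2 := sideP_spec g.d r
  omega

/-- Inside a vector gadget, the first path is close to the second one only inside a gadget. -/
lemma inside_of_near {v r j : ℕ} (hv : v < g.u) (hr1 : 1 ≤ r) (hr : r ≤ 4 * g.d + 4) (h3 : 3 ≤ j)
    (hj : j ≤ 4 + g.w * g.L) (h : g.spokes.Near 4 (vertP (v * g.L + r)) (g.vertQ j)) :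
    ∃ w < g.w, ∃ r', j = 4 + (w * g.L + r') ∧ 1 ≤ r' ∧ r' ≤ 4 * g.d + 4 := by
  have hm := g.hm
  have hL : g.w * g.L = g.w * (4 * g.d + 6) := rfl
  have hr' : r < g.L := by unfold L; omega
  have hc := g.lab_le (g.ell_P hv hr').1 (by omega) (by omega) h
  rcases g.cases_Q (j := j) with h4 | ⟨w, r', hw, hr2, rfl⟩ | ⟨s, rfl⟩
  · obtain rfl : j = 3 := by omega
    obtain ⟨v', hv', h⟩ := g.eq_of_near_three (g.ell_P hv hr').1 h
    have e1 := mod_eq (v := v) hr'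
    have e2 := mod_eq (v := v') g.L_pos
    rw [add_zero] at e2
    rw [h, e2] at e1; omega
  · refine ⟨w, hw, r', rfl, ?_⟩
    by_contra hne
    have hr2' : r' < 4 * g.d + 6 := hr2
    -- Positions `0` and `4 * d + 5` have distance 3 from both hubs, while inner positions of the
    -- first kind have distance at least 2 from both.
    rw [show g.n + (4 + (w * g.L + r') - 1) = g.n + 3 + (w * g.L + r') by omega,
      g.lab_Q_gadget hw hr2, g.lab_Q_gadget hw hr2, if_pos (by omega), if_pos (by omega),
      g.lab_P hv hr', g.lab_P hv hr'] at hc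
    simp only [ite_zero (sideP_le _ _), ite_one (sideP_le _ _)] at hc
    have s1 := ellP_spec g.d (g.U v) r
    have s2 := sideP_spec g.d r
    omega
  · obtain rfl : s = 0 := by omega
    exact absurd h (g.not_near_tail hv hr)

/-- Constraints on close positions inside vector gadgets. -/
lemma of_near_gadgets {v w r r' : ℕ} (hv : v < g.u) (hw : w < g.w) (hr1 : 1 ≤ r)
    (hr : r ≤ 4 * g.d + 3) (hr1' : 1 ≤ r') (hr' : r' ≤ 4 * g.d + 4)
    (h : g.spokes.Near 4 (vertP (v * g.L + r)) (g.vertQ (4 + (w * g.L + r')))) :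
    (r % 4 = 3 → r' % 4 = 3) ∧ (2 ≤ r → r % 4 = 0 ∨ r % 4 = 2 → r' % 4 ≠ 3) ∧
      ∀ k < g.d, g.U v k = true → g.W w k = true → 4 * k + 4 ≤ r → r ≤ 4 * k + 6 →
        r' % 4 ≠ 3 ∧ r' ≠ 4 * k + 5 := by
  have hm := g.hm
  have hL : g.w * g.L = g.w * (4 * g.d + 6) := rfl
  have hr2 : r < g.L := by unfold L; omega
  have hr2' : r' < g.L := by unfold L; omega
  have hlt := lt_of_mul_add hw hr2'
  have hc := g.lab_le (g.ell_P hv hr2).1 (by omega) (by omega) h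
  rw [show g.n + (4 + (w * g.L + r') - 1) = g.n + 3 + (w * g.L + r') by omega,
    g.lab_Q_gadget hw hr2', g.lab_Q_gadget hw hr2',
    if_neg (show ¬ (r' = 0 ∨ r' = 4 * g.d + 5) by omega),
    if_neg (show ¬ (r' = 0 ∨ r' = 4 * g.d + 5) by omega),
    g.lab_P hv hr2, g.lab_P hv hr2] at hc
  refine ⟨fun h3 => ?_, fun h2 h3 => ?_, fun k hk hU hW h4 h6 => ?_⟩
  · by_contra hne
    simp only [ite_zero (sideP_le _ _), ite_one (sideP_le _ _), ite_zero (sideQ_le _ _),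
      ite_one (sideQ_le _ _)] at hc
    have s1 := ellP_spec g.d (g.U v) r
    have s2 := sideP_spec g.d r
    have s3 := ellQ_spec g.d (g.W w) r'
    have s4 := sideQ_spec g.d r'
    omega
  · intro hne
    simp only [ite_zero (sideP_le _ _), ite_one (sideP_le _ _), ite_zero (sideQ_le _ _),
      ite_one (sideQ_le _ _)] at hc
    have s1 := ellP_spec g.d (g.U v) r
    have s2 := sideP_spec g.d r
    have s3 := ellQ_spec g.d (g.W w) r'
    have s4 := sideQ_spec g.d r'
    omega
  -- The bit 1 makes the distance to hub `0` equal to 3 throughout `4 * k + 4, …, 4 * k + 6`. The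
  -- partner must then have distance at most 1 from hub `0`, which excludes markers and the other
  -- coordinate vertex with bit 1.
  · have hP : ellP g.d (g.U v) r = 3 ∧ sideP g.d r = 0 := by
      have s1 := ellP_spec g.d (g.U v) r
      have s2 := sideP_spec g.d r
      by_cases h5 : r = 4 * k + 5
      · have e : r / 4 - 1 = k := by omega
        refine ⟨?_, by omega⟩
        rw [ellP, e, hU, if_neg (by omega), if_neg (by omega), if_pos (by omega)]; rfl
      · omega
    rw [hP.1, hP.2] at hc
    have hb := (ellQ_bounds g.d (g.W w) r').1
    constructor
    · intro h3
      have hs : sideQ g.d r' = 1 := by unfold sideQ; rw [if_pos (.inl h3)]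
      rw [hs] at hc
      norm_num at hc; omega
    · intro h5
      have e : r' / 4 - 1 = k := by omega
      have hQ : ellQ g.d (g.W w) r' = 2 := by
        rw [ellQ, e, hW, if_neg (by omega), if_neg (by omega), if_pos (by omega)]; rfl
      rw [hQ] at hc
      split_ifs at hc <;> omega

/-- A marker of the first path is matched only by markers of the second, and the vertices next to it
on either side only by vertices that are not markers. So the first path cannot pass a marker without
the second passing one as well. At the common coordinate `k` the second path cannot go across `4 * k
+ 5` while the first does, so only a second path that is already a period ahead lets the first one
through. -/
lemma Behind.step {k r r' s s' : ℕ} (h : Behind k r r') (hr : 1 ≤ r)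
    (hs : s = r ∨ s = r + 1) (hs' : s' = r' ∨ s' = r' + 1)
    (h1 : s % 4 = 3 → s' % 4 = 3) (h2 : 2 ≤ s → s % 4 = 0 ∨ s % 4 = 2 → s' % 4 ≠ 3)
    (h3 : 4 * k + 4 ≤ s → s ≤ 4 * k + 6 → s' % 4 ≠ 3 ∧ s' ≠ 4 * k + 5) : Behind k s s' := by
  obtain ⟨a1, a2, a3, a4⟩ := h
  -- One bound for all residues, by `4 * (r / 4) = r - r % 4`.
  have hb : r ≤ r' + r % 4 ∧ (4 * k + 7 ≤ r → r + 4 ≤ r' + r % 4) := by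
    clear a4 h1 h2 h3 hs hs'
    by_cases hr3 : r % 4 = 3
    · have := a1 hr3
      exact ⟨by omega, fun h => by have := (a3 h).1 hr3; omega⟩
    · have := a2 hr3
      exact ⟨by omega, fun h => by have := (a3 h).2 hr3; omega⟩
  have hb3 : r % 4 = 3 → r ≤ r' ∧ r' % 4 = 3 ∧ (4 * k + 7 ≤ r → r + 4 ≤ r') := fun h =>
    ⟨(a1 h).1, (a1 h).2, fun h' => (a3 h').1 h⟩
  clear a1 a2 a3
  by_cases hs3 : s % 4 = 3
  · have e := h1 hs3
    clear h1 h2 h3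
    rcases hs with rfl | rfl
    · have := hb3 hs3
      refine ⟨fun _ => ⟨by omega, e⟩, fun h => absurd hs3 h, fun h => ⟨fun _ => by omega,
        fun h => absurd hs3 h⟩, fun _ _ => by omega⟩
    · clear hb3
      refine ⟨fun _ => ⟨by omega, e⟩, fun h => absurd hs3 h, fun h => ⟨fun _ => ?_,
        fun h => absurd hs3 h⟩, fun _ _ => by omega⟩
      by_cases hk7 : 4 * k + 7 ≤ r
      · have := hb.2 hk7; omega
      -- From `4 * k + 4` a single step does not reach a marker; hence the second path was at `4 * k
      -- + 8` or later, and its next marker is at least `4 * k + 11`.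
      · have := a4 (by omega) (by omega); omega
  · clear h1
    refine ⟨fun h => absurd h hs3, fun _ => ?_, fun h => ⟨fun h => absurd h hs3, fun _ => ?_⟩,
      fun h h' => ?_⟩
    · clear h3 a4
      rcases hs with rfl | rfl
      · omega
      · by_cases h3 : r % 4 = 3
        · have := hb3 h3
          -- Leaving a marker, the first path forces the second to leave its marker in the same
          -- step.
          have := h2 (by omega) (by omega)
          omega
        · omega
    · clear h3 a4
      rcases hs with rfl | rfl
      · have := hb.2 h; omega
      · by_cases h3 : r % 4 = 3
        · have := hb3 h3
          have := h2 (by omega) (by omega)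
          omega
        · have := hb.2 (by omega); omega
    · have h5 := h3 h h'
      clear h3 h2
      by_cases hr4 : 4 * k + 4 ≤ r
      · have := a4 hr4 (by omega); omega
      · have := hb3 (by omega); omega

/-- Entering the vertex `3` pins the first path to a start; a start can be left only while the
second path is inside a gadget; from then on `Behind` is preserved for a coordinate common to both
vectors, and neither path can leave its gadget. -/
lemma Reachable.step {i j i' j' : ℕ} (h : g.Reachable i j)
    (hno : ∀ v < g.u, ∀ w < g.w, ∃ k < g.d, g.U v k = true ∧ g.W w k = true)
    (hi : i' = i ∨ i' = i + 1) (hj : j' = j ∨ j' = j + 1) (hin : i' < g.n)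
    (hnear : g.spokes.Near 4 (vertP i') (g.vertQ j')) : g.Reachable i' j' := by
  rcases h with h | ⟨h1, h2, v, hv, h⟩
  · by_cases hj' : j' ≤ 2
    · exact .inl hj'
    · obtain rfl : j' = 3 := by omega
      obtain ⟨v, hv, e⟩ := g.eq_of_near_three hin hnear
      exact .inr ⟨le_rfl, by omega, v, hv, .inl e⟩
  right
  rcases h with rfl | ⟨r, w, r', rfl, hr1, hr, hw, rfl, hr1', hr', k, hk, hU, hW, hB⟩
  · rcases hi with rfl | rfl
    · have hne : j' ≠ 4 + g.w * g.L := by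
        rintro rfl
        exact g.not_near_tail hv (r := 0) (by omega) hnear
      exact ⟨by omega, by omega, v, hv, .inl rfl⟩
    · obtain ⟨w, hw, r', rfl, h3, h4⟩ := g.inside_of_near hv (r := 1) le_rfl (by omega)
        (by omega) (by omega) hnear
      have hlt : w * g.L + r' < g.w * g.L := lt_of_mul_add hw (by unfold L; omega)
      obtain ⟨k, hk, hU, hW⟩ := hno v hv w hw
      refine ⟨by omega, by omega, v, hv, .inr ⟨1, w, r', rfl, le_rfl, by omega, hw, rfl, h3, h4,
        k, hk, hU, hW, ?_⟩⟩
      unfold Behind; omega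
  · obtain ⟨s, hs, rfl⟩ : ∃ s, (s = r ∨ s = r + 1) ∧ i' = v * g.L + s := by
      rcases hi with rfl | rfl
      exacts [⟨r, .inl rfl, rfl⟩, ⟨r + 1, .inr rfl, by omega⟩]
    obtain ⟨s', hs', rfl⟩ : ∃ s', (s' = r' ∨ s' = r' + 1) ∧ j' = 4 + (w * g.L + s') := by
      rcases hj with rfl | rfl
      exacts [⟨r', .inl rfl, rfl⟩, ⟨r' + 1, .inr rfl, by omega⟩]
    have hlt : w * g.L + r' < g.w * g.L := lt_of_mul_add hw (by unfold L; omega)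
    obtain ⟨w₂, hw₂, s₂, e, h3, h4⟩ := g.inside_of_near hv (r := s) (by omega) (by omega)
      (by omega) (by omega) hnear
    have hL : g.L = 4 * g.d + 6 := rfl
    have e' : w * g.L + s' = w₂ * g.L + s₂ := by omega
    have d1 := div_eq (v := w) (show s' < g.L by omega)
    have d2 := div_eq (v := w₂) (show s₂ < g.L by omega)
    -- The second path stays in its gadget, because the position between two gadget interiors is not
    -- close.
    obtain rfl : w = w₂ := by rw [← d1, ← d2, e']
    obtain rfl : s' = s₂ := by omega
    -- To get here the first path was at `4 * d + 3`, past the coordinate `k < d`. Then `Behind`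
    -- demands `r' ≥ 4 * d + 7`, beyond the interior of the other gadget.
    by_cases hs4 : s = 4 * g.d + 4
    · obtain ⟨a1, a2, a3, a4⟩ := hB
      omega
    obtain ⟨b1, b2, b3⟩ := g.of_near_gadgets hv hw (by omega) (by omega) h3 h4 hnear
    have hlt' : w * g.L + s' < g.w * g.L := lt_of_mul_add hw (by omega)
    exact ⟨by omega, by omega, v, hv, .inr ⟨s, w, s', rfl, by omega, by omega, hw, rfl, h3, h4, k,
      hk, hU, hW, hB.step hr1 hs hs' b1 b2 (b3 k hk hU hW)⟩⟩

/-! ### The input of the Fréchet distance problem -/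

lemma vertQ_lt {j : ℕ} (hj : j < g.m) : g.vertQ j < 3 * g.spokes.T + 2 := by
  have := g.hm
  unfold vertQ; simp only [spokes]
  split_ifs <;> omega

lemma vertP_lt {i : ℕ} (hi : i < g.n) : vertP i < 3 * g.spokes.T + 2 := by
  have := g.hm
  unfold vertP; simp only [spokes]; omega

/-- The two paths as an input of the Fréchet distance problem. -/
def toPlanarPathPair : PlanarPathPair where
  N := 3 * g.spokes.T + 2
  n := g.n
  m := g.m
  G := g.spokes.graph
  planar := g.spokes.planar
  connected := g.spokes.connected
  edges := g.spokes.edges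
  mem_edges u v := by
    rw [g.spokes.mem_edges, g.spokes.mem_edges]; rfl
  nodup_edges := g.spokes.nodup_edges
  P i := g.spokes.vert (vertP i)
  Q j := g.spokes.vert (g.vertQ j)
  one_le_n := g.one_le_n
  one_le_m := by have := g.hm; omega
  isPath_P := by
    constructor
    · intro i j h
      have := congrArg Fin.val h
      rw [Spokes.vert_val _ (g.vertP_lt i.2), Spokes.vert_val _ (g.vertP_lt j.2)] at this
      unfold vertP at this; exact Fin.ext (by omega)
    · intro i j h
      have hj := j.2
      dsimp only
      rw [h]
      refine (g.spokes.adj_vert (g.spokes.mem_edgeList.2 (.inr ⟨i + 1, ?_, g.spokes.mem_row.2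
        (.inr (.inr (.inr ⟨by omega, ?_, ?_⟩)))⟩))).symm
      · simp only [spokes]; omega
      · simp only [spokes]; omega
      · unfold vertP; rfl
  isPath_Q := by
    have hm := g.hm
    constructor
    · intro i j h
      have := congrArg Fin.val h
      rw [Spokes.vert_val _ (g.vertQ_lt i.2), Spokes.vert_val _ (g.vertQ_lt j.2)] at this
      have := i.2
      have := j.2
      have := g.one_le_n
      unfold vertQ at *; apply Fin.ext; split_ifs at * <;> omega
    · intro i j h
      have hj := j.2
      have h1 := g.one_le_n
      dsimp only
      rw [h] at hj ⊢
      -- The first and the last edge of the second path are the spokes of length 1 that attach its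
      -- outermost rows to the hubs.
      by_cases h0 : (i : ℕ) = 0
      · refine (g.spokes.adj_vert (g.spokes.mem_edgeList.2 (.inr ⟨g.n, ?_, g.spokes.mem_row.2
          (.inr (.inr (.inl ?_)))⟩))).symm
        · simp only [spokes]; omega
        · obtain ⟨e1, e2⟩ := g.ell_Q_head (j := 0) (by omega)
          rw [add_zero] at e1 e2
          rw [h0, g.vertQ_eq (by omega) (by omega), Spokes.target, if_pos e1, e2]; rfl
      · by_cases hlast : (i : ℕ) + 1 + 1 = g.m
        · refine g.spokes.adj_vert (g.spokes.mem_edgeList.2 (.inr ⟨g.n + (i - 1), ?_,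
            g.spokes.mem_row.2 (.inr (.inr (.inl ?_)))⟩))
          · simp only [spokes]; omega
          · have hL : g.w * g.L = g.w * (4 * g.d + 6) := rfl
            obtain ⟨e1, e2⟩ := g.ell_Q_tail (s := g.m - 6 - g.w * g.L)
            rw [if_neg (by omega), if_neg (by omega)] at e1
            have e : g.n + 3 + (g.w * g.L + (g.m - 6 - g.w * g.L)) = g.n + (i - 1) := by omega
            rw [e] at e1 e2
            rw [g.vertQ_eq h0 (by omega), vertQ, if_neg (by omega), if_pos hlast, Spokes.target,
              if_pos e1, e2]
        · refine (g.spokes.adj_vert (g.spokes.mem_edgeList.2 (.inr ⟨g.n + i, ?_,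
            g.spokes.mem_row.2 (.inr (.inr (.inr ⟨by omega, ?_, ?_⟩)))⟩))).symm
          · simp only [spokes]; omega
          · simp only [spokes]; omega
          · rw [g.vertQ_eq (by omega) hlast, g.vertQ_eq h0 (by omega)]
            simp only [Prod.mk.injEq]; omega

lemma frechet_le {v w : ℕ} (hv : v < g.u) (hw : w < g.w)
    (h : ∀ k < g.d, (g.U v k && g.W w k) = false) : g.toPlanarPathPair.frechet ≤ 4 := by
  have hm := g.hm
  have hn := g.one_le_n
  have h0 : (0, 0) ∈ {x : ℕ × ℕ | x.1 < g.n ∧ x.2 < g.m} := by constructor <;> dsimp only <;> omega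
  have lift : ∀ x : ℕ × ℕ, Relation.ReflTransGen g.CloseStep (0, 0) x →
      ∃ hx : x.1 < g.n ∧ x.2 < g.m, Relation.ReflTransGen (fun s t : Fin g.n × Fin g.m =>
        MonotoneStep s t ∧ g.spokes.graph.edist (g.spokes.vert (vertP t.1))
          (g.spokes.vert (g.vertQ t.2)) ≤ 4) (⟨0, h0.1⟩, ⟨0, h0.2⟩) (⟨x.1, hx.1⟩, ⟨x.2, hx.2⟩) := by
    intro x hx
    induction hx with
    | refl => exact ⟨h0, .refl⟩
    | tail _ hs ih =>
      obtain ⟨hx, ih⟩ := ih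
      obtain ⟨a1, a2, a3, a4, a5⟩ := hs
      exact ⟨⟨a3, a4⟩, ih.tail ⟨⟨a1, a2⟩, a5⟩⟩
  obtain ⟨hx, hr⟩ := lift _ (g.reach_end hv hw h)
  refine discreteFrechet_le (s := (⟨0, h0.1⟩, ⟨0, h0.2⟩)) ⟨rfl, rfl⟩ ?_ ?_ hr
  · exact ⟨Nat.sub_add_cancel (by omega), Nat.sub_add_cancel (by omega)⟩
  · exact g.near_hub_P (i := 0) (by omega) (h := 0) (by omega)

lemma le_frechet (hno : ∀ v < g.u, ∀ w < g.w, ∃ k < g.d, g.U v k = true ∧ g.W w k = true) :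
    5 ≤ g.toPlanarPathPair.frechet := by
  have hm := g.hm
  have hL : g.w * g.L = g.w * (4 * g.d + 6) := rfl
  refine le_discreteFrechet (c := 4) g.Reachable (.inl (by omega)) ?_ ?_
  · rintro i j hi hj (h | ⟨_, h, _⟩)
    · have : j + 1 = g.m := hj
      omega
    · have : j + 1 = g.m := hj
      omega
  · intro s t hst hs ht
    exact hs.step g hno hst.1 hst.2 t.1.2 ht

end Gadget

namespace WordRAM

/-! ### Writing lists to memory -/

/-- The memory `f` with the list `l` written to the addresses from `b` on. -/
def writeList (f : ℕ → ℕ) (b : ℕ) (l : List ℕ) (x : ℕ) : ℕ :=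
  if b ≤ x ∧ x < b + l.length then l.getD (x - b) 0 else f x

lemma writeList_nil (f : ℕ → ℕ) (b : ℕ) : writeList f b [] = f := by
  funext x; simp [writeList]

lemma writeList_append (f : ℕ → ℕ) (b : ℕ) (l : List ℕ) (v : ℕ) :
    Function.update (writeList f b l) (b + l.length) v = writeList f b (l ++ [v]) := by
  funext x
  rw [writeList, List.length_append, List.length_singleton]
  by_cases hx : x = b + l.length
  · subst hx
    rw [Function.update_self, if_pos (by omega), Nat.add_sub_cancel_left,
      List.getD_append_right _ _ _ _ le_rfl]
    simp
  · rw [Function.update_of_ne hx]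
    by_cases h : b ≤ x ∧ x < b + l.length
    · rw [writeList, if_pos h, if_pos (by omega), List.getD_append _ _ _ _ (by omega)]
    · rw [writeList, if_neg h, if_neg (by omega)]

lemma writeList_of_lt {f : ℕ → ℕ} {b x : ℕ} (l : List ℕ) (h : x < b) : writeList f b l x = f x := by
  rw [writeList, if_neg (by omega)]

/-- The list `l` has been written to the addresses from `b` on, and register `14` points behind it.
The registers from `14` to `22` are auxiliary. -/
structure Emitting (σ₀ : State) (b : ℕ) (l : List ℕ) (σ : State) : Prop where
  mem : σ.mem = writeList σ₀.mem b l
  ptr : σ.reg 14 = b + l.length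
  reg : ∀ r, ¬ (14 ≤ r ∧ r ≤ 22) → σ.reg r = σ₀.reg r

lemma Emitting.setReg {σ₀ σ : State} {b : ℕ} {l : List ℕ} (h : Emitting σ₀ b l σ) {x v : ℕ}
    (hx : 15 ≤ x ∧ x ≤ 22) : Emitting σ₀ b l (σ.setReg x v) where
  mem := h.mem
  ptr := by simp [State.setReg, h.ptr, show (14 : ℕ) ≠ x by omega]
  reg r hr := by simp [State.setReg, h.reg r hr, show r ≠ x by omega]

/-- Append the values of the expressions to the output. -/
def emitAll : List Expr → Prog
  | [] => .skip
  | e :: l => .seq (.seq (storeAt (.var 14) e) (assign 14 (.op .add (.var 14) (.lit 1)))) (emitAll l)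

/-- Running time of `emitAll`. -/
def emitCost : List Expr → ℕ
  | [] => 1
  | e :: l => e.cost + 6 + emitCost l

/-- The values are required for every state with the same registers other than the output pointer,
so the expressions must not depend on that pointer or on the memory, both of which change while
writing. -/
lemma Runs.emitAll {W b : ℕ} {σ₀ : State} : ∀ {es : List Expr} {l vs : List ℕ} {σ : State},
    Emitting σ₀ b l σ → (∀ e ∈ es, e.wf = true) → (∀ v ∈ vs, v ≤ W) →
    (∀ σ' : State, (∀ r ≠ 14, σ'.reg r = σ.reg r) → es.map (·.eval σ') = vs) →
    b + (l ++ vs).length ≤ W → Runs W (emitAll es) (emitCost es) σ fun σ' =>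
      Emitting σ₀ b (l ++ vs) σ' ∧ ∀ r ≠ 14, σ'.reg r = σ.reg r
  | [], l, vs, σ, h, _, _, hv, _ => by
    obtain rfl : [] = vs := hv σ fun _ _ => rfl
    exact Runs.skip ⟨by rwa [List.append_nil], fun _ _ => rfl⟩
  | e :: es, l, vs, σ, h, hwf, hW, hv, hlen => by
    have hv0 := hv σ fun _ _ => rfl
    obtain ⟨v, vs, rfl⟩ : ∃ v vs', vs = v :: vs' := by
      cases vs with
      | nil => simp at hv0
      | cons v vs => exact ⟨v, vs, rfl⟩
    simp only [List.map_cons, List.cons.injEq] at hv0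
    have e14 : (Expr.var 14).eval σ = b + l.length := h.ptr
    simp only [List.length_append, List.length_cons] at hlen
    refine Runs.seq (Runs.mono (T₁ := e.cost + 6) (post := fun σ' =>
      Emitting σ₀ b (l ++ [v]) σ' ∧ ∀ r ≠ 14, σ'.reg r = σ.reg r) ?_ le_rfl ?_)
    · refine Runs.mono (Runs.seq (Runs.storeAt (by decide) (hwf e (by simp))
        (fun _ => by rw [hv0.1]; exact hW v (by simp)) (Runs.assign (by decide) (fun _ => ?_) ?_)))
        ?_ fun _ _ h => h
      · show σ.reg 14 + 1 ≤ W
        rw [h.ptr]; omega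
      · have e15 : (Expr.op .add (.var 14) (.lit 1)).eval
            (σ.setMem ((Expr.var 14).eval σ) (e.eval σ)) = b + l.length + 1 := by
          rw [← h.ptr]; rfl
        rw [e15, e14, hv0.1]
        refine ⟨⟨?_, ?_, fun r hr => ?_⟩, fun r hr => ?_⟩
        · simp only [State.setReg, State.setMem, h.mem, writeList_append]
        · simp [State.setReg, add_assoc]
        · simp [State.setReg, State.setMem, h.reg r hr, show r ≠ 14 by omega]
        · simp [State.setReg, State.setMem, hr]
      · simp only [Expr.cost]; omega
    · rintro σ' _ ⟨h1, h2⟩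
      refine (Runs.emitAll h1 (fun e he => hwf e (by simp [he])) (fun v hv => hW v (by simp [hv]))
        (vs := vs) (fun σ'' hσ => ?_) ?_).mono le_rfl ?_
      · have := hv σ'' fun r hr => (hσ r hr).trans (h2 r hr)
        simp only [List.map_cons, List.cons.injEq] at this
        exact this.2
      · simp only [List.length_append, List.length_singleton]; omega
      · rintro σ'' _ ⟨h3, h4⟩
        exact ⟨by simpa using h3, fun r hr => (h4 r hr).trans (h2 r hr)⟩

lemma Runs.emitLoop {W b N T c : ℕ} {σ₀ σ : State} {e : Expr} {P : Prog} {l : List ℕ}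
    (f : ℕ → List ℕ) (h : Emitting σ₀ b l σ)
    (he : (Expr.op .lt (.var 15) e).wf = true) (hc : e.cost ≤ c)
    (heval : ∀ l σ, Emitting σ₀ b l σ → e.eval σ = N) (hN : N ≤ W)
    (hlen : b + (l ++ (List.range N).flatMap f).length ≤ W)
    (hP : ∀ k < N, ∀ l σ, b + (l ++ f k).length ≤ W → Emitting σ₀ b l σ → σ.reg 15 = k →
      Runs W P T σ fun σ' => Emitting σ₀ b (l ++ f k) σ' ∧ σ'.reg 15 = k) :
    Runs W (WordRAM.forLoop 15 e P) ((T + (c + 10)) * N + (c + 10)) σ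
      (Emitting σ₀ b (l ++ (List.range N).flatMap f)) := by
  refine Runs.forLoop (fun k σ => Emitting σ₀ b (l ++ (List.range k).flatMap f) σ ∧ σ.reg 15 = k)
    (by omega) he hc ⟨?_, by simp [State.setReg]⟩ (fun k hk σ h => ⟨h.2, heval _ _ h.1⟩) hN ?_
    fun σ h => h.1
  · simpa using h.setReg (x := 15) (v := 0) (by omega)
  · rintro k hk σ ⟨h1, h2⟩
    have hle : ((List.range (k + 1)).flatMap f).length ≤ ((List.range N).flatMap f).length := by
      obtain ⟨j, rfl⟩ := Nat.exists_eq_add_of_le (show k + 1 ≤ N from hk)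
      rw [List.range_add (n := k + 1), List.flatMap_append, List.length_append]; omega
    have e1 : (List.range (k + 1)).flatMap f = (List.range k).flatMap f ++ f k := by
      rw [List.range_succ, List.flatMap_append]; simp
    refine (hP k hk _ σ ?_ h1 h2).mono le_rfl ?_
    · rw [List.append_assoc, ← e1]
      simp only [List.length_append] at hlen ⊢; omega
    · rintro σ' _ ⟨h3, h4⟩
      refine ⟨h4, ?_, by simp [State.setReg]⟩
      rw [e1, ← List.append_assoc]
      exact h3.setReg (by omega)

/-! ### Conditional expressions -/

namespace Expr

def add (e f : Expr) : Expr := .op .add e f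
def sub (e f : Expr) : Expr := .op .sub e f
def mul (e f : Expr) : Expr := .op .mul e f
def div (e f : Expr) : Expr := .op .div e f
def mod (e f : Expr) : Expr := .op .mod e f
def lt (e f : Expr) : Expr := .op .lt e f
def eq (e f : Expr) : Expr := .op .eq e f

/-- `e` or `f`, for truth values `0` and `1` -/
def or (e f : Expr) : Expr := lt (lit 0) (add e f)

/-- `if c then e else f`, for a truth value `c` -/
def ite (c e f : Expr) : Expr := add (mul c e) (mul (sub (lit 1) c) f)

variable {σ : State} {e f c : Expr} {p q : Prop} [Decidable p] [Decidable q]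

@[simp] lemma eval_lit (v : ℕ) : (lit v).eval σ = v := rfl
@[simp] lemma eval_var (r : ℕ) : (var r).eval σ = σ.reg r := rfl
@[simp] lemma eval_load : (load e).eval σ = σ.mem (e.eval σ) := rfl
@[simp] lemma eval_add : (add e f).eval σ = e.eval σ + f.eval σ := rfl
@[simp] lemma eval_sub : (sub e f).eval σ = e.eval σ - f.eval σ := rfl
@[simp] lemma eval_mul : (mul e f).eval σ = e.eval σ * f.eval σ := rfl
@[simp] lemma eval_div : (div e f).eval σ = e.eval σ / f.eval σ := rfl
@[simp] lemma eval_mod : (mod e f).eval σ = e.eval σ % f.eval σ := rfl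
@[simp] lemma eval_lt : (lt e f).eval σ = if e.eval σ < f.eval σ then 1 else 0 := rfl
@[simp] lemma eval_eq : (eq e f).eval σ = if e.eval σ = f.eval σ then 1 else 0 := rfl

lemma eval_or (he : e.eval σ = if p then 1 else 0) (hf : f.eval σ = if q then 1 else 0) :
    (or e f).eval σ = if p ∨ q then 1 else 0 := by
  by_cases hp : p <;> by_cases hq : q <;> simp [or, he, hf, hp, hq]

lemma eval_ite (hc : c.eval σ = if p then 1 else 0) :
    (ite c e f).eval σ = if p then e.eval σ else f.eval σ := by
  by_cases hp : p <;> simp [ite, hc, hp]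

end Expr

end WordRAM

/-! ### The encoding of the Fréchet instance as a list -/

lemma ofFn_val {α : Type*} (n : ℕ) (f : ℕ → α) :
    List.ofFn (fun i : Fin n => f i) = (List.range n).map f :=
  List.ext_getElem (by simp) (by simp)

namespace Spokes

variable (S : Spokes)

/-- The edges of a row, as a list of vertices. -/
def flatRow (t : ℕ) : List ℕ := (S.row t).flatMap fun e => [e.1, e.2]

/-- Four edges per row, apart from the missing path edges of the rows `0` and `n`. -/
lemma length_edgeList : ∀ T : ℕ, ((List.range T).flatMap S.row).length + (if 0 < T then 1 else 0) +
    (if S.n < T ∧ 0 < S.n then 1 else 0) = 4 * T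
  | 0 => by simp
  | T + 1 => by
    have ih := length_edgeList T
    rw [List.range_succ, List.flatMap_append, List.length_append]
    simp only [List.flatMap_cons, List.flatMap_nil, List.append_nil, row, List.length_append,
      List.length_cons, List.length_nil]
    split_ifs at ih ⊢ <;> simp only [List.length_cons, List.length_nil] <;> omega

end Spokes

namespace Gadget

variable (g : Gadget)

/-- The encoding of the instance, in the order in which it is written to memory. -/
def output : List ℕ :=
  [3 * (g.n + (g.m - 2)) + 2, 4 * (g.n + (g.m - 2)) - 1, g.n, g.m, 1, 0]
    ++ (List.range g.n).flatMap g.spokes.flatRow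
    ++ (List.range (g.m - 2)).flatMap (fun i => g.spokes.flatRow (g.n + i))
    ++ (List.range g.n).flatMap (fun i => [3 * i + 4]) ++ [0]
    ++ (List.range (g.m - 2)).flatMap (fun i => [3 * (g.n + i) + 4]) ++ [1]

lemma encode_eq_output : g.toPlanarPathPair.encode = g.output := by
  have h1 := g.one_le_n
  have hm := g.hm
  have hlen : g.spokes.edges.length = 4 * (g.n + (g.m - 2)) - 1 := by
    have e1 := congrArg List.length (g.spokes.map_edges fun a b => (a, b))
    have e2 := g.spokes.length_edgeList g.spokes.T
    rw [List.length_map, List.length_map] at e1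
    rw [e1, Spokes.edgeList, List.length_cons]
    simp only [show g.spokes.n = g.n from rfl, show g.spokes.T = g.n + (g.m - 2) from rfl] at e2 ⊢
    rw [if_pos (by omega), if_pos (by omega)] at e2
    omega
  have hP : (List.ofFn fun i : Fin g.n => ((g.spokes.vert (vertP i) : Fin _) : ℕ)) =
      (List.range g.n).flatMap (fun i => [3 * i + 4]) := by
    rw [← List.map_eq_flatMap, ← ofFn_val]
    congr 1; funext i
    rw [Spokes.vert_val _ (g.vertP_lt i.2)]; rfl
  have hQ : (List.ofFn fun j : Fin g.m => ((g.spokes.vert (g.vertQ j) : Fin _) : ℕ)) =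
      [0] ++ (List.range (g.m - 2)).flatMap (fun i => [3 * (g.n + i) + 4]) ++ [1] := by
    have e : (List.ofFn fun j : Fin g.m => ((g.spokes.vert (g.vertQ j) : Fin _) : ℕ)) =
        (List.range g.m).map g.vertQ := by
      rw [← ofFn_val]
      congr 1; funext j
      rw [Spokes.vert_val _ (g.vertQ_lt j.2)]
    obtain ⟨k, hk⟩ : ∃ k, g.m = k + 2 := ⟨g.m - 2, by omega⟩
    rw [e, ← List.map_eq_flatMap, hk, Nat.add_sub_cancel, List.range_succ, List.map_append,
      List.range_succ_eq_map, List.map_cons, List.map_map, List.map_cons, List.map_nil]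
    have e1 : g.vertQ 0 = 0 := rfl
    have e2 : g.vertQ (k + 1) = 1 := by rw [vertQ, if_neg (by omega), if_pos (by omega)]
    rw [e1, e2, List.singleton_append]
    congr 2
    refine List.map_congr_left fun i hi => ?_
    rw [List.mem_range] at hi
    simp only [Function.comp_apply, vertQ]
    rw [if_neg (by omega), if_neg (by omega)]
    omega
  have hE : (g.spokes.edges.map fun e => [(e.1 : ℕ), (e.2 : ℕ)]).flatten =
      [1, 0] ++ (List.range g.n).flatMap g.spokes.flatRow
        ++ (List.range (g.m - 2)).flatMap (fun i => g.spokes.flatRow (g.n + i)) := by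
    rw [g.spokes.map_edges fun a b => [a, b], ← List.flatMap_def, Spokes.edgeList,
      List.flatMap_cons, List.flatMap_assoc, show g.spokes.T = g.n + (g.m - 2) from rfl,
      List.range_add, List.flatMap_append, List.flatMap_map, List.append_assoc]
    rfl
  have e : g.toPlanarPathPair.encode =
      [3 * (g.n + (g.m - 2)) + 2, g.spokes.edges.length, g.n, g.m]
        ++ (g.spokes.edges.map fun e => [(e.1 : ℕ), (e.2 : ℕ)]).flatten
        ++ (List.ofFn fun i : Fin g.n => ((g.spokes.vert (vertP i) : Fin _) : ℕ))
        ++ (List.ofFn fun j : Fin g.m => ((g.spokes.vert (g.vertQ j) : Fin _) : ℕ)) := rfl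
  rw [e, hlen, hE, hP, hQ, output]
  simp only [List.append_assoc, List.cons_append, List.nil_append]

/-- The encoding has length `4 + 2 * (4 * (n + m - 2) - 1) + n + m`. -/
lemma length_output : g.output.length + 14 = 9 * (g.n + g.m) := by
  have h1 := g.one_le_n
  have hm := g.hm
  have e : g.toPlanarPathPair.encode.length = 4 + 2 * (4 * (g.n + (g.m - 2)) - 1) + g.n + g.m := by
    have e1 := congrArg List.length (g.spokes.map_edges fun a b => (a, b))
    have e2 := g.spokes.length_edgeList g.spokes.T
    rw [List.length_map, List.length_map] at e1
    have h : ((g.toPlanarPathPair.edges.map fun e => [(e.1 : ℕ), (e.2 : ℕ)]).flatten).length =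
        2 * g.spokes.edges.length := by
      rw [← List.flatMap_def, List.length_flatMap]
      simp [toPlanarPathPair, mul_comm]
    simp only [PlanarPathPair.encode, List.length_append, h, List.length_ofFn, List.length_cons,
      List.length_nil]
    rw [e1, Spokes.edgeList, List.length_cons]
    simp only [show g.spokes.n = g.n from rfl, show g.spokes.T = g.n + (g.m - 2) from rfl] at e2 ⊢
    rw [if_pos (by omega), if_pos (by omega)] at e2
    simp only [show g.toPlanarPathPair.n = g.n from rfl, show g.toPlanarPathPair.m = g.m from rfl]
    omega
  rw [← encode_eq_output, e]; omega

end Gadget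

namespace WordRAM

/-! ### The program that writes the Fréchet instance -/

@[simp] lemma State.reg_setReg (σ : State) (x v r : ℕ) :
    (σ.setReg x v).reg r = if r = x then v else σ.reg r := by
  simp [State.setReg, Function.update_apply]

@[simp] lemma State.mem_setReg (σ : State) (x v : ℕ) : (σ.setReg x v).mem = σ.mem := rfl

open WordRAM.Expr

/-- The remaining time is stated explicitly, so that a generous numerical budget replaces the exact
sum of costs. -/
lemma Runs.assign_seq {W T x : ℕ} {e : Expr} {Q : Prog} {σ : State} {post : State → Prop}
    (T₂ : ℕ) (hT : e.cost + 1 + T₂ ≤ T) (he : e.wf = true) (hv : Bounded W σ → e.eval σ ≤ W)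
    (h : Runs W Q T₂ (σ.setReg x (e.eval σ)) post) : Runs W (.seq (WordRAM.assign x e) Q) T σ post :=
  (Runs.seq (Runs.assign he hv h)).mono hT fun _ _ h => h

lemma Runs.emitAll_seq {W b T : ℕ} {σ₀ σ : State} {es : List Expr} {l : List ℕ} {Q : Prog}
    {post : State → Prop} (T₂ : ℕ) (vs : List ℕ) (hT : emitCost es + T₂ ≤ T)
    (h : Emitting σ₀ b l σ) (hwf : ∀ e ∈ es, e.wf = true) (hW : ∀ v ∈ vs, v ≤ W)
    (hv : ∀ σ' : State, (∀ r ≠ 14, σ'.reg r = σ.reg r) → es.map (·.eval σ') = vs)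
    (hlen : b + (l ++ vs).length ≤ W)
    (hQ : ∀ σ', Emitting σ₀ b (l ++ vs) σ' → (∀ r ≠ 14, σ'.reg r = σ.reg r) →
      Runs W Q T₂ σ' post) : Runs W (.seq (WordRAM.emitAll es) Q) T σ post :=
  (Runs.seq ((Runs.emitAll h hwf hW hv hlen).mono le_rfl fun σ' _ h' => hQ σ' h'.1 h'.2)).mono hT
    fun _ _ h => h

lemma Runs.branch_le {W T : ℕ} {e : Expr} {P Q : Prog} {σ : State} {post : State → Prop}
    (T₁ : ℕ) (hT : e.cost + (T₁ + 1) ≤ T) (he : e.wf = true)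
    (h1 : e.eval σ ≠ 0 → Runs W P T₁ σ post) (h2 : e.eval σ = 0 → Runs W Q T₁ σ post) :
    Runs W (WordRAM.branch e P Q) T σ post := (Runs.branch he h1 h2).mono hT fun _ _ h => h

/-- Write the edges of the row with number `var 20`, with distance `var 18` from hub `var 19`. -/
def rowProg : Prog :=
  .seq (assign 22 (ite (eq (var 18) (lit 1)) (var 19)
      (add (mul (lit 3) (var 20)) (ite (eq (var 18) (lit 2)) (lit 2) (lit 3)))))
    (.seq (emitAll [add (mul (lit 3) (var 20)) (lit 2), var 19, add (mul (lit 3) (var 20)) (lit 3),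
        add (mul (lit 3) (var 20)) (lit 2), add (mul (lit 3) (var 20)) (lit 4), var 22])
      (branch (or (eq (var 20) (lit 0)) (eq (var 20) (var 5))) .skip
        (emitAll [add (mul (lit 3) (var 20)) (lit 4), add (mul (lit 3) (var 20)) (lit 1)])))

lemma Runs.rowProg {W b t : ℕ} {σ₀ σ : State} {l : List ℕ} (S : Spokes) (h : Emitting σ₀ b l σ)
    (h18 : σ.reg 18 = S.ell t) (h19 : σ.reg 19 = S.side t) (h20 : σ.reg 20 = t)
    (h5 : σ₀.reg 5 = S.n) (hW : 3 * t + 4 ≤ W) (hlen : b + (l ++ S.flatRow t).length ≤ W) :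
    Runs W rowProg 200 σ fun σ' => Emitting σ₀ b (l ++ S.flatRow t) σ' ∧ σ'.reg 15 = σ.reg 15 := by
  have hs := S.side_le t
  have ht := S.target_lt t
  have e22 : (ite (eq (var 18) (lit 1)) (var 19)
      (add (mul (lit 3) (var 20)) (ite (eq (var 18) (lit 2)) (lit 2) (lit 3)))).eval σ =
      S.target t := by
    rw [Expr.eval_ite Expr.eval_eq, eval_add, Expr.eval_ite Expr.eval_eq]
    simp only [eval_var, eval_lit, eval_mul, h18, h19, h20, Spokes.target]
    split_ifs <;> rfl
  refine Runs.assign_seq 150 (by decide) (by decide) (fun _ => by rw [e22]; omega) ?_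
  rw [e22]
  have hlen' : (S.flatRow t).length =
      6 + (if t = 0 ∨ t = S.n then [] else [3 * t + 4, 3 * t + 1]).length := by
    unfold Spokes.flatRow Spokes.row
    split_ifs <;> simp
  rw [List.length_append, hlen'] at hlen
  refine Runs.emitAll_seq 50 [3 * t + 2, S.side t, 3 * t + 3, 3 * t + 2, 3 * t + 4, S.target t]
    (by decide) (h.setReg (x := 22) (by omega)) (by decide) ?_ ?_ ?_ ?_
  · simp only [List.mem_cons, List.not_mem_nil, or_false]; omega
  · intro σ' hσ
    simp [hσ, h19, h20]
  · simp only [List.length_append, List.length_cons, List.length_nil]; omega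
  · intro σ' h1 h2
    have e20 : σ'.reg 20 = t := by simp [h2, h20]
    have e5 : σ'.reg 5 = S.n := by rw [h1.reg 5 (by omega), h5]
    have e15 : σ'.reg 15 = σ.reg 15 := by simp [h2]
    have eb : (or (eq (var 20) (lit 0)) (eq (var 20) (var 5))).eval σ' =
        if t = 0 ∨ t = S.n then 1 else 0 := by
      rw [Expr.eval_or Expr.eval_eq Expr.eval_eq]
      simp only [eval_var, eval_lit, e20, e5]
    refine Runs.branch_le 30 (by decide) (by decide) (fun hne => ?_) (fun h0 => ?_)
    · have hc : t = 0 ∨ t = S.n := by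
        by_contra hc; rw [eb, if_neg hc] at hne; exact hne rfl
      refine (Runs.skip ?_).mono (by decide) fun _ _ h => h
      refine ⟨?_, e15⟩
      unfold Spokes.flatRow Spokes.row
      rw [if_pos hc]
      exact h1
    · have hc : ¬ (t = 0 ∨ t = S.n) := by
        intro hc; rw [eb, if_pos hc] at h0; exact one_ne_zero h0
      rw [if_neg hc] at hlen
      refine Runs.mono (Runs.emitAll h1 (by decide) (vs := [3 * t + 4, 3 * t + 1]) ?_ ?_ ?_)
        (by decide) ?_
      · simp only [List.mem_cons, List.not_mem_nil, or_false]; omega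
      · intro σ'' hσ
        simp [hσ, e20]
      · simp only [List.length_append, List.length_cons, List.length_nil] at hlen ⊢; omega
      · rintro σ'' - ⟨h3, h4⟩
        refine ⟨?_, (h4 15 (by omega)).trans e15⟩
        unfold Spokes.flatRow Spokes.row
        rw [if_neg hc]
        simpa using h3

end WordRAM

/-! ### The rows of the two paths and the whole output -/

namespace WordRAM

open WordRAM.Expr

/-- The registers and the memory hold the data of the gadget `g`, whose vectors are chosen from the
input by the offsets in the registers `12` and `13`, and the output goes to the address `b`. -/
structure Ready (g : Gadget) (b : ℕ) (σ : State) : Prop where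
  reg_three : σ.reg 3 = g.d
  reg_four : σ.reg 4 = g.L
  reg_five : σ.reg 5 = g.n
  reg_six : σ.reg 6 = g.m
  reg_seven : σ.reg 7 = g.u
  reg_eight : σ.reg 8 = g.w
  reg_base : σ.reg 29 = b
  memU : ∀ v < g.u, ∀ k < g.d, 3 + min (σ.reg 12 + v) (σ.reg 1 - 1) * g.d + k < b ∧
    σ.mem (3 + min (σ.reg 12 + v) (σ.reg 1 - 1) * g.d + k) = (g.U v k).toNat
  memW : ∀ v < g.w, ∀ k < g.d,
    3 + σ.reg 1 * g.d + min (σ.reg 13 + v) (σ.reg 2 - 1) * g.d + k < b ∧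
    σ.mem (3 + σ.reg 1 * g.d + min (σ.reg 13 + v) (σ.reg 2 - 1) * g.d + k) = (g.W v k).toNat

/-- minimum of `e` and `f` -/
def Expr.min (e f : Expr) : Expr := sub e (sub e f)

@[simp] lemma Expr.eval_min {σ : State} {e f : Expr} :
    (Expr.min e f).eval σ = Min.min (e.eval σ) (f.eval σ) := by
  simp only [Expr.min, eval_sub]; omega

/-- Bit of the vector of the first kind that belongs to position `var 17` of gadget `var 16`. -/
def bitU : Expr := load (add (add (lit 3) (mul (Expr.min (add (var 12) (var 16))
  (sub (var 1) (lit 1))) (var 3))) (sub (div (var 17) (lit 4)) (lit 1)))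

/-- Bit of the vector of the second kind that belongs to position `var 17` of gadget `var 16`. -/
def bitW : Expr := load (add (add (add (lit 3) (mul (var 1) (var 3)))
  (mul (Expr.min (add (var 13) (var 16)) (sub (var 2) (lit 1))) (var 3)))
  (sub (div (var 17) (lit 4)) (lit 1)))

/-- Choose among four expressions by the kind of the position `var 17`. -/
def byPosition (a b c e : Expr) : Expr :=
  ite (or (eq (var 17) (lit 0)) (eq (var 17) (sub (var 4) (lit 1)))) a
    (ite (or (eq (var 17) (lit 1)) (eq (var 17) (sub (var 4) (lit 2)))) b
      (ite (eq (mod (var 17) (lit 4)) (lit 1)) c e))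

lemma eval_byPosition {σ : State} {a b c e : Expr} {d r : ℕ} (h4 : σ.reg 4 = 4 * d + 6)
    (h17 : σ.reg 17 = r) : (byPosition a b c e).eval σ =
      if r = 0 ∨ r = 4 * d + 5 then a.eval σ else if r = 1 ∨ r = 4 * d + 4 then b.eval σ else
        if r % 4 = 1 then c.eval σ else e.eval σ := by
  rw [byPosition, eval_ite (eval_or eval_eq eval_eq),
    eval_ite (eval_or eval_eq eval_eq), eval_ite eval_eq]
  simp only [eval_var, eval_lit, eval_sub, eval_mod, h4, h17]
  rfl

/-- Side of the hub at position `var 17`; the last or the first position counts as side `1`. -/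
def sideExpr (e : Expr) : Expr :=
  or (eq (mod (var 17) (lit 4)) (lit 3)) (or (eq (var 17) (sub (var 4) (lit 2))) (eq (var 17) e))

lemma eval_sideExpr {σ : State} {e : Expr} {d r x : ℕ} (h4 : σ.reg 4 = 4 * d + 6)
    (h17 : σ.reg 17 = r) (he : e.eval σ = x) : (sideExpr e).eval σ =
      if r % 4 = 3 ∨ r = 4 * d + 4 ∨ r = x then 1 else 0 := by
  rw [sideExpr, eval_or eval_eq (eval_or eval_eq eval_eq)]
  simp only [eval_var, eval_lit, eval_sub, eval_mod, h4, h17, he]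
  rfl

/-- Write the row of the vertex with number `var 15` of the first path. -/
def rowP : Prog :=
  .seq (assign 20 (var 15)) (.seq (assign 16 (div (var 15) (var 4)))
    (.seq (assign 17 (ite (lt (var 16) (var 7)) (mod (var 15) (var 4)) (sub (var 4) (lit 1))))
      (.seq (assign 21 bitU)
        (.seq (assign 18 (byPosition (lit 1) (lit 2) (add (lit 2) (var 21)) (lit 3)))
          (.seq (assign 19 (sideExpr (sub (var 4) (lit 1)))) rowProg)))))

lemma Runs.rowP {W b i : ℕ} {g : Gadget} {σ₀ σ : State} {l : List ℕ} (hR : Ready g b σ₀)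
    (h : Emitting σ₀ b l σ) (h15 : σ.reg 15 = i) (hi : i < g.n) (hW : 3 * i + 4 ≤ W)
    (hlen : b + (l ++ g.spokes.flatRow i).length ≤ W) :
    Runs W rowP 600 σ fun σ' => Emitting σ₀ b (l ++ g.spokes.flatRow i) σ' ∧ σ'.reg 15 = i := by
  refine Runs.with_bounded fun hb => ?_
  have h16 := hb.1
  have hLW : g.L ≤ W := by
    have := hb.2.1 4 (by decide)
    rwa [h.reg 4 (by omega), hR.reg_four] at this
  have hL := g.L_pos
  have r1 : σ.reg 1 = σ₀.reg 1 := h.reg 1 (by omega)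
  have r3 : σ.reg 3 = g.d := by rw [h.reg 3 (by omega), hR.reg_three]
  have r4 : σ.reg 4 = g.L := by rw [h.reg 4 (by omega), hR.reg_four]
  have r7 : σ.reg 7 = g.u := by rw [h.reg 7 (by omega), hR.reg_seven]
  have r12 : σ.reg 12 = σ₀.reg 12 := h.reg 12 (by omega)
  have hdiv : i / g.L ≤ W := (Nat.div_le_self _ _).trans (by omega)
  have hpos : g.posP i < g.L := by
    unfold Gadget.posP; split_ifs
    · exact Nat.mod_lt _ hL
    · unfold Gadget.L; omega
  refine Runs.assign_seq 590 (by decide) (by decide) (fun _ => by rw [eval_var]; omega) ?_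
  refine Runs.assign_seq 580 (by decide) (by decide) (fun _ => by simpa [h15, r4] using hdiv) ?_
  have e17 : ∀ σ' : State, σ'.reg 15 = i → σ'.reg 16 = i / g.L → σ'.reg 7 = g.u →
      σ'.reg 4 = g.L → (ite (lt (var 16) (var 7)) (mod (var 15) (var 4))
        (sub (var 4) (lit 1))).eval σ' = g.posP i := by
    intro σ' h15 h16 h7 h4
    rw [eval_ite eval_lt]
    simp only [eval_var, eval_lit, eval_mod, eval_sub, h15, h16, h7, h4, Gadget.posP]
    rfl
  have e17' := e17 ((σ.setReg 20 (eval σ (var 15))).setReg 16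
    (eval (σ.setReg 20 (eval σ (var 15))) ((var 15).div (var 4)))) (by simp [h15])
    (by simp [h15, r4]) (by simp [r7]) (by simp [r4])
  refine Runs.assign_seq 550 (by decide) (by decide) (fun _ => by rw [e17']; omega) ?_
  rw [e17']
  -- The bit is loaded even where the position has none. Any cell may be read, as all of them are
  -- bounded by `W`; the value is used only at coordinates.
  refine Runs.assign_seq 500 (by decide) (by decide) (fun hb => hb.2.2 _) ?_
  generalize hbit : eval _ bitU = bit
  set σ₁ := (((σ.setReg 20 (eval σ (var 15))).setReg 16
    (eval (σ.setReg 20 (eval σ (var 15))) ((var 15).div (var 4)))).setReg 17 (g.posP i)) with hσ₁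
  have e18 : (byPosition (lit 1) (lit 2) (add (lit 2) (var 21)) (lit 3)).eval (σ₁.setReg 21 bit) =
      g.spokes.ell i := by
    rw [eval_byPosition (d := g.d) (r := g.posP i) (by simp [hσ₁, r4, Gadget.L])
      (by simp [hσ₁])]
    simp only [Gadget.spokes, if_pos hi, Gadget.ellP, eval_lit, eval_add, eval_var]
    split_ifs with c1 c2 c3
    · rfl
    · rfl
    -- Padding has position `4 * d + 5`, which the first case has already covered.
    · have hu : i / g.L < g.u := by
        by_contra hu
        exact c1 (.inr (by rw [Gadget.posP, if_neg hu]))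
      have hk : g.posP i / 4 - 1 < g.d := by unfold Gadget.L at hpos; omega
      obtain ⟨m1, m2⟩ := hR.memU _ hu _ hk
      rw [← m2, ← hbit]
      simp [bitU, hσ₁, r1, r3, r4, r12, h15]
      rw [h.mem, writeList_of_lt _ m1]
    · rfl
  have b18 := g.spokes.ell_le i
  refine Runs.assign_seq 400 (by decide) (by decide) (fun _ => by rw [e18]; omega) ?_
  rw [e18]
  have e19 : (sideExpr (sub (var 4) (lit 1))).eval
      ((σ₁.setReg 21 bit).setReg 18 (g.spokes.ell i)) = g.spokes.side i := by
    rw [eval_sideExpr (d := g.d) (r := g.posP i) (x := 4 * g.d + 5) (by simp [hσ₁, r4, Gadget.L])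
      (by simp [hσ₁]) (by simp [hσ₁, r4, Gadget.L])]
    simp only [Gadget.spokes, if_pos hi, Gadget.sideP]
  have b19 := g.spokes.side_le i
  refine Runs.assign_seq 200 (by decide) (by decide) (fun _ => by rw [e19]; omega) ?_
  rw [e19]
  refine (Runs.rowProg (t := i) g.spokes (σ₀ := σ₀) (b := b) (l := l) ?_ (by simp) (by simp)
    (by simp [hσ₁, h15]) hR.reg_five hW hlen).mono le_rfl fun σ' _ h' => ⟨h'.1, ?_⟩
  · exact (((((h.setReg (by omega)).setReg (by omega)).setReg (by omega)).setReg
      (by omega)).setReg (by omega)).setReg (by omega)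
  · rw [h'.2]; simp [hσ₁, h15]

/-- Write the row of the vertex with number `var 15 + 1` of the second path. -/
def rowQ : Prog :=
  .seq (assign 20 (add (var 5) (var 15)))
    (.seq (assign 16 (div (sub (var 15) (lit 3)) (var 4)))
      (.seq (assign 17 (mod (sub (var 15) (lit 3)) (var 4)))
        (.seq (assign 21 bitW)
          (.seq (assign 18 (ite (lt (var 15) (lit 3)) (add (var 15) (lit 1))
              (ite (lt (var 16) (var 8))
                (byPosition (lit 3) (lit 2) (add (lit 1) (var 21)) (lit 1))
                (ite (eq (var 15) (add (lit 3) (mul (var 8) (var 4)))) (lit 3)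
                  (ite (eq (var 15) (add (lit 4) (mul (var 8) (var 4)))) (lit 2) (lit 1))))))
            (.seq (assign 19 (ite (lt (var 15) (lit 3)) (lit 0)
              (ite (lt (var 16) (var 8)) (sideExpr (lit 0)) (lit 1)))) rowProg)))))

lemma Runs.rowQ {W b i : ℕ} {g : Gadget} {σ₀ σ : State} {l : List ℕ} (hR : Ready g b σ₀)
    (h : Emitting σ₀ b l σ) (h15 : σ.reg 15 = i) (hW : 3 * (g.n + i) + 4 ≤ W)
    (hlen : b + (l ++ g.spokes.flatRow (g.n + i)).length ≤ W) :
    Runs W rowQ 600 σ fun σ' =>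
      Emitting σ₀ b (l ++ g.spokes.flatRow (g.n + i)) σ' ∧ σ'.reg 15 = i := by
  refine Runs.with_bounded fun hb => ?_
  have h16 := hb.1
  have hL := g.L_pos
  have r1 : σ.reg 1 = σ₀.reg 1 := h.reg 1 (by omega)
  have r2 : σ.reg 2 = σ₀.reg 2 := h.reg 2 (by omega)
  have r3 : σ.reg 3 = g.d := by rw [h.reg 3 (by omega), hR.reg_three]
  have r4 : σ.reg 4 = g.L := by rw [h.reg 4 (by omega), hR.reg_four]
  have r5 : σ.reg 5 = g.n := by rw [h.reg 5 (by omega), hR.reg_five]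
  have r8 : σ.reg 8 = g.w := by rw [h.reg 8 (by omega), hR.reg_eight]
  have r13 : σ.reg 13 = σ₀.reg 13 := h.reg 13 (by omega)
  have hdiv : (i - 3) / g.L ≤ W := (Nat.div_le_self _ _).trans (by omega)
  have hmod : (i - 3) % g.L ≤ W := (Nat.mod_le _ _).trans (by omega)
  have hmod' : (i - 3) % g.L < g.L := Nat.mod_lt _ hL
  refine Runs.assign_seq 590 (by decide) (by decide) (fun _ => ?_) ?_
  · simp only [eval_add, eval_var, r5, h15]; omega
  refine Runs.assign_seq 580 (by decide) (by decide) (fun _ => by simpa [h15, r4] using hdiv) ?_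
  refine Runs.assign_seq 570 (by decide) (by decide) (fun _ => by simpa [h15, r4] using hmod) ?_
  refine Runs.assign_seq 540 (by decide) (by decide) (fun hb => hb.2.2 _) ?_
  generalize hbit : eval _ bitW = bit
  generalize hσ₁ : ((State.setReg (State.setReg σ 20 _) 16 _).setReg 17 _) = σ₁ at hbit ⊢
  simp only [eval_add, eval_var, eval_div, eval_sub, eval_lit, eval_mod, State.reg_setReg, r5, h15,
    r4] at hσ₁
  norm_num at hσ₁
  -- The loop index `i` belongs to the path vertex `j = i + 1`, so the program's `i - 3` is the `j -
  -- 4` of `ellRowQ`.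
  have q4 : g.n + i - g.n + 1 = i + 1 := by omega
  have q5 : i + 1 - 4 = i - 3 := by omega
  have q6 : ¬ g.n + i < g.n := by omega
  have a3 : i + 1 < 4 ↔ i < 3 := by omega
  have a4 : i + 1 = 4 + g.w * g.L ↔ i = 3 + g.w * g.L := by omega
  have a5 : i + 1 = 5 + g.w * g.L ↔ i = 4 + g.w * g.L := by omega
  have e18 : (ite (lt (var 15) (lit 3)) (add (var 15) (lit 1))
      (ite (lt (var 16) (var 8)) (byPosition (lit 3) (lit 2) (add (lit 1) (var 21)) (lit 1))
        (ite (eq (var 15) (add (lit 3) (mul (var 8) (var 4)))) (lit 3)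
          (ite (eq (var 15) (add (lit 4) (mul (var 8) (var 4)))) (lit 2) (lit 1))))).eval
      (σ₁.setReg 21 bit) = g.spokes.ell (g.n + i) := by
    rw [eval_ite eval_lt, eval_ite eval_lt, eval_ite eval_eq,
      eval_ite eval_eq, eval_byPosition (d := g.d) (r := (i - 3) % g.L)
        (by simp [← hσ₁, r4, Gadget.L]) (by simp [← hσ₁])]
    simp only [Gadget.spokes, if_neg q6, q4, Gadget.ellRowQ, q5, a3, a4, a5, Gadget.ellQ]
    have e15 : (σ₁.setReg 21 bit).reg 15 = i := by simp [← hσ₁, h15]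
    have e16 : (σ₁.setReg 21 bit).reg 16 = (i - 3) / g.L := by simp [← hσ₁]
    have e8 : (σ₁.setReg 21 bit).reg 8 = g.w := by simp [← hσ₁, r8]
    have e4 : (σ₁.setReg 21 bit).reg 4 = g.L := by simp [← hσ₁, r4]
    have e21 : (σ₁.setReg 21 bit).reg 21 = bit := by simp
    simp only [eval_var, eval_lit, eval_add, eval_mul, e15, e16, e8, e4, e21]
    by_cases c0 : i < 3
    · rw [if_pos c0, if_pos c0]; omega
    rw [if_neg c0, if_neg c0]
    by_cases c1 : (i - 3) / g.L < g.w
    · rw [if_pos c1, if_pos c1]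
      split_ifs with c2 c3 c4
      · rfl
      · rfl
      · have hk : (i - 3) % g.L / 4 - 1 < g.d := by unfold Gadget.L at hmod' c2 c3 c4 ⊢; omega
        obtain ⟨m1, m2⟩ := hR.memW _ c1 _ hk
        rw [← m2, ← hbit]
        simp [bitW, ← hσ₁, r1, r2, r3, r13]
        rw [h.mem, writeList_of_lt _ m1]
      · rfl
    · rw [if_neg c1, if_neg c1]
  have b18 := g.spokes.ell_le (g.n + i)
  refine Runs.assign_seq 320 (by decide) (by decide) (fun _ => by rw [e18]; omega) ?_
  rw [e18]
  have e19 : (ite (lt (var 15) (lit 3)) (lit 0)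
      (ite (lt (var 16) (var 8)) (sideExpr (lit 0)) (lit 1))).eval
      ((σ₁.setReg 21 bit).setReg 18 (g.spokes.ell (g.n + i))) = g.spokes.side (g.n + i) := by
    rw [eval_ite eval_lt, eval_ite eval_lt, eval_sideExpr (d := g.d) (r := (i - 3) % g.L) (x := 0)
      (by simp [← hσ₁, r4, Gadget.L]) (by simp [← hσ₁]) rfl]
    simp only [Gadget.spokes, if_neg q6, q4, Gadget.sideRowQ, q5, a3, Gadget.sideQ]
    simp [← hσ₁, h15, r8]
  have b19 := g.spokes.side_le (g.n + i)
  refine Runs.assign_seq 200 (by decide) (by decide) (fun _ => by rw [e19]; omega) ?_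
  rw [e19]
  refine (Runs.rowProg (t := g.n + i) g.spokes (σ₀ := σ₀) (b := b) (l := l) ?_ (by simp) (by simp)
    (by simp [← hσ₁]) hR.reg_five hW hlen).mono le_rfl fun σ' _ h' => ⟨h'.1, ?_⟩
  · refine Emitting.setReg (Emitting.setReg (Emitting.setReg ?_ (by omega)) (by omega)) (by omega)
    rw [← hσ₁]
    exact ((h.setReg (by omega)).setReg (by omega)).setReg (by omega)
  · rw [h'.2]; simp [← hσ₁, h15]

lemma Runs.seq_le {W T : ℕ} {P Q : Prog} {σ : State} {post : State → Prop} (T₁ T₂ : ℕ)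
    (mid : State → Prop) (hT : T₁ + T₂ ≤ T) (h : Runs W P T₁ σ mid)
    (hQ : ∀ σ', Bounded W σ' → mid σ' → Runs W Q T₂ σ' post) : Runs W (.seq P Q) T σ post :=
  (Runs.seq (h.mono le_rfl hQ)).mono hT fun _ _ h => h

/-- Write the input of the Fréchet distance problem. -/
def buildProg : Prog :=
  .seq (assign 14 (var 29))
    (.seq (emitAll [add (mul (lit 3) (add (var 5) (sub (var 6) (lit 2)))) (lit 2),
        sub (mul (lit 4) (add (var 5) (sub (var 6) (lit 2)))) (lit 1), var 5, var 6, lit 1, lit 0])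
      (.seq (forLoop 15 (var 5) rowP)
        (.seq (forLoop 15 (sub (var 6) (lit 2)) rowQ)
          (.seq (forLoop 15 (var 5) (emitAll [add (mul (lit 3) (var 15)) (lit 4)]))
            (.seq (emitAll [lit 0])
              (.seq (forLoop 15 (sub (var 6) (lit 2))
                  (emitAll [add (mul (lit 3) (add (var 5) (var 15))) (lit 4)]))
                (emitAll [lit 1])))))))

lemma Runs.buildProg {W b : ℕ} {g : Gadget} {σ : State} (hR : Ready g b σ)
    (hW : b + 9 * (g.n + g.m) ≤ W) :
    Runs W buildProg (1000 * (g.n + g.m)) σ (Emitting σ b g.output) := by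
  have h1 := g.one_le_n
  have hm := g.hm
  have hlen : b + g.output.length ≤ W := by have := g.length_output; omega
  simp only [Gadget.output, List.length_append] at hlen
  have e5 : ∀ l σ', Emitting σ b l σ' → (var 5).eval σ' = g.n := fun l σ' h => by
    rw [eval_var, h.reg 5 (by omega), hR.reg_five]
  have e6 : ∀ l σ', Emitting σ b l σ' → (sub (var 6) (lit 2)).eval σ' = g.m - 2 := fun l σ' h => by
    rw [eval_sub, eval_var, eval_lit, h.reg 6 (by omega), hR.reg_six]
  refine Runs.assign_seq (1000 * (g.n + g.m) - 5) ?_ (by decide)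
    (fun _ => by rw [eval_var, hR.reg_base]; omega) ?_
  · simp only [Expr.cost]; omega
  have h0 : Emitting σ b [] (σ.setReg 14 (eval σ (var 29))) :=
    ⟨by rw [writeList_nil]; rfl, by simp [hR.reg_base], fun r hr => by simp [show r ≠ 14 by omega]⟩
  refine Runs.emitAll_seq (1000 * (g.n + g.m) - 200) [3 * (g.n + (g.m - 2)) + 2,
    4 * (g.n + (g.m - 2)) - 1, g.n, g.m, 1, 0] ?_ h0 (by decide) ?_ ?_ ?_ ?_
  · simp only [emitCost, Expr.cost, Expr.add, Expr.mul, Expr.sub]; omega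
  · simp only [List.mem_cons, List.not_mem_nil, or_false]; omega
  · intro σ' hσ
    simp [hσ, hR.reg_five, hR.reg_six]
  · simp only [List.length_append, List.length_nil]; omega
  intro σ₁ h1' _
  refine Runs.seq_le ((600 + (10 + 10)) * g.n + (10 + 10))
    (1000 * (g.n + g.m) - 620 * g.n - 300) _ (by omega)
    (Runs.emitLoop (σ₀ := σ) g.spokes.flatRow h1' (by decide) (by decide) e5 (by omega)
      (by simp only [List.length_append, List.length_nil]; omega) fun k hk l σ' hl h' h15 =>
        Runs.rowP hR h' h15 hk (by omega) hl) fun σ₂ _ h2 => ?_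
  refine Runs.seq_le ((600 + (10 + 10)) * (g.m - 2) + (10 + 10))
    (1000 * (g.n + g.m) - 620 * g.n - 620 * g.m - 400) _ (by omega)
    (Runs.emitLoop (σ₀ := σ) (fun i => g.spokes.flatRow (g.n + i)) h2 (by decide) (by decide) e6
      (by omega) (by simp only [List.length_append, List.length_nil]; omega) fun k hk l σ' hl h' h15 =>
        Runs.rowQ hR h' h15 (by omega) hl) fun σ₃ _ h3 => ?_
  refine Runs.seq_le ((50 + (10 + 10)) * g.n + (10 + 10))
    (1000 * (g.n + g.m) - 700 * g.n - 620 * g.m - 500) _ (by omega)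
    (Runs.emitLoop (σ₀ := σ) (fun i => [3 * i + 4]) h3 (by decide) (by decide) e5 (by omega)
      (by simp only [List.length_append, List.length_nil]; omega) fun k hk l σ' hl h' h15 =>
        (Runs.emitAll h' (by decide) (by simp only [List.mem_singleton]; omega)
          (fun σ'' hσ => by simp [hσ, h15]) hl).mono (by decide) fun σ'' _ h'' =>
            ⟨h''.1, by rw [h''.2 15 (by omega), h15]⟩) fun σ₄ _ h4 => ?_
  refine Runs.emitAll_seq (1000 * (g.n + g.m) - 700 * g.n - 620 * g.m - 600) [0] ?_ h4
    (by decide) (by simp) (fun _ _ => rfl) (by simp only [List.length_append, List.length_nil]; omega)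
    fun σ₅ h5 _ => ?_
  · simp only [emitCost, Expr.cost]; omega
  refine Runs.seq_le ((50 + (10 + 10)) * (g.m - 2) + (10 + 10)) 20 _ (by omega)
    (Runs.emitLoop (σ₀ := σ) (fun i => [3 * (g.n + i) + 4]) h5 (by decide) (by decide) e6 (by omega)
      (by simp only [List.length_append, List.length_nil]; omega) fun k hk l σ' hl h' h15 =>
        (Runs.emitAll h' (by decide) (by simp only [List.mem_singleton]; omega)
          (fun σ'' hσ => by simp [hσ, h15, show σ'.reg 5 = g.n from e5 _ _ h']) hl).mono (by decide)
            fun σ'' _ h'' => ⟨h''.1, by rw [h''.2 15 (by omega), h15]⟩) fun σ₆ _ h6 => ?_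
  refine (Runs.emitAll (vs := [1]) h6 (by decide) (by simp only [List.mem_singleton]; omega)
    (fun _ _ => rfl) (by simp only [List.length_append, List.length_nil]; omega)).mono (by decide)
    fun σ₇ _ h7 => ?_
  simpa only [Gadget.output, List.append_assoc, List.nil_append] using h7.1

end WordRAM

/-! ### Reading the input -/

lemma List.getD_flatten_of_length {α : Type*} {d : ℕ} (a : α) :
    ∀ (l : List (List α)), (∀ x ∈ l, x.length = d) → ∀ i k, k < d →
      l.flatten.getD (i * d + k) a = (l.getD i []).getD k a
  | [], _, i, k, _ => by simp
  | x :: l, h, 0, k, hk => by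
    rw [List.flatten_cons, Nat.zero_mul, Nat.zero_add,
      List.getD_append _ _ _ _ (by rw [h x (by simp)]; exact hk)]
    rfl
  | x :: l, h, i + 1, k, hk => by
    have hx := h x (by simp)
    rw [List.flatten_cons, List.getD_append_right _ _ _ _ (by rw [hx]; nlinarith), hx,
      show (i + 1) * d + k - d = i * d + k by rw [Nat.succ_mul]; omega,
      List.getD_flatten_of_length a l (fun y hy => h y (by simp [hy])) i k hk]
    rfl

lemma List.length_flatten_ofFn {α : Type*} {n d : ℕ} (f : Fin n → Fin d → α) :
    (List.ofFn fun i => List.ofFn fun k => f i k).flatten.length = n * d := by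
  simp [List.length_flatten, List.map_ofFn, Function.comp_def]

lemma List.getD_flatten_ofFn {n d i k : ℕ} (f : Fin n → Fin d → ℕ) (hi : i < n) (hk : k < d) :
    (List.ofFn fun i => List.ofFn fun k => f i k).flatten.getD (i * d + k) 0 =
      f ⟨i, hi⟩ ⟨k, hk⟩ := by
  rw [List.getD_flatten_of_length (d := d) 0 _ (by simp [List.mem_ofFn]) i k hk]
  simp [List.getD_eq_getElem?_getD, hi, hk]

section

variable {n m d : ℕ} (U : Fin n → Fin d → Bool) (W : Fin m → Fin d → Bool)

lemma length_encodeOV : (encodeOV U W).length = 3 + (n + m) * d := by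
  simp only [encodeOV, List.length_append, List.length_flatten_ofFn (fun i k => (U i k).toNat),
    List.length_flatten_ofFn (fun i k => (W i k).toNat), List.length_cons, List.length_nil]
  ring

lemma getD_encodeOV_U {i k : ℕ} (hi : i < n) (hk : k < d) :
    (encodeOV U W).getD (3 + i * d + k) 0 = (U ⟨i, hi⟩ ⟨k, hk⟩).toNat := by
  have h : i * d + k < n * d := by nlinarith
  rw [encodeOV, List.getD_append _ _ _ _ (by
      simp only [List.length_append, List.length_flatten_ofFn (fun i k => (U i k).toNat),
        List.length_cons, List.length_nil]; omega),
    List.getD_append_right _ _ _ _ (by simp only [List.length_cons, List.length_nil]; omega),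
    show 3 + i * d + k - [n, m, d].length = i * d + k by
      simp only [List.length_cons, List.length_nil]; omega,
    List.getD_flatten_ofFn (fun i k => (U i k).toNat) hi hk]

lemma getD_encodeOV_W {j k : ℕ} (hj : j < m) (hk : k < d) :
    (encodeOV U W).getD (3 + n * d + j * d + k) 0 = (W ⟨j, hj⟩ ⟨k, hk⟩).toNat := by
  have e : ([n, m, d] ++ (List.ofFn fun i => List.ofFn fun k => (U i k).toNat).flatten).length =
      3 + n * d := by
    simp only [List.length_append, List.length_flatten_ofFn (fun i k => (U i k).toNat),
        List.length_cons, List.length_nil]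
  rw [encodeOV, List.getD_append_right _ _ _ _ (by omega), e,
    show 3 + n * d + j * d + k - (3 + n * d) = j * d + k by omega,
    List.getD_flatten_ofFn (fun i k => (W i k).toNat) hj hk]

lemma mem_encodeOV_le {x : ℕ} (hx : x ∈ encodeOV U W) : x ≤ max (max n m) (max d 1) := by
  simp only [encodeOV, List.mem_append, List.mem_cons, List.not_mem_nil, or_false,
    List.mem_flatten, List.mem_ofFn] at hx
  rcases hx with (hx | ⟨_, ⟨i, rfl⟩, hx⟩) | ⟨_, ⟨i, rfl⟩, hx⟩
  · omega
  · obtain ⟨k, rfl⟩ := List.mem_ofFn.1 hx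
    have := Bool.toNat_le (U i k); omega
  · obtain ⟨k, rfl⟩ := List.mem_ofFn.1 hx
    have := Bool.toNat_le (W i k); omega

/-! ### Splitting an instance into blocks -/

/-- Bit `k` of the vector `i`; indices that are too large stand for the last vector. -/
def clampBit {n d : ℕ} (U : Fin n → Fin d → Bool) (i k : ℕ) : Bool :=
  if h : min i (n - 1) < n ∧ k < d then U ⟨min i (n - 1), h.1⟩ ⟨k, h.2⟩ else false

variable {n' m' : ℕ}

/-- Numbers of vectors that fit into paths with `n'` and `m'` vertices. -/
def blockU (d n' : ℕ) : ℕ := n' / (4 * d + 6)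
def blockW (d m' : ℕ) : ℕ := (m' - 8) / (4 * d + 6)

/-- The gadget for the pair of blocks with number `c`. -/
def callGadget (hn : 4 * d + 6 ≤ n') (hm : 4 * d + 14 ≤ m') (c : ℕ) : Gadget where
  d := d
  u := blockU d n'
  w := blockW d m'
  n := n'
  m := m'
  U v := clampBit U (c / (m / blockW d m' + 1) * blockU d n' + v)
  W v := clampBit W (c % (m / blockW d m' + 1) * blockW d m' + v)
  hn := Nat.div_mul_le_self _ _
  hm := by have := Nat.div_mul_le_self (m' - 8) (4 * d + 6); unfold blockW; omega
  one_le_n := by omega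

/-- Some pair of vectors in the pair of blocks with number `c` is orthogonal. -/
def BlockHasPair (n' m' c : ℕ) : Prop :=
  ∃ v < blockU d n', ∃ w < blockW d m', ∀ k < d,
    (clampBit U (c / (m / blockW d m' + 1) * blockU d n' + v) k &&
      clampBit W (c % (m / blockW d m' + 1) * blockW d m' + w) k) = false

/-- Clamping only repeats genuine vectors, so no orthogonal pair is invented; the pair `i`, `j` is
found in the blocks `i / u` and `j / w`. -/
lemma exists_blockHasPair_iff (hn : 1 ≤ n) (hm : 1 ≤ m) (hu : 1 ≤ blockU d n')
    (hw : 1 ≤ blockW d m') :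
    (∃ c < (n / blockU d n' + 1) * (m / blockW d m' + 1), BlockHasPair U W n' m' c) ↔
      HasOrthogonalPair U W := by
  constructor
  · rintro ⟨c, -, v, hv, w, hw, h⟩
    refine ⟨⟨min (c / (m / blockW d m' + 1) * blockU d n' + v) (n - 1), by omega⟩,
      ⟨min (c % (m / blockW d m' + 1) * blockW d m' + w) (m - 1), by omega⟩, fun k => ?_⟩
    have := h k k.2
    rwa [clampBit, clampBit, dif_pos ⟨by omega, k.2⟩, dif_pos ⟨by omega, k.2⟩] at this
  · rintro ⟨i, j, h⟩
    set u := blockU d n'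
    set w := blockW d m'
    have hi := i.2
    have hj := j.2
    have h1 : (i : ℕ) / u < n / u + 1 := Nat.lt_succ_of_le (Nat.div_le_div_right hi.le)
    have h2 : (j : ℕ) / w < m / w + 1 := Nat.lt_succ_of_le (Nat.div_le_div_right hj.le)
    refine ⟨(i : ℕ) / u * (m / w + 1) + (j : ℕ) / w, Gadget.lt_of_mul_add h1 h2,
      (i : ℕ) % u, Nat.mod_lt _ hu, (j : ℕ) % w, Nat.mod_lt _ hw, fun k hk => ?_⟩
    rw [Gadget.div_eq h2, Gadget.mod_eq h2, mul_comm _ u, Nat.div_add_mod, mul_comm _ w,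
      Nat.div_add_mod, clampBit, clampBit, dif_pos ⟨by omega, hk⟩, dif_pos ⟨by omega, hk⟩]
    convert h ⟨k, hk⟩ using 4
    · exact min_eq_left (by omega)
    · exact min_eq_left (by omega)

end

/-! ### The calls of the approximation program -/

namespace WordRAM

open WordRAM.Expr

/-- Build the input for the pair of blocks with number `var 9`, run `A` on it, and update the
answer in register `0`. -/
def callProg (A : Prog) : Prog :=
  .seq (assign 12 (mul (div (var 9) (var 11)) (var 7)))
    (.seq (assign 13 (mul (mod (var 9) (var 11)) (var 8)))
      (.seq buildProg
        (.seq (clearRegs A.maxReg)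
          (.seq A.relocate
            (.seq (assign 0 (or (var 0) (lt (var 50) (mul (lit 5) (var 51)))))
              (assign 29 (add (var 29) (var 23))))))))

/-- Registers that keep their values during the calls. -/
def Kept (r : ℕ) : Prop := (1 ≤ r ∧ r ≤ 8) ∨ r = 10 ∨ r = 11 ∨ (23 ≤ r ∧ r < 29)

/-- The state of the registers and the memory before the first call. -/
structure CallReady {n m d : ℕ} (U : Fin n → Fin d → Bool) (W : Fin m → Fin d → Bool)
    (n' m' S : ℕ) (σ : State) : Prop where
  reg_zero : σ.reg 0 = 0
  reg_one : σ.reg 1 = n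
  reg_two : σ.reg 2 = m
  reg_three : σ.reg 3 = d
  reg_four : σ.reg 4 = 4 * d + 6
  reg_five : σ.reg 5 = n'
  reg_six : σ.reg 6 = m'
  reg_seven : σ.reg 7 = blockU d n'
  reg_eight : σ.reg 8 = blockW d m'
  reg_ten : σ.reg 10 = (n / blockU d n' + 1) * (m / blockW d m' + 1)
  reg_eleven : σ.reg 11 = m / blockW d m' + 1
  reg_stride : σ.reg 23 = S
  reg_base : σ.reg 29 = (encodeOV U W).length
  high : ∀ r, σ.reg (r + 50) = 0
  mem : ∀ y, σ.mem y = (encodeOV U W).getD y 0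

/-- The state before call number `k`, where `σ₀` is the state before the first call. -/
structure Calling {n m d : ℕ} (U : Fin n → Fin d → Bool) (W : Fin m → Fin d → Bool)
    (R S : ℕ) (σ₀ : State) (k : ℕ) (σ : State) : Prop where
  kept : ∀ r, Kept r → σ.reg r = σ₀.reg r
  counter : σ.reg 9 = k
  base : σ.reg 29 = (encodeOV U W).length + k * S
  input : ∀ y < (encodeOV U W).length, σ.mem y = (encodeOV U W).getD y 0
  zero : ∀ y, (encodeOV U W).length + k * S ≤ y → σ.mem y = 0
  high : ∀ r, R ≤ r → σ.reg (r + 50) = 0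

variable {n m d n' m' S W k : ℕ} {U : Fin n → Fin d → Bool} {V : Fin m → Fin d → Bool}

lemma CallReady.ready {σ₀ σ : State} {R b : ℕ} (h₀ : CallReady U V n' m' S σ₀)
    (hn : 4 * d + 6 ≤ n') (hm : 4 * d + 14 ≤ m') (hn1 : 1 ≤ n) (hm1 : 1 ≤ m)
    (h : Calling U V R S σ₀ k σ) (hb : b = (encodeOV U V).length + k * S) :
    Ready (callGadget U V hn hm k) b
      ((σ.setReg 12 (k / (m / blockW d m' + 1) * blockU d n')).setReg 13
        (k % (m / blockW d m' + 1) * blockW d m')) where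
  reg_three := by simp [h.kept 3 (by simp [Kept]), h₀.reg_three, callGadget]
  reg_four := by simp [h.kept 4 (by simp [Kept]), h₀.reg_four, callGadget, Gadget.L]
  reg_five := by simp [h.kept 5 (by simp [Kept]), h₀.reg_five, callGadget]
  reg_six := by simp [h.kept 6 (by simp [Kept]), h₀.reg_six, callGadget]
  reg_seven := by simp [h.kept 7 (by simp [Kept]), h₀.reg_seven, callGadget]
  reg_eight := by simp [h.kept 8 (by simp [Kept]), h₀.reg_eight, callGadget]
  reg_base := by simp [h.base, hb]
  memU v _ x hx := by
    have hlen := length_encodeOV U V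
    have e1 : σ.reg 1 = n := by rw [h.kept 1 (by simp [Kept]), h₀.reg_one]
    have hx : x < d := hx
    simp only [State.reg_setReg, e1, if_pos, if_neg (show ¬ (12 = 13) by omega),
      if_neg (show ¬ (1 = 12) by omega), if_neg (show ¬ (1 = 13) by omega), State.mem_setReg,
      show (callGadget U V hn hm k).d = d from rfl]
    set i := Min.min (k / (m / blockW d m' + 1) * blockU d n' + v) (n - 1) with hi
    have hi' : i < n := by omega
    have h1 : 3 + i * d + x < 3 + (n + m) * d := by nlinarith
    refine ⟨by omega, ?_⟩
    rw [h.input _ (by omega), getD_encodeOV_U U V hi' hx]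
    simp only [callGadget, clampBit]
    rw [dif_pos ⟨hi', hx⟩]
  memW v _ x hx := by
    have hlen := length_encodeOV U V
    have e1 : σ.reg 1 = n := by rw [h.kept 1 (by simp [Kept]), h₀.reg_one]
    have e2 : σ.reg 2 = m := by rw [h.kept 2 (by simp [Kept]), h₀.reg_two]
    have hx : x < d := hx
    simp only [State.reg_setReg, e1, e2, if_pos, if_neg (show ¬ (2 = 12) by omega),
      if_neg (show ¬ (2 = 13) by omega),
      if_neg (show ¬ (1 = 12) by omega), if_neg (show ¬ (1 = 13) by omega), State.mem_setReg,
      show (callGadget U V hn hm k).d = d from rfl]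
    set i := Min.min (k % (m / blockW d m' + 1) * blockW d m' + v) (m - 1) with hi
    have hi' : i < m := by omega
    have h1 : 3 + n * d + i * d + x < 3 + (n + m) * d := by nlinarith
    refine ⟨by omega, ?_⟩
    rw [h.input _ (by omega), getD_encodeOV_W U V hi' hx]
    simp only [callGadget, clampBit]
    rw [dif_pos ⟨hi', hx⟩]

/-- The program `A` approximates the Fréchet distance of the instance `g` within a factor less than
`5 / 4`, in time `T` and with words that hold numbers below `B`. -/
def Approximates (A : Prog) (B T : ℕ) (g : Gadget) : Prop :=
  ∃ t s f, Exec B A (initState g.output) t s ∧ t ≤ T ∧ g.toPlanarPathPair.frechet = (f : ℕ) ∧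
    (s.reg 0 < 5 * s.reg 1 ↔ f < 5)

open Classical in
-- Every call uses a new memory window of length `S`, which exceeds all addresses that `A` can form.
-- The window is still zero, so only registers have to be cleared between calls.
lemma Runs.callProg {A : Prog} {B T : ℕ} {σ₀ σ : State} (h₀ : CallReady U V n' m' S σ₀)
    (hn : 4 * d + 6 ≤ n') (hm : 4 * d + 14 ≤ m') (hn1 : 1 ≤ n) (hm1 : 1 ≤ m)
    (h : Calling U V A.maxReg S σ₀ k σ)
    (hk : k < (n / blockU d n' + 1) * (m / blockW d m' + 1))
    (hA : Approximates A B T (callGadget U V hn hm k)) (hB : 0 < B) (hBS : B ≤ S)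
    (hS : 9 * (n' + m') ≤ S) (hW : (encodeOV U V).length + (k + 1) * S ≤ W) (p : Prop) [Decidable p]
    (hans : σ.reg 0 = if p then 1 else 0) :
    Runs W (callProg A) (100 + 1000 * (n' + m') + A.maxReg + 2 * T) σ fun σ' =>
      σ'.reg 9 = k ∧ Calling U V A.maxReg S σ₀ (k + 1) (σ'.setReg 9 (k + 1)) ∧
        σ'.reg 0 = if p ∨ BlockHasPair U V n' m' k then 1 else 0 := by
  refine Runs.with_bounded fun hbd => ?_
  have h16 := hbd.1
  have hr : ∀ r, Kept r → ¬ Scratch r := fun r => by unfold Kept Scratch; omega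
  have e7 : σ.reg 7 = blockU d n' := by rw [h.kept 7 (by simp [Kept]), h₀.reg_seven]
  have e8 : σ.reg 8 = blockW d m' := by rw [h.kept 8 (by simp [Kept]), h₀.reg_eight]
  have e11 : σ.reg 11 = m / blockW d m' + 1 := by
    rw [h.kept 11 (by simp [Kept]), h₀.reg_eleven]
  have e23 : σ.reg 23 = S := by rw [h.kept 23 (by simp [Kept]), h₀.reg_stride]
  have hnW : n ≤ W := by
    have := hbd.2.1 1 (by decide); rwa [h.kept 1 (by simp [Kept]), h₀.reg_one] at this
  have hmW : m ≤ W := by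
    have := hbd.2.1 2 (by decide); rwa [h.kept 2 (by simp [Kept]), h₀.reg_two] at this
  set b := (encodeOV U V).length + k * S with hb
  have hbW : b + S ≤ W := by rw [add_mul] at hW; omega
  have ev12 : eval σ (mul (div (var 9) (var 11)) (var 7)) =
      k / (m / blockW d m' + 1) * blockU d n' := by simp [h.counter, e11, e7]
  have b12 : k / (m / blockW d m' + 1) * blockU d n' ≤ n := by
    refine le_trans (Nat.mul_le_mul_right _ ?_) (Nat.div_mul_le_self n (blockU d n'))
    exact Nat.lt_succ_iff.1 ((Nat.div_lt_iff_lt_mul (Nat.succ_pos _)).2 hk)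
  have b13 : k % (m / blockW d m' + 1) * blockW d m' ≤ m :=
    le_trans (Nat.mul_le_mul_right _ (Nat.lt_succ_iff.1 (Nat.mod_lt _ (Nat.succ_pos _))))
      (Nat.div_mul_le_self m (blockW d m'))
  refine Runs.assign_seq (90 + 1000 * (n' + m') + A.maxReg + 2 * T) ?_ (by decide)
    (fun _ => by rw [ev12]; omega) ?_
  · simp only [Expr.cost, Expr.mul, Expr.div]; omega
  rw [ev12]
  have ev13 : eval (σ.setReg 12 (k / (m / blockW d m' + 1) * blockU d n'))
      (mul (mod (var 9) (var 11)) (var 8)) = k % (m / blockW d m' + 1) * blockW d m' := by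
    simp [h.counter, e11, e8]
  refine Runs.assign_seq (80 + 1000 * (n' + m') + A.maxReg + 2 * T) ?_ (by decide)
    (fun _ => by rw [ev13]; omega) ?_
  · simp only [Expr.cost, Expr.mul, Expr.mod]; omega
  rw [ev13]
  have hready := h₀.ready hn hm hn1 hm1 h hb
  set g := callGadget U V hn hm k with hg
  set σ₁ := (σ.setReg 12 (k / (m / blockW d m' + 1) * blockU d n')).setReg 13
    (k % (m / blockW d m' + 1) * blockW d m') with hσ₁
  have h1 : ∀ r, r ≠ 12 → r ≠ 13 → σ₁.reg r = σ.reg r := fun r h h' => by simp [hσ₁, h, h']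
  have hout := g.length_output
  have hgn : g.n = n' := rfl
  have hgm : g.m = m' := rfl
  refine Runs.seq_le (1000 * (n' + m')) (80 + A.maxReg + 2 * T) _ (by omega)
    (Runs.buildProg hready (by omega)) fun σ₂ _ h2 => ?_
  refine Runs.seq_le (A.maxReg + 1) (70 + 2 * T) _ (by omega) (Runs.clearRegs A.maxReg)
    fun σ₃ _ ⟨h31, h32, h33, h34⟩ => ?_
  obtain ⟨t, s, f, hE, ht, hf, hcmp⟩ := hA
  -- Registers below `A.maxReg` have just been cleared and the others were never written; the window
  -- holds the output followed by zeros.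
  have hR : Relocated B b (initState g.output) σ₃ := by
    refine ⟨fun r => ?_, fun x hx => ?_, fun r => hB⟩
    · rcases lt_or_ge r A.maxReg with hr' | hr'
      · exact h33 r hr'
      · rw [h34 r hr', h2.reg _ (by omega), h1 _ (by omega) (by omega)]
        exact h.high r hr'
    · rw [h31, h2.mem, writeList]
      split_ifs with hc
      · rw [Nat.add_sub_cancel_left]; rfl
      · rw [show σ₁.mem = σ.mem from rfl, h.zero _ (by omega)]
        exact (List.getD_eq_default _ _ (by omega)).symm
  have hb3 : σ₃.reg 29 = b := by rw [h32 29 (by omega), h2.reg 29 (by omega), hready.reg_base]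
  refine Runs.seq_le (2 * T) 60 _ (by omega)
    ((Runs.relocate hE (by omega : b + B ≤ W) hb3 hR).mono (by omega) fun _ _ h => h)
    fun σ₄ _ ⟨h4, h5⟩ => ?_
  have low : ∀ r < 30, ¬ (12 ≤ r ∧ r ≤ 22) → σ₄.reg r = σ.reg r := fun r hr1 hr2 => by
    rw [h5.reg r hr1, h32 r hr1, h2.reg r (by omega), h1 r (by omega) (by omega)]
  -- The gap between Fréchet distance 4 and 5, decided without division.
  have hiff : s.reg 0 < 5 * s.reg 1 ↔ BlockHasPair U V n' m' k := by
    rw [hcmp]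
    constructor
    · intro hlt
      by_contra hno
      have : (5 : ℕ∞) ≤ g.toPlanarPathPair.frechet := g.le_frechet fun v hv w hw => by
        by_contra hcon
        refine hno ⟨v, hv, w, hw, fun x hx => ?_⟩
        by_contra hne
        rw [Bool.not_eq_false, Bool.and_eq_true] at hne
        exact hcon ⟨x, hx, hne⟩
      rw [hf] at this
      have : 5 ≤ f := by exact_mod_cast this
      omega
    · rintro ⟨v, hv, w, hw, hvw⟩
      have : g.toPlanarPathPair.frechet ≤ (4 : ℕ∞) := g.frechet_le hv hw hvw
      rw [hf] at this
      have : f ≤ 4 := by exact_mod_cast this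
      omega
  have eans : eval σ₄ (or (var 0) (lt (var 50) (mul (lit 5) (var 51)))) =
      if p ∨ BlockHasPair U V n' m' k then 1 else 0 := by
    refine Expr.eval_or ?_ ?_
    · rw [eval_var, low 0 (by omega) (by omega), hans]
    · rw [eval_lt, eval_var, eval_mul, eval_lit, eval_var, h4.reg 0, h4.reg 1]
      simp only [hiff]
  refine Runs.assign_seq 40 (by decide) (by decide) (fun _ => by rw [eans]; split_ifs <;> omega) ?_
  rw [eans]
  have e29 : eval (σ₄.setReg 0 (if p ∨ BlockHasPair U V n' m' k then 1 else 0))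
      (add (var 29) (var 23)) = b + S := by
    simp [low 29 (by omega) (by omega), low 23 (by omega) (by omega), h.base, e23, hb]
  refine (Runs.assign (by decide) (fun _ => by rw [e29]; omega) ?_).mono (by decide)
    fun _ _ h => h
  rw [e29]
  refine ⟨?_, ⟨fun r hr => ?_, by simp, ?_, fun y hy => ?_, fun y hy => ?_, fun r hr => ?_⟩, ?_⟩
  · simp [low 9 (by omega) (by omega), h.counter]
  · unfold Kept at hr
    simp only [State.reg_setReg]
    rw [if_neg (by omega), if_neg (by omega), if_neg (by omega), low r (by omega) (by omega),
      h.kept r hr]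
  · simp only [State.reg_setReg]
    rw [if_neg (by omega), if_pos trivial, hb, add_mul]; omega
  · have hyb : y < b := by omega
    simp only [State.mem_setReg]
    rw [h5.mem y (by omega), h31, h2.mem, writeList_of_lt _ hyb]
    exact h.input y hy
  · simp only [State.mem_setReg]
    have : b + S ≤ y := by rw [add_mul] at hy; omega
    rw [h5.mem y (by omega), h31, h2.mem, writeList, if_neg (by omega)]
    exact h.zero y (by omega)
  · simp only [State.reg_setReg]
    rw [if_neg (by omega), if_neg (by omega), if_neg (by omega), h4.reg,
      hE.reg_of_maxReg_le r hr]
    rfl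
  · simp

open Classical in
/-- The loop over all pairs of blocks. -/
lemma Runs.callLoop {A : Prog} {B T : ℕ} {σ₀ : State} (h₀ : CallReady U V n' m' S σ₀)
    (hn : 4 * d + 6 ≤ n') (hm : 4 * d + 14 ≤ m') (hn1 : 1 ≤ n) (hm1 : 1 ≤ m)
    (hA : ∀ k, Approximates A B T (callGadget U V hn hm k)) (hB : 0 < B) (hBS : B ≤ S)
    (hS : 9 * (n' + m') ≤ S) (hW : (encodeOV U V).length +
      (n / blockU d n' + 1) * (m / blockW d m' + 1) * S ≤ W) :
    Runs W (WordRAM.forLoop 9 (var 10) (WordRAM.callProg A))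
      ((150 + 1000 * (n' + m') + A.maxReg + 2 * T) *
        ((n / blockU d n' + 1) * (m / blockW d m' + 1)) + 50) σ₀ fun σ' =>
      σ'.reg 0 = if HasOrthogonalPair U V then 1 else 0 := by
  have hu : 1 ≤ blockU d n' := (Nat.one_le_div_iff (by omega)).2 hn
  have hw : 1 ≤ blockW d m' := (Nat.one_le_div_iff (by omega)).2 (by omega)
  refine (Runs.forLoop (N := (n / blockU d n' + 1) * (m / blockW d m' + 1)) (c := 10)
    (T := 100 + 1000 * (n' + m') + A.maxReg + 2 * T) (fun k σ => Calling U V A.maxReg S σ₀ k σ ∧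
      σ.reg 0 = if ∃ c < k, BlockHasPair U V n' m' c then 1 else 0) (by omega) (by decide)
    (by decide) ⟨⟨fun r hr => ?_, by simp, ?_, fun y _ => h₀.mem y, fun y hy => ?_, fun r _ => ?_⟩, ?_⟩
    (fun k _ σ h => ⟨h.1.counter, ?_⟩) ?_ (fun k hk σ h => ?_) fun σ h => ?_).mono ?_
    fun _ _ h => h
  · unfold Kept at hr
    simp [show r ≠ 9 by omega]
  · simp [h₀.reg_base]
  · rw [State.mem_setReg, h₀.mem]
    exact List.getD_eq_default _ _ (by omega)
  · simp [h₀.high]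
  · simp [h₀.reg_zero]
  · rw [eval_var, h.1.kept 10 (by simp [Kept]), h₀.reg_ten]
  · have : (n / blockU d n' + 1) * (m / blockW d m' + 1) ≤
      (n / blockU d n' + 1) * (m / blockW d m' + 1) * S := Nat.le_mul_of_pos_right _ (by omega)
    omega
  · have hkS : (k + 1) * S ≤ (n / blockU d n' + 1) * (m / blockW d m' + 1) * S :=
      Nat.mul_le_mul_right _ hk
    refine (Runs.callProg h₀ hn hm hn1 hm1 h.1 hk (hA k) hB hBS hS (by omega) _ h.2).mono le_rfl
      fun σ' _ h' => ⟨h'.1, h'.2.1, ?_⟩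
    simp only [State.reg_setReg]
    rw [if_neg (by omega), h'.2.2]
    refine if_congr ?_ rfl rfl
    constructor
    · rintro (⟨c, hc, h⟩ | h)
      exacts [⟨c, by omega, h⟩, ⟨k, by omega, h⟩]
    · rintro ⟨c, hc, hc'⟩
      rcases Nat.lt_succ_iff_lt_or_eq.1 hc with hc | hck
      exacts [.inl ⟨c, hc, hc'⟩, .inr (hck ▸ hc')]
  · rw [h.2]
    exact if_congr (exists_blockHasPair_iff U V hn1 hm1 hu hw) rfl rfl
  · have : ∀ a b : ℕ, a * b + (10 + 10) ≤ a * b + 50 := fun a b => by omega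
    refine (this _ _).trans (Nat.add_le_add_right (Nat.mul_le_mul_right _ ?_) _)
    omega

end WordRAM

/-! ### The program for orthogonal vectors -/

namespace WordRAM

open WordRAM.Expr

/-- Register `24` becomes the power of register `25` with a fixed exponent. -/
def powProg : ℕ → Prog
  | 0 => .const 24 1
  | e + 1 => .seq (powProg e) (assign 24 (mul (var 24) (var 25)))

lemma Runs.powProg {W y : ℕ} {σ : State} (hy : 1 ≤ y) (h25 : σ.reg 25 = y) :
    ∀ e : ℕ, y ^ e ≤ W → Runs W (powProg e) (5 * e + 1) σ fun σ' => σ' = σ.setReg 24 (y ^ e)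
  | 0, h => Runs.const _ _ (by simpa using h) (by simp)
  | e + 1, h => by
    have hle : y ^ e ≤ y ^ (e + 1) := Nat.pow_le_pow_right hy (Nat.le_succ e)
    refine Runs.seq_le _ 4 _ (by omega) (Runs.powProg hy h25 e (hle.trans h)) fun σ' _ h' => ?_
    subst h'
    have e1 : eval (σ.setReg 24 (y ^ e)) (mul (var 24) (var 25)) = y ^ (e + 1) := by
      simp [h25, pow_succ]
    refine (Runs.assign (by decide) (fun _ => by rw [e1]; exact h) ?_).mono (by decide)
      fun _ _ h => h
    rw [e1]
    simp only [State.setReg, Function.update_idem]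

/-- In states whose registers hold `n`, `m` and `d`, the program `sel` computes the lengths `n'` and
`m'` of the paths. -/
def Selects (W : ℕ) (sel : Prog) (T n m d n' m' : ℕ) : Prop :=
  ∀ σ : State, σ.reg 1 = n → σ.reg 2 = m → σ.reg 3 = d →
    Runs W sel T σ fun σ' => σ'.reg 5 = n' ∧ σ'.reg 6 = m' ∧ σ'.mem = σ.mem ∧
      ∀ r, r < 5 ∨ 50 ≤ r → σ'.reg r = σ.reg r

/-- The program for the orthogonal vectors problem. -/
def solveProg (A sel : Prog) (e : ℕ) : Prog :=
  .seq (assign 1 (load (lit 0))) (.seq (assign 2 (load (lit 1))) (.seq (assign 3 (load (lit 2)))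
    (.seq (assign 4 (add (mul (lit 4) (var 3)) (lit 6))) (.seq sel
      (.seq (assign 7 (div (var 5) (var 4))) (.seq (assign 8 (div (sub (var 6) (lit 8)) (var 4)))
        (.seq (assign 11 (add (div (var 2) (var 8)) (lit 1)))
          (.seq (assign 10 (mul (add (div (var 1) (var 7)) (lit 1)) (var 11)))
            (.seq (assign 25 (mul (lit 16) (add (var 5) (var 6)))) (.seq (powProg e)
              (.seq (assign 23 (var 24))
                (.seq (assign 29 (add (lit 3) (mul (add (var 1) (var 2)) (var 3))))
                  (forLoop 9 (var 10) (callProg A))))))))))))))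

variable {n m d n' m' W : ℕ} {U : Fin n → Fin d → Bool} {V : Fin m → Fin d → Bool}

open Classical in
lemma Runs.solveProg {A sel : Prog} {B e T T₀ : ℕ} (hsel : Selects W sel T₀ n m d n' m')
    (hn : 4 * d + 6 ≤ n') (hm : 4 * d + 14 ≤ m') (hn1 : 1 ≤ n) (hm1 : 1 ≤ m) (he : 1 ≤ e)
    (hA : ∀ k, Approximates A B T (callGadget U V hn hm k)) (hB : 0 < B)
    (hBS : B ≤ (16 * (n' + m')) ^ e) (hW : (encodeOV U V).length +
      (n / blockU d n' + 1) * (m / blockW d m' + 1) * (16 * (n' + m')) ^ e ≤ W) :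
    Runs W (solveProg A sel e) (T₀ + ((150 + 1000 * (n' + m') + A.maxReg + 2 * T) *
        ((n / blockU d n' + 1) * (m / blockW d m' + 1)) + (300 + 5 * e)))
      (initState (encodeOV U V)) fun σ' =>
      σ'.reg 0 = if HasOrthogonalPair U V then 1 else 0 := by
  refine Runs.with_bounded fun hbd => ?_
  have hlen := length_encodeOV U V
  set S := (16 * (n' + m')) ^ e with hS
  -- The stride also leaves room for the output, of length below `9 * (n' + m')`.
  have hS1 : 16 * (n' + m') ≤ S := Nat.le_self_pow (by omega) _
  set τ := (150 + 1000 * (n' + m') + A.maxReg + 2 * T) *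
        ((n / blockU d n' + 1) * (m / blockW d m' + 1)) with hτ
  have c1 : m / blockW d m' + 1 ≤ (n / blockU d n' + 1) * (m / blockW d m' + 1) :=
    Nat.le_mul_of_pos_left _ (Nat.succ_pos _)
  have c2 : (n / blockU d n' + 1) * (m / blockW d m' + 1) ≤
      (n / blockU d n' + 1) * (m / blockW d m' + 1) * S := Nat.le_mul_of_pos_right _ (by omega)
  have c3 : S ≤ (n / blockU d n' + 1) * (m / blockW d m' + 1) * S :=
    Nat.le_mul_of_pos_left _ (by positivity)
  have m0 : (encodeOV U V).getD 0 0 = n := rfl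
  have m1 : (encodeOV U V).getD 1 0 = m := rfl
  have m2 : (encodeOV U V).getD 2 0 = d := rfl
  have hmem : ∀ y, (initState (encodeOV U V)).mem y = (encodeOV U V).getD y 0 := fun _ => rfl
  have hreg : ∀ y, (initState (encodeOV U V)).reg y = 0 := fun _ => rfl
  set σ := initState (encodeOV U V)
  have n0 : σ.mem 0 = n := hmem 0
  have n1 : σ.mem 1 = m := hmem 1
  have n2 : σ.mem 2 = d := hmem 2
  refine Runs.assign_seq (T₀ + (τ + (290 + 5 * e))) (by simp only [Expr.cost]; omega) (by decide)
    (fun hb => hb.2.2 _) ?_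
  refine Runs.assign_seq (T₀ + (τ + (280 + 5 * e))) (by simp only [Expr.cost]; omega) (by decide)
    (fun hb => hb.2.2 _) ?_
  refine Runs.assign_seq (T₀ + (τ + (270 + 5 * e))) (by simp only [Expr.cost]; omega) (by decide)
    (fun hb => hb.2.2 _) ?_
  simp only [eval_load, eval_lit, State.mem_setReg, n0, n1, n2]
  refine Runs.assign_seq (T₀ + (τ + (260 + 5 * e)))
    (by simp only [Expr.cost, Expr.add, Expr.mul]; omega) (by decide)
    (fun _ => by simp; omega) ?_
  refine Runs.seq_le T₀ (τ + (260 + 5 * e)) _ le_rfl (hsel _ (by simp) (by simp) (by simp)) ?_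
  rintro σ₁ - ⟨h5, h6, h7, h8⟩
  have r0 : σ₁.reg 0 = 0 := by rw [h8 0 (by omega)]; simp [hreg]
  have r1 : σ₁.reg 1 = n := by rw [h8 1 (by omega)]; simp
  have r2 : σ₁.reg 2 = m := by rw [h8 2 (by omega)]; simp
  have r3 : σ₁.reg 3 = d := by rw [h8 3 (by omega)]; simp
  have r4 : σ₁.reg 4 = 4 * d + 6 := by rw [h8 4 (by omega)]; simp
  have rhigh : ∀ r, σ₁.reg (r + 50) = 0 := fun r => by
    rw [h8 _ (by omega)]
    simp only [State.reg_setReg]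
    rw [if_neg (by omega), if_neg (by omega), if_neg (by omega), if_neg (by omega), hreg]
  have rmem : ∀ y, σ₁.mem y = (encodeOV U V).getD y 0 := fun y => by rw [h7]; rfl
  have b1 : blockU d n' ≤ n' := Nat.div_le_self _ _
  have b2 : blockW d m' ≤ m' := (Nat.div_le_self _ _).trans (Nat.sub_le _ _)
  have e7 : eval σ₁ (div (var 5) (var 4)) = blockU d n' := by simp [h5, r4, blockU]
  refine Runs.assign_seq (τ + (250 + 5 * e)) (by simp only [Expr.cost, Expr.div]; omega)
    (by decide) (fun _ => by rw [e7]; omega) ?_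
  rw [e7]
  have e8 : eval (σ₁.setReg 7 (blockU d n')) (div (sub (var 6) (lit 8)) (var 4)) =
      blockW d m' := by simp [h6, r4, blockW]
  refine Runs.assign_seq (τ + (240 + 5 * e)) (by simp only [Expr.cost, Expr.div, Expr.sub]; omega)
    (by decide) (fun _ => by rw [e8]; omega) ?_
  rw [e8]
  have e11 : eval ((σ₁.setReg 7 (blockU d n')).setReg 8 (blockW d m'))
      (add (div (var 2) (var 8)) (lit 1)) = m / blockW d m' + 1 := by simp [r2]
  refine Runs.assign_seq (τ + (230 + 5 * e)) (by simp only [Expr.cost, Expr.div, Expr.add]; omega)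
    (by decide) (fun _ => by rw [e11]; omega) ?_
  rw [e11]
  have e10 : eval (((σ₁.setReg 7 (blockU d n')).setReg 8 (blockW d m')).setReg 11
      (m / blockW d m' + 1)) (mul (add (div (var 1) (var 7)) (lit 1)) (var 11)) =
      (n / blockU d n' + 1) * (m / blockW d m' + 1) := by simp [r1]
  refine Runs.assign_seq (τ + (220 + 5 * e))
    (by simp only [Expr.cost, Expr.div, Expr.add, Expr.mul]; omega)
    (by decide) (fun _ => by rw [e10]; omega) ?_
  rw [e10]
  refine Runs.assign_seq (τ + (210 + 5 * e))
    (by simp only [Expr.cost, Expr.add, Expr.mul]; omega)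
    (by decide) (fun _ => by simp [h5, h6]; omega) ?_
  refine Runs.seq_le (5 * e + 1) (τ + 200) _ (by omega)
    (Runs.powProg (y := 16 * (n' + m')) (by omega) (by simp [h5, h6]) e (by omega)) ?_
  rintro σ₂ - rfl
  refine Runs.assign_seq (τ + 190) (by simp only [Expr.cost]; omega)
    (by decide) (fun _ => by simp; omega) ?_
  refine Runs.assign_seq (τ + 170) (by simp only [Expr.cost, Expr.add, Expr.mul]; omega)
    (by decide) (fun _ => by simp [r1, r2, r3]; omega) ?_
  refine (Runs.callLoop (U := U) (V := V) (S := S) ⟨?_, ?_, ?_, ?_, ?_, ?_, ?_, ?_, ?_, ?_, ?_, ?_,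
    ?_, ?_, ?_⟩ hn hm hn1 hm1 hA hB hBS (by omega) hW).mono (by omega) fun _ _ h => h
  · simp [r0]
  · simp [r1]
  · simp [r2]
  · simp [r3]
  · simp [r4]
  · simp [h5]
  · simp [h6]
  · simp
  · simp
  · simp
  · simp
  · simp [hS]
  · simp [r1, r2, r3, hlen]
  · intro r; simp [rhigh]
  · exact rmem

end WordRAM

/-! ### The running time -/

/-- The full blocks number at most `4 * L * n / n'`, and the extra block is absorbed because `n' ≤ c
* n`. -/
lemma block_count_le {n n' u L c : ℕ} (hn' : 1 ≤ n') (hu : 1 ≤ u) (hL : 1 ≤ L)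
    (h : n' ≤ 4 * (L * u)) (hc : n' ≤ c * n) :
    ((n / u + 1 : ℕ) : ℝ) ≤ (4 + c) * L * n / n' := by
  have h0 : (0 : ℝ) < n' := by exact_mod_cast hn'
  have hu0 : (0 : ℝ) < u := by exact_mod_cast hu
  have hL1 : (1 : ℝ) ≤ L := by exact_mod_cast hL
  have h1 : ((n / u : ℕ) : ℝ) ≤ n / u := Nat.cast_div_le
  have h2 : (n' : ℝ) ≤ 4 * (L * u) := by exact_mod_cast h
  have h3 : (n' : ℝ) ≤ c * n := by exact_mod_cast hc
  have hn0 : (0 : ℝ) ≤ n := Nat.cast_nonneg n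
  have hc0 : (0 : ℝ) ≤ c * n := by positivity
  have h4 : (n : ℝ) / u ≤ 4 * L * n / n' := by
    rw [div_le_div_iff₀ hu0 h0]
    nlinarith
  have h5 : (1 : ℝ) ≤ c * L * n / n' := by
    rw [le_div_iff₀ h0]
    nlinarith
  push_cast
  calc ((n / u : ℕ) : ℝ) + 1 ≤ 4 * L * n / n' + c * L * n / n' := by linarith
    _ = _ := by ring

/-- The time for `X Y` calls of length `D`, for blocks of `a'` and `b'` of the `a` and `b` vectors. -/
lemma calls_time_le {a b a' b' c L R C X Y δ M D : ℝ} (ha : 1 ≤ a') (hb : 1 ≤ b')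
    (hδ : 0 < δ) (hδ1 : δ < 1) (hX : 0 ≤ X) (hY : 0 ≤ Y) (hR : 0 ≤ R) (hC : 0 ≤ C) (hL : 0 ≤ L)
    (hc : 0 ≤ c) (h0 : 0 ≤ a)
    (hXa : X ≤ c * L * a / a') (hYb : Y ≤ c * L * b / b')
    (hD : D ≤ R * (a' + b') + C * (a' * b') ^ (1 - δ)) (hM : 0 < M)
    (haM : M ≤ a' ^ δ) (hbM : M ≤ b' ^ δ) :
    D * (X * Y) ≤ c ^ 2 * (2 * R + C) * (a * b) * (L ^ 2 / M) := by
  have ha0 : 0 < a' := by linarith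
  have hb0 : 0 < b' := by linarith
  have h1 : ∀ z : ℝ, 1 ≤ z → M ≤ z ^ δ → 1 / z ≤ 1 / M := fun z hz h =>
    one_div_le_one_div_of_le hM (h.trans ((Real.rpow_le_rpow_of_exponent_le hz hδ1.le).trans
      (by rw [Real.rpow_one])))
  have h2 : (a' * b') ^ (1 - δ) ≤ a' * b' * (1 / M) := by
    rw [Real.rpow_sub (by positivity), Real.rpow_one, div_eq_mul_one_div]
    refine mul_le_mul_of_nonneg_left (one_div_le_one_div_of_le hM ?_) (by positivity)
    rw [Real.mul_rpow ha0.le hb0.le]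
    have : 1 ≤ b' ^ δ := Real.one_le_rpow hb hδ.le
    nlinarith [Real.rpow_nonneg ha0.le δ]
  have hM1 : 0 < 1 / M := by positivity
  -- The linear cost of writing an instance also gains the factor `1 / M`, as each of `a'` and `b'`
  -- is at least `M`.
  have h3 : a' + b' ≤ a' * b' * (2 * (1 / M)) := by
    have e1 : a' + b' = a' * b' * (1 / a' + 1 / b') := by field_simp; ring
    rw [e1]
    refine mul_le_mul_of_nonneg_left ?_ (by positivity)
    linarith [h1 a' ha haM, h1 b' hb hbM]
  have h4 : D ≤ (2 * R + C) * (a' * b') * (1 / M) := by nlinarith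
  have h5 : X * Y ≤ (c * L * a / a') * (c * L * b / b') :=
    mul_le_mul hXa hYb hY (by positivity)
  calc D * (X * Y) ≤ (2 * R + C) * (a' * b') * (1 / M) * ((c * L * a / a') * (c * L * b / b')) :=
        mul_le_mul h4 h5 (by positivity) (by positivity)
    _ = _ := by field_simp

/-- Powers of `n m` and of `n`, for `m = ⌈n ^ γ⌉`. -/
lemma mul_ceil_rpow_le {n m : ℕ} {γ δ s : ℝ} (hn : 1 ≤ n) (hγ : 0 < γ) (hm : m = ⌈(n : ℝ) ^ γ⌉₊)
    (hδ : 0 < δ) (hδ1 : δ ≤ 1) (hs : (1 + γ) * δ ≤ s) :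
    (n * m : ℝ) / (n : ℝ) ^ s ≤ 2 * (n * m : ℝ) ^ (1 - δ) := by
  have h1 : (1 : ℝ) ≤ n := by exact_mod_cast hn
  have hp : (1 : ℝ) ≤ (n : ℝ) ^ γ := Real.one_le_rpow h1 hγ.le
  have hm1 : (n : ℝ) ^ γ ≤ m := by rw [hm]; exact Nat.le_ceil _
  have hm2 : (m : ℝ) ≤ 2 * (n : ℝ) ^ γ := by
    have := (Nat.ceil_lt_add_one (by positivity : 0 ≤ (n : ℝ) ^ γ)).le
    rw [← hm] at this; linarith
  have h0 : (0 : ℝ) < n * m := by have : (0 : ℝ) < m := by linarith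
                                  positivity
  -- The product `n m` is at most `2 * n ^ (1 + γ)`; the factor 2 pays for the rounding in `m`.
  have h2 : (n * m : ℝ) ^ δ ≤ 2 * (n : ℝ) ^ s := by
    calc (n * m : ℝ) ^ δ ≤ (2 * (n : ℝ) ^ (1 + γ)) ^ δ := by
          refine Real.rpow_le_rpow h0.le ?_ hδ.le
          rw [Real.rpow_add (by linarith), Real.rpow_one]
          nlinarith
      _ = 2 ^ δ * (n : ℝ) ^ ((1 + γ) * δ) := by
          rw [Real.mul_rpow (by norm_num) (by positivity), ← Real.rpow_mul (by linarith)]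
      _ ≤ 2 * (n : ℝ) ^ s := by
          refine mul_le_mul ?_ (Real.rpow_le_rpow_of_exponent_le h1 hs) (by positivity) (by norm_num)
          calc (2 : ℝ) ^ δ ≤ 2 ^ (1 : ℝ) := Real.rpow_le_rpow_of_exponent_le (by norm_num) hδ1
            _ = 2 := Real.rpow_one 2
  rw [Real.rpow_sub h0, Real.rpow_one, ← mul_div_assoc, div_le_div_iff₀ (by positivity)
    (by positivity)]
  nlinarith

/-- Gadgets have logarithmic length, which is below any power `n ^ s` up to a constant. -/
lemma ceil_mul_log_le {n : ℕ} {ω s : ℝ} (hn : 1 ≤ n) (hω : 0 < ω) (hs : 0 < s) :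
    ((4 * ⌈ω * Real.log n⌉₊ + 6 : ℕ) : ℝ) ≤ (4 * ω / s + 10) * (n : ℝ) ^ s := by
  have h1 : (1 : ℝ) ≤ n := by exact_mod_cast hn
  have h2 := (Nat.ceil_lt_add_one (mul_nonneg hω.le (Real.log_nonneg h1))).le
  have h3 := Real.log_le_rpow_div (by linarith : (0 : ℝ) ≤ n) hs
  have h4 : (1 : ℝ) ≤ (n : ℝ) ^ s := Real.one_le_rpow h1 hs.le
  have h5 : ω * Real.log n ≤ ω / s * (n : ℝ) ^ s := by
    calc ω * Real.log n ≤ ω * ((n : ℝ) ^ s / s) := mul_le_mul_of_nonneg_left h3 hω.le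
      _ = _ := by ring
  push_cast
  have : 4 * ω / s = 4 * (ω / s) := by ring
  rw [this]
  nlinarith

/-! ### The reduction for given path lengths -/

open WordRAM

/-- Some program computes, from the size of an instance of the orthogonal vectors problem, lengths
`n'` and `m'` of paths for which the Fréchet distance is to be approximated. -/
def HasSelection (γ₀ ω γ ε : ℝ) : Prop :=
  ∃ (sel : Prog) (c e₀ : ℕ) (C : ℝ), ∀ n m d : ℕ, 1 ≤ n → m = ⌈(n : ℝ) ^ γ₀⌉₊ →
    d = ⌈ω * Real.log n⌉₊ → ∃ n' m' T₀ : ℕ, m' = ⌈(n' : ℝ) ^ γ⌉₊ ∧ 4 * d + 6 ≤ n' ∧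
      4 * d + 22 ≤ m' ∧ n' ≤ c * n ∧ m' ≤ c * m ∧ (n : ℝ) ^ ε ≤ C * n' ∧ (n : ℝ) ^ ε ≤ C * m' ∧
      (T₀ : ℝ) ≤ C * (n * m : ℝ) ^ (1 / 2 : ℝ) ∧
      ∀ W, (5 + n + m) ^ e₀ ≤ W → Selects W sel T₀ n m d n' m'

/-- If `f ≤ 4`, the output is at most `4 * c < 5`; if the output is below 5, so is `f`. -/
lemma approximates_of_runsWithin {A : Prog} {k : ℕ} {T c : ℝ} (hc : c < 5 / 4) {g : Gadget}
    (h : RunsWithin A k g.toPlanarPathPair.encode T fun s => ∃ f : ℕ,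
      g.toPlanarPathPair.frechet = f ∧ 0 < s.reg 1 ∧ (f : ℝ) ≤ (s.reg 0 : ℝ) / s.reg 1 ∧
        (s.reg 0 : ℝ) / s.reg 1 ≤ c * f) :
    Approximates A ((g.output.length + 2) ^ k) ⌊T⌋₊ g := by
  rw [g.encode_eq_output] at h
  obtain ⟨t, s, hE, ht, f, hf, h1, h2, h3⟩ := h
  refine ⟨t, s, f, hE, Nat.le_floor ht, hf, ?_⟩
  have h1' : (0 : ℝ) < s.reg 1 := by exact_mod_cast h1
  constructor
  · intro h
    have h' : (s.reg 0 : ℝ) < 5 * s.reg 1 := by exact_mod_cast h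
    have : (s.reg 0 : ℝ) / s.reg 1 < 5 := (div_lt_iff₀ h1').2 h'
    exact_mod_cast h2.trans_lt this
  · intro h
    have h4 : (f : ℝ) ≤ 4 := by exact_mod_cast Nat.lt_succ_iff.1 h
    have h0 : (0 : ℝ) ≤ f := Nat.cast_nonneg f
    have : (s.reg 0 : ℝ) / s.reg 1 < 5 := by
      rcases h0.eq_or_lt with h0 | h0
      · rw [← h0, mul_zero] at h3; linarith
      · nlinarith
    have := (div_lt_iff₀ h1').1 this
    exact_mod_cast this

lemma Runs.runsWithin {W T k : ℕ} {P : Prog} {x : List ℕ} {post : State → Prop}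
    (h : Runs W P T (initState x) post) (h16 : 16 ≤ W) (hx : ∀ y ∈ x, y ≤ W)
    (hW : W ^ 100 < (x.length + 2) ^ k) {T' : ℝ} (hT : (T : ℝ) ≤ T')
    (hpost : ∀ s σ, Sim s σ → post σ → post s) : RunsWithin P k x T' post := by
  have hb : Bounded W (initState x) := by
    refine ⟨h16, fun _ _ => Nat.zero_le _, fun y => ?_⟩
    simp only [initState]
    rcases lt_or_ge y x.length with hy | hy
    · rw [List.getD_eq_getElem _ _ hy]
      exact hx _ (List.getElem_mem hy)
    · rw [List.getD_eq_default _ _ hy]; exact Nat.zero_le _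
  obtain ⟨t, s', σ', h1, h2, h3, -, h5⟩ := h hb _ hW _ (Sim.refl _)
  exact ⟨t, s', h1, le_trans (by exact_mod_cast h2) hT, hpost _ _ h3 h5⟩

/-- The word size suffices. -/
lemma word_bound {n m d n' m' c e l N : ℕ} (hn : 1 ≤ n) (hm : 1 ≤ m)
    (hn' : n' ≤ c * n) (hm' : m' ≤ c * m) (hl : l = 3 + (n + m) * d)
    (hd : n = 1 ∧ m = 1 ∨ 1 ≤ d) (hN : N ≤ (n + 1) * (m + 1)) :
    l + N * (16 * (n' + m')) ^ e ≤ (l + 2) ^ (5 + (16 * c + 2) * e) := by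
  -- Without coordinates the input has only three words, but then `n = m = 1`.
  have hZ : n + m ≤ l + 2 := by
    rcases hd with ⟨rfl, rfl⟩ | hd
    · omega
    · nlinarith
  have hZ5 : 5 ≤ l + 2 := by omega
  set Z := l + 2 with hZdef
  have hN' : N ≤ Z ^ 4 := by
    have h2 : (n + 1) * (m + 1) ≤ (Z * Z) * (Z * Z) := Nat.mul_le_mul (by nlinarith) (by nlinarith)
    calc N ≤ _ := hN
      _ ≤ _ := h2
      _ = Z ^ 4 := by ring
  -- Constants go into the exponent, since word bounds have the form `Z ^ k`.
  have hc : 16 * c ≤ Z ^ (16 * c) := by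
    calc 16 * c ≤ 2 ^ (16 * c) := Nat.lt_two_pow_self.le
      _ ≤ Z ^ (16 * c) := Nat.pow_le_pow_left (by omega) _
  have hS : (16 * (n' + m')) ^ e ≤ Z ^ ((16 * c + 2) * e) := by
    rw [pow_mul]
    refine Nat.pow_le_pow_left ?_ e
    calc 16 * (n' + m') ≤ 16 * c * (n + m) := by nlinarith
      _ ≤ Z ^ (16 * c) * Z ^ 2 := Nat.mul_le_mul hc (by nlinarith)
      _ = _ := (pow_add _ _ _).symm
  have hX : N * (16 * (n' + m')) ^ e ≤ Z ^ (4 + (16 * c + 2) * e) := by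
    rw [pow_add]; exact Nat.mul_le_mul hN' hS
  have hpos : 1 ≤ Z ^ (4 + (16 * c + 2) * e) := Nat.one_le_pow _ _ (by omega)
  calc l + N * (16 * (n' + m')) ^ e ≤ Z ^ (4 + (16 * c + 2) * e) * Z := by
        have hl' : l + 2 = Z := rfl
        nlinarith
    _ = Z ^ (5 + (16 * c + 2) * e) := by rw [← pow_succ]; ring_nf

/-- The constant in the bound on the running time. -/
noncomputable def timeConst (ω s δ C C₁ : ℝ) (c R : ℕ) : ℝ :=
  ((4 + c : ℝ) ^ 2 * (2 * (1150 + R) + 2 * |C|)) * ((4 * ω / s + 10) ^ 2 * (max C₁ 1) ^ δ) * 2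

/-- Cutting into blocks costs `L ^ 2`, of order at most `n ^ (2 * s)`; the calls save `M`, of order
`n ^ (ε * δ) = n ^ (4 * s)`. The net gain `n ^ (2 * s)` covers `(n m) ^ δ'`. -/
lemma total_time_le {n m d n' m' u w c R T T₀ K : ℕ} {γ₀ ω ε δ δ' s C C₁ : ℝ} (hγ₀ : 0 < γ₀)
    (hω : 0 < ω) (hs0 : 0 < s) (hδ : 0 < δ) (hδ1 : δ < 1) (hδ'0 : 0 < δ') (hδ'2 : δ' ≤ 1 / 2)
    (hδ's : (1 + γ₀) * δ' ≤ 2 * s) (hs : s = ε * δ / 4) (hn : 1 ≤ n) (hm : m = ⌈(n : ℝ) ^ γ₀⌉₊)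
    (hd : d = ⌈ω * Real.log n⌉₊) (hn' : 1 ≤ n') (hm' : 1 ≤ m') (hu : 1 ≤ u) (hw : 1 ≤ w)
    (hu4 : n' ≤ 4 * ((4 * d + 6) * u)) (hw4 : m' ≤ 4 * ((4 * d + 6) * w))
    (g4 : n' ≤ c * n) (g5 : m' ≤ c * m) (g6 : (n : ℝ) ^ ε ≤ C₁ * n') (g7 : (n : ℝ) ^ ε ≤ C₁ * m')
    (g8 : (T₀ : ℝ) ≤ C₁ * (n * m : ℝ) ^ (1 / 2 : ℝ)) (hT : T = ⌊C * ((n' : ℝ) * m') ^ (1 - δ)⌋₊) :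
    ((T₀ + ((150 + 1000 * (n' + m') + R + 2 * T) * ((n / u + 1) * (m / w + 1)) + K) : ℕ) : ℝ) ≤
      (max C₁ 0 + timeConst ω s δ C C₁ c R + K) * (n * m : ℝ) ^ (1 - δ') := by
  have hn1 : (1 : ℝ) ≤ n := by exact_mod_cast hn
  have hm1 : 1 ≤ m := by
    rw [hm, Nat.one_le_ceil_iff]; positivity
  have hm1' : (1 : ℝ) ≤ m := by exact_mod_cast hm1
  have hnm : (1 : ℝ) ≤ n * m := one_le_mul_of_one_le_of_one_le hn1 hm1'
  have hn'1 : (1 : ℝ) ≤ n' := by exact_mod_cast hn'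
  have hm'1 : (1 : ℝ) ≤ m' := by exact_mod_cast hm'
  have hXle := block_count_le (n := n) (c := c) hn' hu (by omega) hu4 g4
  have hYle := block_count_le (n := m) (c := c) hm' hw (by omega) hw4 g5
  generalize n / u + 1 = X at hXle ⊢
  generalize m / w + 1 = Y at hYle ⊢
  have hLs : ((4 * d + 6 : ℕ) : ℝ) ≤ (4 * ω / s + 10) * (n : ℝ) ^ s := by
    rw [hd]; exact ceil_mul_log_le hn hω hs0
  have hL0 : (0 : ℝ) ≤ ((4 * d + 6 : ℕ) : ℝ) := Nat.cast_nonneg _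
  generalize ((4 * d + 6 : ℕ) : ℝ) = L at hXle hYle hLs hL0
  have hC1 : 0 < max C₁ 1 := lt_of_lt_of_le one_pos (le_max_right _ _)
  obtain ⟨M, hM⟩ : ∃ M, M = ((n : ℝ) ^ ε / max C₁ 1) ^ δ := ⟨_, rfl⟩
  have hM0 : 0 < M := by rw [hM]; positivity
  have hMle : ∀ z : ℝ, 1 ≤ z → (n : ℝ) ^ ε ≤ C₁ * z → M ≤ z ^ δ := fun z hz h => by
    rw [hM]
    refine Real.rpow_le_rpow (by positivity) ?_ hδ.le
    rw [div_le_iff₀ hC1]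
    nlinarith [le_max_left C₁ 1]
  have hTle : (T : ℝ) ≤ |C| * ((n' : ℝ) * m') ^ (1 - δ) := by
    have hpow : 0 ≤ ((n' : ℝ) * m') ^ (1 - δ) := by positivity
    rcases le_or_gt 0 (C * ((n' : ℝ) * m') ^ (1 - δ)) with h | h
    · rw [hT]
      exact (Nat.floor_le h).trans (mul_le_mul_of_nonneg_right (le_abs_self C) hpow)
    · rw [hT, Nat.floor_of_nonpos h.le]; push_cast; positivity
  have hR : (0 : ℝ) ≤ R := Nat.cast_nonneg _
  have htime := calls_time_le (a := n) (b := m) (a' := n') (b' := m') (c := 4 + c) (L := L)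
    (R := 1150 + R) (C := 2 * |C|) (X := X) (Y := Y) (δ := δ) (M := M)
    (D := 150 + 1000 * (n' + m') + R + 2 * T) hn'1 hm'1 hδ hδ1 (Nat.cast_nonneg _)
    (Nat.cast_nonneg _) (by positivity) (by positivity) hL0 (by positivity) (by positivity)
    hXle hYle (by nlinarith) hM0 (hMle _ hn'1 g6) (hMle _ hm'1 g7)
  have hLM : L ^ 2 / M ≤ (4 * ω / s + 10) ^ 2 * (max C₁ 1) ^ δ / (n : ℝ) ^ (2 * s) := by
    have e1 : M = (n : ℝ) ^ (4 * s) / (max C₁ 1) ^ δ := by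
      rw [hM, Real.div_rpow (by positivity) hC1.le, ← Real.rpow_mul (by positivity), hs]
      ring_nf
    have e2 : (n : ℝ) ^ (4 * s) = (n : ℝ) ^ (2 * s) * (n : ℝ) ^ (2 * s) := by
      rw [← Real.rpow_add (by linarith)]; ring_nf
    have e3 : (n : ℝ) ^ (2 * s) = ((n : ℝ) ^ s) ^ 2 := by
      rw [← Real.rpow_natCast, ← Real.rpow_mul (by positivity)]; push_cast; ring_nf
    have e4 : L ^ 2 ≤ (4 * ω / s + 10) ^ 2 * (n : ℝ) ^ (2 * s) := by
      rw [e3, ← mul_pow]; exact pow_le_pow_left₀ hL0 hLs 2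
    have hp : 0 < (n : ℝ) ^ (2 * s) := by positivity
    have hC1p : 0 < (max C₁ 1) ^ δ := Real.rpow_pos_of_pos hC1 δ
    rw [div_le_div_iff₀ hM0 hp, e1, e2]
    calc L ^ 2 * (n : ℝ) ^ (2 * s) ≤
        (4 * ω / s + 10) ^ 2 * (n : ℝ) ^ (2 * s) * (n : ℝ) ^ (2 * s) :=
          mul_le_mul_of_nonneg_right e4 hp.le
      _ = _ := by field_simp
  have hcalls : (150 + 1000 * (n' + m' : ℝ) + R + 2 * T) * (X * Y) ≤
      timeConst ω s δ C C₁ c R * (n * m : ℝ) ^ (1 - δ') := by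
    refine htime.trans ?_
    unfold timeConst
    have hK₁ : 0 ≤ (4 + c : ℝ) ^ 2 * (2 * (1150 + R) + 2 * |C|) := by positivity
    have hK₂ : 0 ≤ (4 * ω / s + 10) ^ 2 * (max C₁ 1) ^ δ :=
      mul_nonneg (sq_nonneg _) (Real.rpow_nonneg hC1.le δ)
    generalize (4 + c : ℝ) ^ 2 * (2 * (1150 + R) + 2 * |C|) = K₁ at hK₁ ⊢
    generalize (4 * ω / s + 10) ^ 2 * (max C₁ 1) ^ δ = K₂ at hK₂ hLM ⊢
    calc K₁ * (n * m) * (L ^ 2 / M)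
        ≤ K₁ * (n * m) * (K₂ / (n : ℝ) ^ (2 * s)) :=
          mul_le_mul_of_nonneg_left hLM (by positivity)
      _ = K₁ * K₂ * ((n * m : ℝ) / (n : ℝ) ^ (2 * s)) := by ring
      _ ≤ K₁ * K₂ * (2 * (n * m : ℝ) ^ (1 - δ')) :=
          mul_le_mul_of_nonneg_left (mul_ceil_rpow_le hn hγ₀ hm hδ'0 (by linarith) hδ's)
            (by positivity)
      _ = _ := by ring
  have hone : (1 : ℝ) ≤ (n * m : ℝ) ^ (1 - δ') := Real.one_le_rpow hnm (by linarith)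
  have hT₀ : (T₀ : ℝ) ≤ max C₁ 0 * (n * m : ℝ) ^ (1 - δ') :=
    g8.trans (mul_le_mul (le_max_left _ _)
      (Real.rpow_le_rpow_of_exponent_le hnm (by linarith)) (by positivity) (le_max_right _ _))
  -- The fixed overhead is charged to `(n m) ^ (1 - δ') ≥ 1`.
  have hk : (K : ℝ) ≤ K * (n * m : ℝ) ^ (1 - δ') :=
    le_mul_of_one_le_right (Nat.cast_nonneg _) hone
  push_cast
  linarith

/-- The bound `1 / 2` on the exponent leaves room for the time of the selection. The new exponent
does not depend on `ω`, as the order of quantifiers in `OVHAt` demands. -/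
theorem ovSolvable_of_selection {γ₀ ω γ ε δ c : ℝ} (hγ₀ : 0 < γ₀) (hω : 0 < ω) (hε : 0 < ε)
    (hδ : 0 < δ) (hδ1 : δ < 1) (hc : c < 5 / 4) (hsel : HasSelection γ₀ ω γ ε)
    (hF : FrechetApproximable 3 γ δ c) :
    OVSolvable ω γ₀ (min (1 / 2) (ε * δ / (2 * (1 + γ₀)))) := by
  obtain ⟨A, k, C, hA⟩ := hF
  obtain ⟨sel, c₀, e₀, C₁, hsel⟩ := hsel
  set δ' := min (1 / 2) (ε * δ / (2 * (1 + γ₀))) with hδ'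
  have hδ'0 : 0 < δ' := by rw [hδ']; positivity
  have hδ'2 : δ' ≤ 1 / 2 := min_le_left _ _
  set s := ε * δ / 4 with hs
  have hs0 : 0 < s := by positivity
  have hδ's : (1 + γ₀) * δ' ≤ 2 * s := by
    have : δ' ≤ ε * δ / (2 * (1 + γ₀)) := min_le_right _ _
    calc (1 + γ₀) * δ' ≤ (1 + γ₀) * (ε * δ / (2 * (1 + γ₀))) :=
          mul_le_mul_of_nonneg_left this (by positivity)
      _ = 2 * s := by rw [hs]; field_simp; ring
  -- Room for the memory windows, for the powers computed by the selection, and for the input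
  -- numbers. The word exponent is then `100 * k₁ + 1`, because expressions may reach `W ^ 100`.
  set k₁ := 5 + (16 * c₀ + 2) * (k + 1) + 2 * e₀ + 2 with hk₁
  refine ⟨solveProg A sel (k + 1), 100 * k₁ + 1,
    max C₁ 0 + timeConst ω s δ C C₁ c₀ A.maxReg + (300 + 5 * (k + 1) : ℕ), fun n m d hn hm hd U V => ?_⟩
  obtain ⟨n', m', T₀, g1, g2, g3, g4, g5, g6, g7, g8, g9⟩ := hsel n m d hn hm hd
  have hn1 : (1 : ℝ) ≤ n := by exact_mod_cast hn
  have hm1 : 1 ≤ m := by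
    rw [hm, Nat.one_le_ceil_iff]; positivity
  have hm1' : (1 : ℝ) ≤ m := by exact_mod_cast hm1
  have hnm : (1 : ℝ) ≤ n * m := one_le_mul_of_one_le_of_one_le hn1 hm1'
  have hlen := length_encodeOV U V
  set l := (encodeOV U V).length with hl
  have hd1 : n = 1 ∧ m = 1 ∨ 1 ≤ d := by
    rcases Nat.lt_or_ge 1 n with h | h
    · right
      rw [hd, Nat.one_le_ceil_iff]
      exact mul_pos hω (Real.log_pos (by exact_mod_cast h))
    · left
      obtain rfl : n = 1 := by omega
      exact ⟨rfl, by rw [hm]; simp⟩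
  set T := ⌊C * ((n' : ℝ) * m') ^ (1 - δ)⌋₊ with hT
  -- `9 * (n' + m') - 12` is the length of the instance plus 2, the base of the word bound for `A`.
  have happ : ∀ i, Approximates A ((9 * (n' + m') - 12) ^ k) T
      (callGadget U V g2 (by omega : 4 * d + 14 ≤ m') i) := fun i => by
    set g := callGadget U V g2 (by omega : 4 * d + 14 ≤ m') i with hg
    have h1 := approximates_of_runsWithin hc (hA g.toPlanarPathPair g1 ?_)
    · have e : g.output.length + 2 = 9 * (n' + m') - 12 := by
        have h2 := g.length_output
        have h3 : g.n = n' := rfl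
        have h4 : g.m = m' := rfl
        omega
      rw [e] at h1
      exact h1
    · show 3 * (n' + (m' - 2)) + 2 ≤ 3 * (n' + m')
      omega
  have hu : 1 ≤ blockU d n' := (Nat.one_le_div_iff (by omega)).2 g2
  have hw : 1 ≤ blockW d m' := (Nat.one_le_div_iff (by omega)).2 (by omega)
  have hu4 : n' ≤ 4 * ((4 * d + 6) * blockU d n') := by
    have h1 := Nat.div_add_mod n' (4 * d + 6)
    have h2 := Nat.mod_lt n' (show 4 * d + 6 > 0 by omega)
    have h3 : 4 * d + 6 ≤ (4 * d + 6) * blockU d n' := Nat.le_mul_of_pos_right _ hu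
    unfold blockU at *
    omega
  have hw4 : m' ≤ 4 * ((4 * d + 6) * blockW d m') := by
    have h1 := Nat.div_add_mod (m' - 8) (4 * d + 6)
    have h2 := Nat.mod_lt (m' - 8) (show 4 * d + 6 > 0 by omega)
    have h3 : 4 * d + 6 ≤ (4 * d + 6) * blockW d m' := Nat.le_mul_of_pos_right _ hw
    unfold blockW at *
    omega
  have hZ5 : 5 ≤ l + 2 := by omega
  have hwords : l + (n / blockU d n' + 1) * (m / blockW d m' + 1) * (16 * (n' + m')) ^ (k + 1) ≤
      (l + 2) ^ (5 + (16 * c₀ + 2) * (k + 1)) :=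
    word_bound hn hm1 g4 g5 hlen hd1 (Nat.mul_le_mul (Nat.succ_le_succ (Nat.div_le_self _ _))
      (Nat.succ_le_succ (Nat.div_le_self _ _)))
  have hW : ∀ a ≤ k₁, (l + 2) ^ a ≤ (l + 2) ^ k₁ := fun a ha => Nat.pow_le_pow_right (by omega) ha
  have hsq : 25 ≤ (l + 2) ^ 2 := by nlinarith
  have hsum : 5 + n + m ≤ (l + 2) ^ 2 := by
    rcases hd1 with ⟨rfl, rfl⟩ | hd1
    · omega
    · have : n + m ≤ (n + m) * d := Nat.le_mul_of_pos_right _ hd1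
      nlinarith
  have hruns := Runs.solveProg (A := A) (U := U) (V := V) (W := (l + 2) ^ k₁) (e := k + 1)
    (g9 ((l + 2) ^ k₁) (le_trans (Nat.pow_le_pow_left hsum e₀)
      (by rw [← pow_mul]; exact hW _ (by omega)))) g2 (by omega) hn hm1 (by omega) happ
    (by have : 0 < 9 * (n' + m') - 12 := by omega
        positivity)
    (le_trans (Nat.pow_le_pow_left (by omega) k) (Nat.pow_le_pow_right (by omega) (Nat.le_succ k)))
    (hwords.trans (hW _ (by omega)))
  refine Runs.runsWithin hruns ((by omega : 16 ≤ (l + 2) ^ 2).trans (hW 2 (by omega)))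
    (fun y hy => ?_) ?_ ?_ ?_
  · have h1 := mem_encodeOV_le U V hy
    have h2 : d ≤ (n + m) * d := Nat.le_mul_of_pos_left _ (by omega)
    have h3 : l + 2 ≤ (l + 2) ^ 2 := Nat.le_self_pow (by omega) _
    refine le_trans ?_ (hW 2 (by omega))
    omega
  · rw [← pow_mul]
    exact Nat.pow_lt_pow_right (by omega) (by omega)
  · exact total_time_le hγ₀ hω hs0 hδ hδ1 hδ'0 hδ'2 hδ's hs hn hm hd (by omega) (by omega) hu hw hu4
      hw4 g4 g5 g6 g7 g8 rfl
  · intro s' σ' h h'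
    rw [h.2 0 (by decide)]
    exact h'

open WordRAM

/-! ### Choosing the lengths of the paths -/

/-- The constant is one more than the required 22, because an integer root `t` is only known to
satisfy `n ^ ε ≤ t + 1`. -/
lemma exists_log_le_rpow {ω ε : ℝ} (hω : 0 < ω) (hε : 0 < ε) :
    ∃ N : ℕ, 1 ≤ N ∧ ∀ n : ℕ, N ≤ n → ((4 * ⌈ω * Real.log n⌉₊ + 23 : ℕ) : ℝ) ≤ (n : ℝ) ^ ε := by
  have h := ((tendsto_rpow_atTop (half_pos hε)).comp tendsto_natCast_atTop_atTop).eventually_ge_atTop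
    (4 * ω / (ε / 2) + 10 + 17)
  obtain ⟨N, hN⟩ := Filter.eventually_atTop.1 h
  refine ⟨max N 1, le_max_right _ _, fun n hn => ?_⟩
  have hn1 : 1 ≤ n := le_of_max_le_right hn
  have h1 := hN n (le_of_max_le_left hn)
  simp only [Function.comp_apply] at h1
  have h2 := ceil_mul_log_le hn1 hω (half_pos hε)
  have h3 : (1 : ℝ) ≤ (n : ℝ) ^ (ε / 2) := Real.one_le_rpow (by exact_mod_cast hn1) (by positivity)
  have h4 : (n : ℝ) ^ ε = (n : ℝ) ^ (ε / 2) * (n : ℝ) ^ (ε / 2) := by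
    rw [← Real.rpow_add (by exact_mod_cast hn1)]; ring_nf
  rw [h4]
  push_cast at h2 ⊢
  nlinarith

lemma ceil_log_mono {ω : ℝ} (hω : 0 < ω) {n N : ℕ} (hn : 1 ≤ n) (h : n ≤ N) :
    ⌈ω * Real.log n⌉₊ ≤ ⌈ω * Real.log N⌉₊ :=
  Nat.ceil_mono (mul_le_mul_of_nonneg_left
    (Real.log_le_log (by exact_mod_cast hn) (by exact_mod_cast h)) hω.le)

lemma one_le_ceil_rpow {n : ℕ} {γ : ℝ} (hn : 1 ≤ n) : 1 ≤ ⌈(n : ℝ) ^ γ⌉₊ := by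
  rw [Nat.one_le_ceil_iff]; positivity

namespace WordRAM

open WordRAM.Expr

/-- Lengths `n` and `m`, but `N` and `M` if `n < N`. -/
def selectMax (N M : ℕ) : Prog :=
  .seq (.const 5 N) (.seq (.const 6 M)
    (branch (lt (var 1) (var 5)) .skip (.seq (assign 5 (var 1)) (assign 6 (var 2)))))

lemma selects_selectMax {W N M n m d : ℕ} (hN : N ≤ W) (hM : M ≤ W) :
    Selects W (selectMax N M) 20 n m d (if n < N then N else n) (if n < N then M else m) := by
  intro σ h1 h2 _
  refine Runs.seq_le 1 19 _ le_rfl (Runs.const 5 N hN (post := fun s => s = σ.setReg 5 N) rfl)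
    fun _ _ h => ?_
  subst h
  refine Runs.seq_le 1 18 _ le_rfl (Runs.const 6 M hM
    (post := fun s => s = (σ.setReg 5 N).setReg 6 M) rfl) fun _ hb h => ?_
  subst h
  have ev : eval ((σ.setReg 5 N).setReg 6 M) (lt (var 1) (var 5)) = if n < N then 1 else 0 := by
    simp [h1]
  have hfr : ∀ r, r < 5 ∨ 50 ≤ r → r ≠ 5 ∧ r ≠ 6 := fun r hr => by omega
  refine Runs.branch_le 14 (by decide) (by decide) (fun hne => ?_) fun h0 => ?_
  · have hlt : n < N := by
      by_contra hc; rw [ev, if_neg hc] at hne; exact hne rfl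
    rw [if_pos hlt, if_pos hlt]
    refine (Runs.skip ⟨by simp, by simp, rfl, fun r hr => ?_⟩).mono (by omega) fun _ _ h => h
    simp [hfr r hr]
  · have hlt : ¬ n < N := by
      intro hc; rw [ev, if_pos hc] at h0; exact one_ne_zero h0
    rw [if_neg hlt, if_neg hlt]
    refine Runs.assign_seq 10 (by decide) (by decide) (fun hb => hb.2.1 1 (by decide)) ?_
    refine (Runs.assign (by decide) (fun hb => hb.2.1 2 (by decide)) ⟨?_, ?_, rfl,
      fun r hr => ?_⟩).mono (by decide) fun _ _ h => h
    · simp [h1]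
    · simp [h2]
    · simp [hfr r hr]

end WordRAM

/-- For large `n` the lengths `n` and `m` themselves leave room for a gadget. Below the threshold
`N` the lengths are the fixed pair `N`, `M`, long enough since the dimension grows with `n`. -/
theorem hasSelection_same {γ ω : ℝ} (hγ : 0 < γ) (hω : 0 < ω) :
    HasSelection γ ω γ (min 1 γ) := by
  obtain ⟨N, hN1, hN⟩ := exists_log_le_rpow hω (lt_min one_pos hγ)
  set M := ⌈(N : ℝ) ^ γ⌉₊ with hM
  have large : ∀ n : ℕ, N ≤ n → 4 * ⌈ω * Real.log n⌉₊ + 23 ≤ n ∧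
      4 * ⌈ω * Real.log n⌉₊ + 23 ≤ ⌈(n : ℝ) ^ γ⌉₊ := fun n hn => by
    have h1 : (1 : ℝ) ≤ n := by exact_mod_cast hN1.trans hn
    constructor
    · have := (hN n hn).trans (Real.rpow_le_rpow_of_exponent_le h1 (min_le_left _ _))
      rw [Real.rpow_one] at this
      exact_mod_cast this
    · exact_mod_cast ((hN n hn).trans
        (Real.rpow_le_rpow_of_exponent_le h1 (min_le_right _ _))).trans (Nat.le_ceil _)
  refine ⟨selectMax N M, N + M + 1, N + M, 20, fun n m d hn hm hd =>
    ⟨if n < N then N else n, if n < N then M else m, 20, ?_⟩⟩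
  have hn1 : (1 : ℝ) ≤ n := by exact_mod_cast hn
  have hm1 : 1 ≤ m := by rw [hm]; exact one_le_ceil_rpow hn
  have hp1 : (n : ℝ) ^ (min 1 γ) ≤ n := by
    simpa using Real.rpow_le_rpow_of_exponent_le hn1 (min_le_left 1 γ)
  have hp2 : (n : ℝ) ^ (min 1 γ) ≤ (n : ℝ) ^ γ :=
    Real.rpow_le_rpow_of_exponent_le hn1 (min_le_right 1 γ)
  have hT : ((20 : ℕ) : ℝ) ≤ 20 * (n * m : ℝ) ^ (1 / 2 : ℝ) := by
    have : (1 : ℝ) ≤ (n * m : ℝ) ^ (1 / 2 : ℝ) := Real.one_le_rpow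
      (one_le_mul_of_one_le_of_one_le hn1 (by exact_mod_cast hm1)) (by norm_num)
    push_cast; linarith
  -- `N` and `M` are literals of the program and have to fit into words even for the smallest
  -- inputs.
  have hWs : ∀ W, (5 + n + m) ^ (N + M) ≤ W → N ≤ W ∧ M ≤ W := fun W hW => by
    have : N + M < (5 + n + m) ^ (N + M) := Nat.lt_pow_self (by omega)
    omega
  refine ⟨?_, ?_, ?_, ?_, ?_, ?_, ?_, hT, fun W hW => selects_selectMax (hWs W hW).1 (hWs W hW).2⟩
  · split_ifs <;> assumption
  · split_ifs with h
    · have := (large N le_rfl).1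
      have := ceil_log_mono hω hn h.le
      omega
    · have := (large n (by omega)).1
      omega
  · split_ifs with h
    · have := (large N le_rfl).2
      have := ceil_log_mono hω hn h.le
      omega
    · have := (large n (by omega)).2
      omega
  · split_ifs <;> nlinarith
  · split_ifs <;> nlinarith
  · split_ifs with h
    · have : (n : ℝ) ≤ N := by exact_mod_cast h.le
      linarith
    · linarith
  · split_ifs with h
    · have h1 : (n : ℝ) ^ γ ≤ (N : ℝ) ^ γ :=
        Real.rpow_le_rpow (by linarith) (by exact_mod_cast h.le) hγ.le
      have h2 : (N : ℝ) ^ γ ≤ M := Nat.le_ceil _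
      have h3 : (0 : ℝ) ≤ M := Nat.cast_nonneg _
      linarith
    · have h2 : (n : ℝ) ^ γ ≤ m := by rw [hm]; exact Nat.le_ceil _
      have h3 : (0 : ℝ) ≤ m := Nat.cast_nonneg _
      linarith

/-! ### Path lengths for a rational exponent -/

open WordRAM

/-- Starting from `t`, increase the number up to `k` times as long as its power is at most `m`. -/
def climb (q m t : ℕ) : ℕ → ℕ
  | 0 => t
  | k + 1 => if (climb q m t k + 1) ^ q ≤ m then climb q m t k + 1 else climb q m t k

lemma climb_spec {q m t : ℕ} : ∀ k, t ≤ climb q m t k ∧ climb q m t k ≤ t + k ∧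
    (climb q m t k = t ∨ climb q m t k ^ q ≤ m) ∧
    (m < (climb q m t k + 1) ^ q ∨ climb q m t k = t + k)
  | 0 => ⟨le_rfl, le_rfl, .inl rfl, .inr rfl⟩
  | k + 1 => by
    obtain ⟨h1, h2, h3, h4⟩ := climb_spec (q := q) (m := m) (t := t) k
    rw [climb]
    split_ifs with h
    · exact ⟨by omega, by omega, .inr h, .inr (by omega)⟩
    · exact ⟨h1, by omega, h3, .inl (by omega)⟩

/-- A search that succeeds in all `m` rounds ends at `t + m`, whose successor exceeds `m` even
before taking powers. -/
lemma lt_climb_succ_pow {q m t : ℕ} (hq : 1 ≤ q) : m < (climb q m t m + 1) ^ q := by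
  obtain ⟨-, -, -, h | h⟩ := climb_spec (q := q) (m := m) (t := t) m
  · exact h
  · have := Nat.le_self_pow (show q ≠ 0 by omega) (climb q m t m + 1)
    omega

namespace WordRAM

open WordRAM.Expr

/-- Compute the lengths `t ^ b` and `t ^ a`, where `t` is the largest number with
`t ^ (a + b) ≤ m`, but at least `t₀`. -/
def selectPow (a b t₀ : ℕ) : Prog :=
  .seq (.const 26 t₀)
    (.seq (forLoop 15 (var 2) (.seq (assign 25 (add (var 26) (lit 1))) (.seq (powProg (a + b))
        (branch (lt (var 2) (var 24)) .skip (assign 26 (var 25))))))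
      (.seq (assign 25 (var 26)) (.seq (powProg b) (.seq (assign 5 (var 24))
        (.seq (powProg a) (assign 6 (var 24)))))))

lemma selects_selectPow {W a b t₀ n m d : ℕ} (ht₀ : 1 ≤ t₀) (ha : 1 ≤ a) (hb : 1 ≤ b)
    (hW : (t₀ + m + 1) ^ (a + b) ≤ W) :
    Selects W (selectPow a b t₀) ((5 * (a + b) + 100) * (m + 1)) n m d
      (climb (a + b) m t₀ m ^ b) (climb (a + b) m t₀ m ^ a) := by
  intro σ h1 h2 _
  set q := a + b with hq
  have hself : t₀ + m + 1 ≤ (t₀ + m + 1) ^ q := Nat.le_self_pow (by omega) _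
  have hmul : (5 * q + 100) * (m + 1) = (5 * q + 50 + (10 + 10)) * m + (10 + 10) +
      (30 * m + 5 * q + 80) := by ring
  refine Runs.seq_le 1 ((5 * q + 100) * (m + 1) - 1) _ (by omega)
    (Runs.const 26 t₀ (by omega) (post := fun s => s = σ.setReg 26 t₀) rfl) fun _ _ h => ?_
  subst h
  refine Runs.seq_le ((5 * q + 50 + (10 + 10)) * m + (10 + 10)) (30 * m + 5 * q + 79)
    (fun σ' => σ'.reg 26 = climb q m t₀ m ∧ σ'.mem = σ.mem ∧
      ∀ r, r < 5 ∨ 50 ≤ r → σ'.reg r = σ.reg r) (by omega) ?_ ?_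
  · refine Runs.forLoop (fun k σ' => (σ'.reg 26 = climb q m t₀ k ∧ σ'.mem = σ.mem ∧
      ∀ r, r < 5 ∨ 50 ≤ r → σ'.reg r = σ.reg r) ∧ σ'.reg 15 = k) (by omega) (by decide) (by decide)
      ⟨⟨by simp [climb], rfl, fun r hr => ?_⟩, by simp⟩ (fun k _ σ' h => ⟨h.2, ?_⟩) (by omega)
      (fun k hk σ' h => ?_) fun σ' h => h.1
    · simp [show r ≠ 15 by omega, show r ≠ 26 by omega]
    · rw [eval_var, h.1.2.2 2 (by omega), h2]
    · obtain ⟨⟨h26, hmem, hfr⟩, h15⟩ := h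
      obtain ⟨c1, c2, -, -⟩ := climb_spec (q := q) (m := m) (t := t₀) k
      set t := climb q m t₀ k with ht
      have hle : (t + 1) ^ q ≤ W := (Nat.pow_le_pow_left (by omega) q).trans hW
      have e25 : eval σ' (add (var 26) (lit 1)) = t + 1 := by simp [h26]
      refine Runs.assign_seq (5 * q + 40) (by simp only [Expr.cost, Expr.add]; omega) (by decide)
        (fun _ => by rw [e25]; omega) ?_
      rw [e25]
      refine Runs.seq_le _ 30 _ (by omega) (Runs.powProg (y := t + 1) (by omega) (by simp) q hle)
        fun _ _ h => ?_
      subst h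
      have ev : eval ((σ'.setReg 25 (t + 1)).setReg 24 ((t + 1) ^ q)) (lt (var 2) (var 24)) =
          if m < (t + 1) ^ q then 1 else 0 := by
        simp [hfr 2 (by omega), h2]
      refine Runs.branch_le 20 (by decide) (by decide) (fun hne => ?_) fun h0 => ?_
      · have hlt : m < (t + 1) ^ q := by
          by_contra hc; rw [ev, if_neg hc] at hne; exact hne rfl
        refine (Runs.skip ⟨by simp [h15], ⟨?_, hmem, fun r hr => ?_⟩, by simp⟩).mono (by omega)
          fun _ _ h => h
        · rw [climb, if_neg (by rw [← ht]; omega)]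
          simp [h26, ht]
        · simp only [State.reg_setReg]
          rw [if_neg (by omega), if_neg (by omega), if_neg (by omega), hfr r hr]
      · have hlt : ¬ m < (t + 1) ^ q := by
          intro hc; rw [ev, if_pos hc] at h0; exact one_ne_zero h0
        refine (Runs.assign (by decide) (fun _ => by simp; omega)
          ⟨by simp [h15], ⟨?_, hmem, fun r hr => ?_⟩, by simp⟩).mono (by decide) fun _ _ h => h
        · rw [climb, if_pos (by rw [← ht]; omega)]
          simp [ht]
        · simp only [State.reg_setReg]
          rw [if_neg (by omega), if_neg (by omega), if_neg (by omega), if_neg (by omega), hfr r hr]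
  · rintro σ₁ - ⟨h26, hmem, hfr⟩
    obtain ⟨c1, c2, -, -⟩ := climb_spec (q := q) (m := m) (t := t₀) m
    set t := climb q m t₀ m with ht
    have hpow : ∀ e ≤ q, t ^ e ≤ W := fun e he =>
      (Nat.pow_le_pow_right (by omega) he).trans ((Nat.pow_le_pow_left (by omega) q).trans hW)
    refine Runs.assign_seq (30 * m + 5 * q + 70) (by simp only [Expr.cost]; omega) (by decide)
      (fun hbd => hbd.2.1 26 (by decide)) ?_
    rw [eval_var, h26]
    refine Runs.seq_le (5 * b + 1) (5 * a + 60) _ (by omega)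
      (Runs.powProg (y := t) (by omega) (by simp) b (hpow b (by omega))) fun _ _ h => ?_
    subst h
    refine Runs.assign_seq (5 * a + 50) (by simp only [Expr.cost]; omega) (by decide)
      (fun hbd => hbd.2.1 24 (by decide)) ?_
    refine Runs.seq_le (5 * a + 1) 20 _ (by omega)
      (Runs.powProg (y := t) (by omega) (by simp) a (hpow a (by omega))) fun _ _ h => ?_
    subst h
    refine (Runs.assign (by decide) (fun hbd => hbd.2.1 24 (by decide))
      ⟨by simp, by simp, hmem, fun r hr => ?_⟩).mono (by decide) fun _ _ h => h
    simp only [State.reg_setReg]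
    rw [if_neg (by omega), if_neg (by omega), if_neg (by omega), if_neg (by omega),
      if_neg (by omega), hfr r hr]

end WordRAM

/-- For `n' = t ^ b` the power `n' ^ (a / b)` is the integer `t ^ a`. With `t` about the `(a +
b)`-th root of `m`, both lengths are at most `m ≤ n` up to constants and at least a fixed power of
`n`. -/
theorem hasSelection_rat {γ₀ ω : ℝ} (hγ₀ : 0 < γ₀) (hγ₁ : γ₀ < 1) (hω : 0 < ω) {a b : ℕ}
    (ha : 1 ≤ a) (hb : 1 ≤ b) : HasSelection γ₀ ω ((a : ℝ) / b) (γ₀ / (a + b : ℕ)) := by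
  have hq : (0 : ℝ) < (a + b : ℕ) := by exact_mod_cast (by omega : 0 < a + b)
  have hε : 0 < γ₀ / (a + b : ℕ) := div_pos hγ₀ hq
  obtain ⟨N, hN1, hN⟩ := exists_log_le_rpow hω hε
  -- This lower bound for `t` makes room for a gadget when `n < N`; for larger `n` the root itself
  -- suffices.
  set t₀ := 4 * ⌈ω * Real.log N⌉₊ + 22 with ht₀
  refine ⟨selectPow a b t₀, t₀ ^ a + t₀ ^ b, (t₀ + 1) * (a + b), 2 * (5 * (a + b) + 100),
    fun n m d hn hm hd => ?_⟩
  have hn1 : (1 : ℝ) ≤ n := by exact_mod_cast hn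
  have hm1 : 1 ≤ m := by rw [hm]; exact one_le_ceil_rpow hn
  have hmn : m ≤ n := by
    rw [hm, Nat.ceil_le]
    simpa using Real.rpow_le_rpow_of_exponent_le hn1 hγ₁.le
  obtain ⟨c1, c2, c3, -⟩ := climb_spec (q := a + b) (m := m) (t := t₀) m
  have c4 := lt_climb_succ_pow (q := a + b) (m := m) (t := t₀) (by omega)
  have hsel := fun (W : ℕ) hW => selects_selectPow (W := W) (n := n) (m := m) (d := d)
    (t₀ := t₀) (by omega) ha hb hW
  generalize climb (a + b) m t₀ m = t at *
  have hta : t ≤ t ^ a := Nat.le_self_pow (by omega) t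
  have htb : t ≤ t ^ b := Nat.le_self_pow (by omega) t
  have hroot : (n : ℝ) ^ (γ₀ / (a + b : ℕ)) ≤ t + 1 := by
    have h1 : (n : ℝ) ^ γ₀ ≤ ((t : ℝ) + 1) ^ (a + b : ℕ) := by
      have h2 : (n : ℝ) ^ γ₀ ≤ m := by rw [hm]; exact Nat.le_ceil _
      exact h2.trans (by exact_mod_cast c4.le)
    calc (n : ℝ) ^ (γ₀ / (a + b : ℕ)) = ((n : ℝ) ^ γ₀) ^ (1 / ((a + b : ℕ) : ℝ)) := by
          rw [← Real.rpow_mul (by linarith)]; ring_nf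
      _ ≤ (((t : ℝ) + 1) ^ (a + b : ℕ)) ^ (1 / ((a + b : ℕ) : ℝ)) :=
          Real.rpow_le_rpow (by positivity) h1 (by positivity)
      _ = t + 1 := by
          rw [← Real.rpow_natCast, ← Real.rpow_mul (by positivity), mul_one_div_cancel hq.ne',
            Real.rpow_one]
  have hdt : 4 * d + 22 ≤ t := by
    rcases Nat.lt_or_ge n N with h | h
    · have := ceil_log_mono hω hn h.le
      omega
    · have := (hN n h).trans hroot
      have : 4 * ⌈ω * Real.log n⌉₊ + 23 ≤ t + 1 := by exact_mod_cast this
      omega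
  have ht1 : (1 : ℝ) ≤ t := by exact_mod_cast (by omega : 1 ≤ t)
  -- Either the search never left `t₀`, and the power is a constant, or `t ^ (a + b) ≤ m`.
  have hle : ∀ e, 1 ≤ e → e ≤ a + b → t ^ e ≤ t₀ ^ e ∨ t ^ e ≤ m := fun e he1 he2 => by
    rcases c3 with rfl | h
    · exact .inl le_rfl
    · exact .inr ((Nat.pow_le_pow_right (by omega) he2).trans h)
  have hroot' : ∀ e, 1 ≤ e →
      (n : ℝ) ^ (γ₀ / (a + b : ℕ)) ≤ 2 * (5 * (a + b) + 100) * ((t ^ e : ℕ) : ℝ) := fun e he => by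
    have h1 : (t : ℝ) ≤ ((t ^ e : ℕ) : ℝ) := by
      exact_mod_cast Nat.le_self_pow (by omega : e ≠ 0) t
    have h2 : (0 : ℝ) ≤ a + b := by positivity
    nlinarith
  refine ⟨t ^ b, t ^ a, (5 * (a + b) + 100) * (m + 1), ?_, by omega, by omega, ?_, ?_,
    hroot' b hb, hroot' a ha, ?_, fun W hW => hsel W (le_trans ?_ hW)⟩
  · have hb0 : (b : ℝ) ≠ 0 := by exact_mod_cast (by omega : b ≠ 0)
    have : ((t ^ b : ℕ) : ℝ) ^ ((a : ℝ) / b) = ((t ^ a : ℕ) : ℝ) := by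
      push_cast
      rw [← Real.rpow_natCast, ← Real.rpow_mul (by positivity), mul_div_cancel₀ _ hb0,
        Real.rpow_natCast]
    rw [this, Nat.ceil_natCast]
  · rcases hle b hb (by omega) with h | h
    · nlinarith [Nat.zero_le (t₀ ^ a)]
    · have : 1 ≤ t₀ ^ a + t₀ ^ b := by have := Nat.one_le_pow a t₀ (by omega); omega
      nlinarith
  · rcases hle a ha (by omega) with h | h
    · nlinarith [Nat.zero_le (t₀ ^ b)]
    · have : 1 ≤ t₀ ^ a + t₀ ^ b := by have := Nat.one_le_pow a t₀ (by omega); omega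
      nlinarith
  · have hm1' : (1 : ℝ) ≤ m := by exact_mod_cast hm1
    -- Here `γ₀ < 1` enters: `m ≤ n`, so a search of linear time in `m` is cheap enough.
    have h1 : (m : ℝ) ≤ (n * m : ℝ) ^ (1 / 2 : ℝ) := by
      rw [← Real.sqrt_eq_rpow]
      refine Real.le_sqrt_of_sq_le ?_
      have : (m : ℝ) ≤ n := by exact_mod_cast hmn
      nlinarith
    have h2 : (0 : ℝ) ≤ 5 * (a + b) + 100 := by positivity
    push_cast
    nlinarith
  · rw [pow_mul]
    refine Nat.pow_le_pow_left ?_ _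
    rw [pow_succ]
    have : t₀ < (5 + n + m) ^ t₀ := Nat.lt_pow_self (by omega)
    nlinarith

/-! ### The hardness theorem -/

theorem mainTheorem1 :
    ∃ K : ℕ,
      (OVH → ∀ γ : ℚ, 0 < γ → ∀ δ : ℝ, 0 < δ → δ < 1 → ∀ c : ℝ, 1 ≤ c → c < 5 / 4 →
        ¬ FrechetApproximable K γ δ c) ∧
      (∀ γ : ℝ, 0 < γ → OVHAt γ → ∀ δ : ℝ, 0 < δ → δ < 1 → ∀ c : ℝ, 1 ≤ c → c < 5 / 4 →
        ¬ FrechetApproximable K γ δ c) := by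
  have key : ∀ γ₀ γ ε : ℝ, 0 < γ₀ → 0 < ε → (∀ ω, 0 < ω → HasSelection γ₀ ω γ ε) → OVHAt γ₀ →
      ∀ δ : ℝ, 0 < δ → δ < 1 → ∀ c : ℝ, c < 5 / 4 → ¬ FrechetApproximable 3 γ δ c := by
    intro γ₀ γ ε hγ₀ hε hsel hov δ hδ hδ1 c hc hF
    obtain ⟨ω, hω, hno⟩ := hov (min (1 / 2) (ε * δ / (2 * (1 + γ₀)))) (by positivity)
    exact hno (ovSolvable_of_selection hγ₀ hω hε hδ hδ1 hc (hsel ω hω) hF)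
  -- Three vertices per row and two hubs: the `n + m - 2` rows give fewer than `3 * (n + m)`
  -- vertices.
  refine ⟨3, ?_, ?_⟩
  · rintro ⟨γ₀, h0, h1, hov⟩ γ hγ δ hδ hδ1 c _ hc
    have ha : 1 ≤ γ.num.toNat := by have := Rat.num_pos.2 hγ; omega
    have hγ' : (γ : ℝ) = (γ.num.toNat : ℝ) / γ.den := by
      rw [Rat.cast_def]
      congr 1
      exact_mod_cast (Int.toNat_of_nonneg (Rat.num_pos.2 hγ).le).symm
    rw [hγ']
    exact key γ₀ _ _ h0 (div_pos h0 (by exact_mod_cast (by omega)))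
      (fun ω hω => hasSelection_rat h0 h1 hω ha γ.pos) hov δ hδ hδ1 c hc
  · intro γ hγ hov δ hδ hδ1 c _ hc
    exact key γ γ _ hγ (lt_min one_pos hγ) (fun ω hω => hasSelection_same hγ hω) hov δ hδ hδ1 c hc
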